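/- **Frequency regularity criterion.** Let $d\ge 3$ and fix a smooth radial cutoff $\chi:\mathbb R^d\to[0,1]$ with $\chi(\xi)=1$ for $|\xi|\le 3/4$ and $\chi(\xi)=0$ for $|\xi|\ge 4/3$. For $J\in\mathbb R$ let $\Delta_{<J}=\chi(2^{-J}D)$, i.e. convolution with $2^{Jd}h(2^J\cdot)$, where $h(x)=(2\pi)^{-d}\int e^{ix\cdot\xi}\chi(\xi)\,d\xi$. Let $L^p_\sigma$ be the space of vector fields in $L^p(\mathbb R^d;\mathbb R^d)$ with vanishing distributional divergence. A mild solution of the Navier–Stokes equations on $(0,T_1)$ with data $u_0\in L^p_\sigma$ is $u\in C((0,T_1);L^p)$, bounded in $L^p$ on $(0,T']$ for every $T'<T_1$, such that for all $t\in(0,T_1)$ $$u(t)=e^{t\Delta}u_0-\int_0^t e^{(t-s)\Delta}\,\mathbb P\,\nabla\cdot(u\otimes u)(s)\,ds ,$$ where $\mathbb P$ is the Leray projection. There is a constant $K>0$ depending only on $d$ and $\chi$, and for every $p$ with $d<p\le\infty$ there are constants $c_0\in(0,1]$ and $C>0$ depending only on $d,p,\chi$, such that the following holds for every $c_p\in(0,c_0]$.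 Let $u_0\in L^p_\sigma$ and $T_0>0$, and let $\gamma>0$ and $T>0$ be defined by $$\|u_0\|_{L^p}\,T_0^{\frac12(1-\frac dp)}\,\gamma=c_p,\qquad \|u_0\|_{L^p}\,T^{\frac12(1-\frac dp)}=\frac{\gamma}{2C}.$$ If $$\|\Delta_{<J}u_0\|_{L^p}\le\frac\gamma2\,\|u_0\|_{L^p}\qquad\text{for some } J\in\mathbb R \text{ with } 2^J\ge K\gamma^{-1}T^{-1/2},$$ then there is $T_1>T_0$ such that a mild solution $u$ with data $u_0$ exists on $(0,T_1)$ and is $C^\infty$ on $\mathbb R^d\times(0,T_1)$; it is unique: for every $T'\le T_1$, every mild solution on $(0,T')$ with data $u_0$ agrees with $u(t)$ almost everywhere for each $t\in(0,T')$. -/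

import Mathlib

open MeasureTheory Set Filter Topology
open scoped ENNReal ContDiff FourierTransform

noncomputable section

namespace NSFreq

/-- Euclidean space `ℝᵈ`. -/
abbrev E (d : ℕ) : Type := EuclideanSpace ℝ (Fin d)

/-! ### Littlewood-Paley low-frequency truncation -/

/-- A standard inhomogeneous Littlewood-Paley cutoff `χ`: smooth, radial, with values in `[0,1]`,
equal to `1` for `|ξ| ≤ 3/4` and to `0` for `|ξ| ≥ 4/3`.  The dyadic symbols are
`φ(2⁻ʲ ξ)` with `φ(ξ) = χ(ξ/2) - χ(ξ)`, supported in `3/4 ≤ |ξ| ≤ 8/3`, and the sum of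
`φ(2⁻ʲ ξ)` over the integers `j < J` telescopes to `χ(2⁻ᴶ ξ)` for every `ξ ≠ 0`. -/
structure IsLowFrequencyCutoff {d : ℕ} (χ : E d → ℝ) : Prop where
  smooth : ContDiff ℝ ∞ χ
  mem_Icc : ∀ ξ, χ ξ ∈ Icc (0 : ℝ) 1
  radial : ∀ ξ η, ‖ξ‖ = ‖η‖ → χ ξ = χ η
  eq_one : ∀ ξ, ‖ξ‖ ≤ 3 / 4 → χ ξ = 1
  eq_zero : ∀ ξ, 4 / 3 ≤ ‖ξ‖ → χ ξ = 0

/-- The Schwartz kernel `h(x) = (2π)⁻ᵈ ∫ e^{i x·ξ} χ(ξ) dξ` of the multiplier `χ(D)`.  (The factor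
`2π` in the argument converts the normalization `e^{2π i x·ξ}` of the inverse Fourier transform;
the kernel is real because `χ` is radial.) -/
def lowFreqKernel {d : ℕ} (χ : E d → ℝ) (x : E d) : ℝ :=
  (𝓕⁻ (fun ξ : E d => ((χ ((2 * Real.pi) • ξ) : ℝ) : ℂ)) x).re

/-- `Δ_{<J} f`, the Fourier multiplier `χ(2⁻ᴶ D)`, that is, convolution with
`2^{Jd} h(2ᴶ ·)`, for real `J`. -/
def lowFreq {d : ℕ} (χ : E d → ℝ) (J : ℝ) (f : E d → E d) (x : E d) : E d :=
  ∫ y, ((2 : ℝ) ^ (J * d) * lowFreqKernel χ ((2 : ℝ) ^ J • (x - y))) • f y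

/-- `f` is `(β, J)`-sparse in frequency in `Lᵖ`: `‖Δ_{<J} f‖_p ≤ β ‖f‖_p`. -/
def SparseInFrequency {d : ℕ} (χ : E d → ℝ) (p : ℝ≥0∞) (β J : ℝ) (f : E d → E d) : Prop :=
  eLpNorm (lowFreq χ J f) p volume ≤ ENNReal.ofReal β * eLpNorm f p volume

/-! ### Solenoidal `Lᵖ` fields -/

/-- `f ∈ Lᵖ_σ(ℝᵈ)`: `f` is in `Lᵖ` and its distributional divergence vanishes. -/
def MemLpSigma {d : ℕ} (p : ℝ≥0∞) (f : E d → E d) : Prop :=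
  MemLp f p volume ∧
    ∀ φ : E d → ℝ, ContDiff ℝ ∞ φ → HasCompactSupport φ →
      ∫ x, fderiv ℝ φ x (f x) = 0

/-! ### Heat and Oseen kernels -/

/-- The heat kernel `(4πt)^{-d/2} exp(-|x|²/(4t))`. -/
def heatKernel {d : ℕ} (t : ℝ) (x : E d) : ℝ :=
  (4 * Real.pi * t) ^ (-(d : ℝ) / 2) * Real.exp (-‖x‖ ^ 2 / (4 * t))

/-- The heat semigroup `e^{tΔ} f`, for `t > 0`. -/
def heat {d : ℕ} (t : ℝ) (f : E d → E d) (x : E d) : E d :=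
  ∫ y, heatKernel t (x - y) • f y

/-- The partial derivative `∂ᵢ f`. -/
def pderiv {d : ℕ} (i : Fin d) (f : E d → ℝ) (x : E d) : ℝ :=
  fderiv ℝ f x (EuclideanSpace.single i 1)

/-- The convolution kernel of `F ↦ (e^{tΔ} ℙ ∇·F)ᵢ` acting on the component `Fⱼₖ`, where
`(∇·F)ⱼ = ∑ₖ ∂ₖ Fⱼₖ` and `ℙ` is the Leray projection.  Its symbol is
`i ξₖ (δᵢⱼ - ξᵢ ξⱼ / |ξ|²) e^{-t|ξ|²}`; since `|ξ|⁻² e^{-t|ξ|²} = ∫_t^∞ e^{-s|ξ|²} ds`, the kernel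
is `δᵢⱼ ∂ₖ G_t + ∫_t^∞ ∂ᵢ ∂ⱼ ∂ₖ G_s ds` with `G` the heat kernel. -/
def oseenKernel {d : ℕ} (t : ℝ) (i j k : Fin d) (x : E d) : ℝ :=
  (if i = j then pderiv k (heatKernel t) x else 0) +
    ∫ s in Ioi t, pderiv i (pderiv j (pderiv k (heatKernel s))) x

/-- `e^{tΔ} ℙ ∇·(v ⊗ v)`, for `t > 0`. -/
def oseenQuadratic {d : ℕ} (t : ℝ) (v : E d → E d) (x : E d) : E d :=
  WithLp.toLp 2 fun i : Fin d =>
    ∑ j : Fin d, ∑ k : Fin d, ∫ y, oseenKernel t i j k (x - y) * (v y j * v y k)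

/-! ### Mild solutions -/

/-- `u` is a mild solution in `C((0,T); Lᵖ)` of the Navier-Stokes equations
`∂ₜ u - Δ u + u·∇u + ∇π = 0`, `div u = 0` with initial data `u₀`: a continuous curve in `Lᵖ`,
bounded in `Lᵖ` up to the initial time (and on each `(0,T']`, `T' < T`), which satisfies
`u(t) = e^{tΔ} u₀ - ∫₀ᵗ e^{(t-s)Δ} ℙ ∇·(u ⊗ u)(s) ds`. -/
structure IsMildSolution {d : ℕ} (p : ℝ≥0∞) (u₀ : E d → E d) (T : ℝ) (u : ℝ → E d → E d) :
    Prop where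
  memLp : ∀ t ∈ Ioo 0 T, MemLp (u t) p volume
  continuous : ∀ t ∈ Ioo 0 T, Tendsto (fun s => eLpNorm (u s - u t) p volume) (𝓝 t) (𝓝 0)
  bounded : ∀ T' < T, ∃ M : ℝ, ∀ t ∈ Ioc 0 T', eLpNorm (u t) p volume ≤ ENNReal.ofReal M
  duhamel : ∀ t ∈ Ioo 0 T, ∀ᵐ x ∂(volume : Measure (E d)),
    u t x = heat t u₀ x - ∫ s in (0 : ℝ)..t, oseenQuadratic (t - s) (u s) x

/-- `u` is smooth in space and time on `ℝᵈ × (0,T)`. -/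
def SmoothOn {d : ℕ} (T : ℝ) (u : ℝ → E d → E d) : Prop :=
  ContDiffOn ℝ ∞ (fun z : ℝ × E d => u z.1 z.2) (Ioo 0 T ×ˢ univ)

/-- The unique mild solution in `Lᵖ` with data `u₀` exists and is smooth on `ℝᵈ × (0,T)`. -/
def UniqueSmoothMildSolution {d : ℕ} (p : ℝ≥0∞) (u₀ : E d → E d) (T : ℝ) : Prop :=
  ∃ u : ℝ → E d → E d, IsMildSolution p u₀ T u ∧ SmoothOn T u ∧
    ∀ T' ≤ T, ∀ v : ℝ → E d → E d, IsMildSolution p u₀ T' v →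
      ∀ t ∈ Ioo 0 T', v t =ᵐ[volume] u t

/-- The exponent `½ (1 - d/p)`, for `0 < p ≤ ∞` (equal to `½` for `p = ∞`). -/
def scalingExponent (d : ℕ) (p : ℝ≥0∞) : ℝ := (1 - ((d : ℝ≥0∞) / p).toReal) / 2

end NSFreq

end

/-! Put s = ½(1 - d/p), which lies in (0, 1], and let q be the exponent conjugate to p. By parabolic
scaling the Oseen kernel at time t has L^q norm O(t^{s-1}). Hölder (Lᵖ × Lᵖ into L^{p/2}) and Young
(L^q * L^{p/2} into Lᵖ) then bound the bilinear operator e^{tΔ}ℙ∇·(v ⊗ w) on Lᵖ by M t^{s-1}, which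
is integrable at t = 0 (`norm_bilinOp_le`). A contraction argument gives a solution on (0, δ) with
norm at most 2‖u₀‖ as soon as 8 M (δ^s/s) ‖u₀‖ ≤ 1 (`exists_sol`).

The criterion is a restart at time T (`exists_sol_of_heat_le`). If γ ≥ 1, the smallness of c_p
already gives existence beyond T₀ from the data u₀. If γ < 1, the choice of T makes the Duhamel term
at T at most (γ/4)‖u₀‖. In the linear term, Δ_{<J}u₀ contributes at most (γ/2)‖u₀‖. On the remaining
frequencies e^{TΔ}(1 - Δ_{<J}) has norm O(2^{-J} T^{-1/2}), because the kernel of Δ_{<J} has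
integral one and first moment O(2^{-J}) (`exists_norm_heatOp_le`); this contributes at most
(γ/4)‖u₀‖. Hence ‖u(T)‖ ≤ γ‖u₀‖, and the solution restarted from u(T) lives for time 2T₀. Uniqueness
(`IsSol.unique`) needs no smallness: the difference of two bounded solutions obeys a Volterra
inequality with an integrable kernel.

Smoothness comes from the implicit function theorem. Dilating time by λ and translating with
velocity a turns a solution V into τ ↦ V(λτ)(· + τa), which solves an equation depending smoothly on
(λ, a). So (t, y) ↦ u(t)(· + y) is a smooth map into Lᵖ (`IsSol.contDiffOn_orbit`). Pointwise values
are recovered from f(0) = (e^{Δ}f)(0) - ∫₀¹ (e^{rΔ}Δf)(0) dr, whose two terms are bounded linear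
functionals of f and of Δf in Lᵖ (`exists_smooth_representative`).

Two devices recur. Smoothness of kernel curves is deduced from the semigroup law
(`contDiffOn_of_map_add`), so one derivative suffices. Functions of time are bounded continuous
functions of log t, so nothing is asked at t = 0, where the heat semigroup on L^∞ is not strongly
continuous. -/

set_option maxSynthPendingDepth 3

/-! ### Young's inequality and convolution as a bounded bilinear map of Lebesgue spaces. -/

noncomputable section

namespace NSFreq

variable {d : ℕ}

/-- The exponent relation `1/a + 1/b = 1 + 1/c` of Young's convolution inequality. -/
class YoungTriple (a b c : ℝ≥0∞) : Prop where
  inv_add_inv : a⁻¹ + b⁻¹ = 1 + c⁻¹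

/-- Three-factor Hölder: k f = (k^a f^b)^{1/c} (k^a)^{1/a-1/c} (f^b)^{1/b-1/c}, where the exponents
add up to one by the Young relation. Only the first factor still depends jointly on x and t, and
Tonelli integrates it. -/
theorem lintegral_convolution_rpow_le {a b c : ℝ} (ha : 0 < a) (hb : 0 < b) (hac : a ≤ c)
    (hbc : b ≤ c) (h : 1 / a + 1 / b = 1 + 1 / c) {k f : E d → ℝ≥0∞} (hk : Measurable k)
    (hf : Measurable f) :
    ∫⁻ x, (∫⁻ t, k t * f (x - t)) ^ c ≤
      (∫⁻ x, k x ^ a) ^ (c / a) * (∫⁻ x, f x ^ b) ^ (c / b) := by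
  have hc : 0 < c := ha.trans_le hac
  set A := ∫⁻ x, k x ^ a
  set B := ∫⁻ x, f x ^ b
  have hα : 0 ≤ 1 / a - 1 / c := sub_nonneg.2 (one_div_le_one_div_of_le ha hac)
  have hβ : 0 ≤ 1 / b - 1 / c := sub_nonneg.2 (one_div_le_one_div_of_le hb hbc)
  have hpt : ∀ x, (∫⁻ t, k t * f (x - t)) ^ c ≤
      (∫⁻ t, k t ^ a * f (x - t) ^ b) * (A ^ (c / a - 1) * B ^ (c / b - 1)) := by
    intro x
    have hfx : Measurable fun t => f (x - t) := hf.comp (measurable_const.sub measurable_id)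
    have key := ENNReal.lintegral_prod_norm_pow_le (μ := (volume : Measure (E d)))
      (Finset.univ : Finset (Fin 3))
      (f := ![fun t => k t ^ a * f (x - t) ^ b, fun t => k t ^ a, fun t => f (x - t) ^ b])
      (p := ![1 / c, 1 / a - 1 / c, 1 / b - 1 / c]) (by
        intro i _
        fin_cases i
        · exact ((hk.pow_const a).mul (hfx.pow_const b)).aemeasurable
        · exact (hk.pow_const a).aemeasurable
        · exact (hfx.pow_const b).aemeasurable) (by
        rw [Fin.sum_univ_three]; simp only [Matrix.cons_val]; linarith) (by
        intro i _
        fin_cases i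
        · exact (one_div_pos.2 hc).le
        · exact hα
        · exact hβ)
    simp only [Fin.prod_univ_three, Matrix.cons_val] at key
    have e1 : ∀ t, (k t ^ a * f (x - t) ^ b) ^ (1 / c) * (k t ^ a) ^ (1 / a - 1 / c) *
        (f (x - t) ^ b) ^ (1 / b - 1 / c) = k t * f (x - t) := by
      intro t
      rw [ENNReal.mul_rpow_of_nonneg _ _ (one_div_pos.2 hc).le]
      have h1 : (k t ^ a) ^ (1 / c) * (k t ^ a) ^ (1 / a - 1 / c) = k t := by
        rw [← ENNReal.rpow_add_of_nonneg _ _ (one_div_pos.2 hc).le hα, ← ENNReal.rpow_mul]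
        simp [ha.ne']
      have h2 : (f (x - t) ^ b) ^ (1 / c) * (f (x - t) ^ b) ^ (1 / b - 1 / c) = f (x - t) := by
        rw [← ENNReal.rpow_add_of_nonneg _ _ (one_div_pos.2 hc).le hβ, ← ENNReal.rpow_mul]
        simp [hb.ne']
      nth_rw 3 [← h1]
      nth_rw 3 [← h2]
      ring
    simp only [e1] at key
    have e2 : ∫⁻ t, f (x - t) ^ b = B := lintegral_sub_left_eq_self (fun t => f t ^ b) x
    rw [e2] at key
    refine (ENNReal.rpow_le_rpow key hc.le).trans (le_of_eq ?_)
    rw [mul_assoc, ENNReal.mul_rpow_of_nonneg _ _ hc.le, ENNReal.mul_rpow_of_nonneg _ _ hc.le,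
      ← ENNReal.rpow_mul, ← ENNReal.rpow_mul, ← ENNReal.rpow_mul]
    have h1 : 1 / c * c = 1 := by field_simp
    have h2 : (1 / a - 1 / c) * c = c / a - 1 := by field_simp
    have h3 : (1 / b - 1 / c) * c = c / b - 1 := by field_simp
    rw [h1, h2, h3, ENNReal.rpow_one]
  have hm : Measurable (Function.uncurry fun x t => k t ^ a * f (x - t) ^ b) := by
    exact ((hk.pow_const a).comp measurable_snd).mul
      ((hf.pow_const b).comp (measurable_fst.sub measurable_snd))
  calc ∫⁻ x, (∫⁻ t, k t * f (x - t)) ^ c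
      ≤ ∫⁻ x, (∫⁻ t, k t ^ a * f (x - t) ^ b) * (A ^ (c / a - 1) * B ^ (c / b - 1)) :=
        lintegral_mono hpt
    _ = (∫⁻ x, ∫⁻ t, k t ^ a * f (x - t) ^ b) * (A ^ (c / a - 1) * B ^ (c / b - 1)) := by
        rw [lintegral_mul_const]
        exact hm.lintegral_prod_right'
    _ = (A * B) * (A ^ (c / a - 1) * B ^ (c / b - 1)) := by
        rw [lintegral_lintegral_swap hm.aemeasurable]
        congr 1
        have : ∀ t, ∫⁻ x, k t ^ a * f (x - t) ^ b = k t ^ a * B := by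
          intro t
          rw [lintegral_const_mul]
          · rw [lintegral_sub_right_eq_self (fun x => f x ^ b) t]
          · exact (hf.pow_const b).comp (measurable_id.sub_const t)
        simp_rw [this]
        rw [lintegral_mul_const]
        exact hk.pow_const a
    _ = A ^ (c / a) * B ^ (c / b) := by
        have h1 : 0 ≤ c / a - 1 := sub_nonneg.2 ((one_le_div ha).2 hac)
        have h2 : 0 ≤ c / b - 1 := sub_nonneg.2 ((one_le_div hb).2 hbc)
        have e1 : A * A ^ (c / a - 1) = A ^ (c / a) := by
          nth_rw 1 [← ENNReal.rpow_one A]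
          rw [← ENNReal.rpow_add_of_nonneg _ _ zero_le_one h1]; congr 1; ring
        have e2 : B * B ^ (c / b - 1) = B ^ (c / b) := by
          nth_rw 1 [← ENNReal.rpow_one B]
          rw [← ENNReal.rpow_add_of_nonneg _ _ zero_le_one h2]; congr 1; ring
        rw [mul_mul_mul_comm, e1, e2]

/-- Since 1/a and 1/b are at most one, the relation forces 1/c ≤ 1/a and 1/c ≤ 1/b. Thus c = ∞ is
the only case in which infinite exponents occur. -/
theorem YoungTriple.top_cases {a b c : ℝ≥0∞} [hy : YoungTriple a b c] [ha : Fact (1 ≤ a)]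
    [hb : Fact (1 ≤ b)] (hc : c ≠ ⊤) :
    a ≠ ⊤ ∧ b ≠ ⊤ ∧ a ≤ c ∧ b ≤ c := by
  have h := hy.inv_add_inv
  have ha1 : a⁻¹ ≤ 1 := ENNReal.inv_le_one.2 ha.out
  have hb1 : b⁻¹ ≤ 1 := ENNReal.inv_le_one.2 hb.out
  have hac : c⁻¹ ≤ a⁻¹ := by
    have : 1 + c⁻¹ ≤ 1 + a⁻¹ := by
      rw [← h, add_comm]; gcongr
    exact (ENNReal.add_le_add_iff_left ENNReal.one_ne_top).1 this
  have hbc : c⁻¹ ≤ b⁻¹ := by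
    have : 1 + c⁻¹ ≤ 1 + b⁻¹ := by
      rw [← h]; gcongr
    exact (ENNReal.add_le_add_iff_left ENNReal.one_ne_top).1 this
  have h1 := ENNReal.inv_le_inv.1 hac
  have h2 := ENNReal.inv_le_inv.1 hbc
  exact ⟨ne_top_of_le_ne_top hc h1, ne_top_of_le_ne_top hc h2, h1, h2⟩

/-- Young's inequality for the convolution of nonnegative functions. -/
theorem young_lintegral {a b c : ℝ≥0∞} [hy : YoungTriple a b c] [ha : Fact (1 ≤ a)]
    [hb : Fact (1 ≤ b)] [hc : Fact (1 ≤ c)] {K F : Type*} [NormedAddCommGroup K]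
    [NormedAddCommGroup F] {k : E d → K} {f : E d → F} (hk : AEStronglyMeasurable k volume)
    (hf : AEStronglyMeasurable f volume) :
    eLpNorm (fun x => ∫⁻ t, ‖k t‖ₑ * ‖f (x - t)‖ₑ) c volume ≤
      eLpNorm k a volume * eLpNorm f b volume := by
  wlog hmeas : StronglyMeasurable k ∧ StronglyMeasurable f generalizing k f
  -- The integral sees only the almost everywhere classes, because t ↦ x - t preserves null sets.
  · have := this hk.stronglyMeasurable_mk.aestronglyMeasurable
      hf.stronglyMeasurable_mk.aestronglyMeasurable
      ⟨hk.stronglyMeasurable_mk, hf.stronglyMeasurable_mk⟩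
    rw [eLpNorm_congr_ae hk.ae_eq_mk, eLpNorm_congr_ae hf.ae_eq_mk]
    convert this using 2
    ext x
    refine lintegral_congr_ae ?_
    filter_upwards [hk.ae_eq_mk, (quasiMeasurePreserving_sub_left_of_right_invariant
      (volume : Measure (E d)) x).ae hf.ae_eq_mk] with t h1 h2
    rw [h1, h2]
  obtain ⟨hkm, hfm⟩ := hmeas
  have hkm' : Measurable fun x => ‖k x‖ₑ := hkm.enorm
  have hfm' : Measurable fun x => ‖f x‖ₑ := hfm.enorm
  have hc0 : c ≠ 0 := (zero_lt_one.trans_le hc.out).ne'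
  have ha0 : a ≠ 0 := (zero_lt_one.trans_le ha.out).ne'
  have hb0 : b ≠ 0 := (zero_lt_one.trans_le hb.out).ne'
  by_cases hct : c = ⊤
  · subst hct
    rw [eLpNorm_exponent_top]
    refine essSup_le_of_ae_le _ (Eventually.of_forall fun x => ?_)
    have h := hy.inv_add_inv
    -- For c = ∞ the Young relation is Hölder conjugacy, and the bound holds at every x.
    have : ENNReal.HolderTriple a b 1 := ⟨by simpa using h⟩
    have key := eLpNorm_le_eLpNorm_mul_eLpNorm_of_nnnorm (p := a) (q := b) (r := 1)
      (μ := (volume : Measure (E d))) (f := fun t => ‖k t‖) (g := fun t => ‖f (x - t)‖)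
      hkm.norm.aestronglyMeasurable
      ((hfm.comp_measurable (measurable_const.sub measurable_id)).norm.aestronglyMeasurable)
      (fun u v => u * v) 1 (Eventually.of_forall fun t => by simp)
    rw [eLpNorm_one_eq_lintegral_enorm] at key
    simp only [enorm_mul, enorm_norm, eLpNorm_norm, ENNReal.coe_one, one_mul] at key
    refine (le_of_eq ?_).trans (key.trans (le_of_eq ?_))
    · simp
    · congr 1
      have hmp : MeasurePreserving (fun t : E d => x - t) volume volume :=
        Measure.measurePreserving_sub_left volume x
      have := eLpNorm_comp_measurePreserving (p := b) hfm.aestronglyMeasurable hmp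
      exact this
  · obtain ⟨hat, hbt, hac, hbc⟩ := YoungTriple.top_cases (a := a) (b := b) hct
    rw [eLpNorm_eq_lintegral_rpow_enorm_toReal hc0 hct, eLpNorm_eq_lintegral_rpow_enorm_toReal ha0 hat,
      eLpNorm_eq_lintegral_rpow_enorm_toReal hb0 hbt]
    have hra := ENNReal.toReal_pos ha0 hat
    have hrb := ENNReal.toReal_pos hb0 hbt
    have hrc := ENNReal.toReal_pos hc0 hct
    have hrel : 1 / a.toReal + 1 / b.toReal = 1 + 1 / c.toReal := by
      have h := congrArg ENNReal.toReal hy.inv_add_inv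
      rw [ENNReal.toReal_add (by simpa) (by simpa), ENNReal.toReal_add (by simp) (by simpa)] at h
      simpa [ENNReal.toReal_inv] using h
    have key := lintegral_convolution_rpow_le hra hrb (ENNReal.toReal_mono hct hac)
      (ENNReal.toReal_mono hct hbc) hrel hkm' hfm'
    have := ENNReal.rpow_le_rpow key (one_div_pos.2 hrc).le
    simp only [enorm_eq_self]
    refine this.trans (le_of_eq ?_)
    rw [ENNReal.mul_rpow_of_nonneg _ _ (one_div_pos.2 hrc).le, ← ENNReal.rpow_mul,
      ← ENNReal.rpow_mul]
    congr 2 <;> field_simp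

section Bilinear

variable {K F V : Type*} [NormedAddCommGroup K] [NormedSpace ℝ K] [NormedAddCommGroup F]
  [NormedSpace ℝ F] [NormedAddCommGroup V] [NormedSpace ℝ V]
  {a b c : ℝ≥0∞} [hy : YoungTriple a b c] [ha : Fact (1 ≤ a)]
  [hb : Fact (1 ≤ b)] [hc : Fact (1 ≤ c)]

theorem enorm_convolution_integrand_le (L : K →L[ℝ] F →L[ℝ] V) (u : K) (v : F) :
    ‖L u v‖ₑ ≤ ‖L‖ₑ * (‖u‖ₑ * ‖v‖ₑ) := by
  rw [← mul_assoc]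
  calc ‖L u v‖ₑ ≤ ‖L u‖ₑ * ‖v‖ₑ := (L u).le_opENorm v
    _ ≤ ‖L‖ₑ * ‖u‖ₑ * ‖v‖ₑ := by gcongr; exact L.le_opENorm u

/-- A function with finite L^c norm is finite almost everywhere. This provides absolute convergence
of the convolution, on which bilinearity and associativity rest. -/
theorem ae_lintegral_convolution_lt_top (c : ℝ≥0∞) [hy : YoungTriple a b c] [hc : Fact (1 ≤ c)]
    {k : E d → K} {f : E d → F} (hk : MemLp k a volume)
    (hf : MemLp f b volume) : ∀ᵐ x, ∫⁻ t, ‖k t‖ₑ * ‖f (x - t)‖ₑ < ⊤ := by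
  have h := young_lintegral (a := a) (b := b) (c := c) hk.1 hf.1
  have hlt : eLpNorm (fun x => ∫⁻ t, ‖k t‖ₑ * ‖f (x - t)‖ₑ) c volume < ⊤ :=
    h.trans_lt (ENNReal.mul_lt_top hk.2 hf.2)
  have hc0 : c ≠ 0 := (zero_lt_one.trans_le hc.out).ne'
  by_cases hct : c = ⊤
  · subst hct
    rw [eLpNorm_exponent_top] at hlt
    filter_upwards [enorm_ae_le_eLpNormEssSup
      (fun x => ∫⁻ t, ‖k t‖ₑ * ‖f (x - t)‖ₑ) volume] with x hx
    exact lt_of_le_of_lt (by simpa using hx) hlt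
  · rw [eLpNorm_eq_lintegral_rpow_enorm_toReal hc0 hct] at hlt
    have hrc := ENNReal.toReal_pos hc0 hct
    have h2 : ∫⁻ x, ‖∫⁻ t, ‖k t‖ₑ * ‖f (x - t)‖ₑ‖ₑ ^ c.toReal < ⊤ := by
      by_contra hcon
      rw [not_lt, top_le_iff] at hcon
      rw [hcon, ENNReal.top_rpow_of_pos (by positivity)] at hlt
      exact lt_irrefl _ hlt
    have hm : AEMeasurable (fun x : E d => ‖∫⁻ t, ‖k t‖ₑ * ‖f (x - t)‖ₑ‖ₑ ^ c.toReal) := by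
      have h3 : AEStronglyMeasurable
          (fun p : E d × E d => (ContinuousLinearMap.mul ℝ ℝ) ‖k p.2‖ ‖f (p.1 - p.2)‖)
          ((volume : Measure (E d)).prod volume) :=
        AEStronglyMeasurable.convolution_integrand _ hk.1.norm hf.1.norm
      have h4 := h3.enorm.lintegral_prod_right'
      simp only [ContinuousLinearMap.mul_apply', enorm_mul, enorm_norm] at h4
      simpa using h4.pow_const c.toReal
    filter_upwards [ae_lt_top' hm h2.ne] with x hx
    simp only [enorm_eq_self] at hx
    by_contra hcon
    rw [not_lt, top_le_iff] at hcon
    rw [hcon, ENNReal.top_rpow_of_pos hrc] at hx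
    exact lt_irrefl _ hx

theorem ae_convolutionExistsAt (c : ℝ≥0∞) [hy : YoungTriple a b c] [hc : Fact (1 ≤ c)]
    (L : K →L[ℝ] F →L[ℝ] V) {k : E d → K} {f : E d → F} (hk : MemLp k a volume)
    (hf : MemLp f b volume) : ∀ᵐ x, ConvolutionExistsAt k f x L volume := by
  filter_upwards [ae_lintegral_convolution_lt_top c hk hf] with x hx
  refine ⟨AEStronglyMeasurable.convolution_integrand_snd L hk.1 hf.1 x, ?_⟩
  calc ∫⁻ t, ‖L (k t) (f (x - t))‖ₑ
      ≤ ∫⁻ t, ‖L‖ₑ * (‖k t‖ₑ * ‖f (x - t)‖ₑ) :=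
        lintegral_mono fun t => enorm_convolution_integrand_le L _ _
    _ = ‖L‖ₑ * ∫⁻ t, ‖k t‖ₑ * ‖f (x - t)‖ₑ := lintegral_const_mul' _ _ enorm_ne_top
    _ < ⊤ := ENNReal.mul_lt_top enorm_lt_top hx

theorem eLpNorm_convolution_le (L : K →L[ℝ] F →L[ℝ] V) {k : E d → K} {f : E d → F}
    (hk : AEStronglyMeasurable k volume) (hf : AEStronglyMeasurable f volume) :
    eLpNorm (convolution k f L) c volume ≤
      ‖L‖ₑ * (eLpNorm k a volume * eLpNorm f b volume) := by
  refine (eLpNorm_le_nnreal_smul_eLpNorm_of_ae_le_mul' (c := ‖L‖₊)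
    (g := fun x => ∫⁻ t, ‖k t‖ₑ * ‖f (x - t)‖ₑ) (Eventually.of_forall fun x => ?_) c).trans ?_
  · calc ‖convolution k f L volume x‖ₑ ≤ ∫⁻ t, ‖L (k t) (f (x - t))‖ₑ :=
          enorm_integral_le_lintegral_enorm _
      _ ≤ ∫⁻ t, ‖L‖ₑ * (‖k t‖ₑ * ‖f (x - t)‖ₑ) :=
        lintegral_mono fun t => enorm_convolution_integrand_le L _ _
      _ = ‖L‖ₑ * ∫⁻ t, ‖k t‖ₑ * ‖f (x - t)‖ₑ := lintegral_const_mul' _ _ enorm_ne_top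
      _ ≤ _ := by simp [enorm_eq_nnnorm]
  · rw [ENNReal.smul_def, smul_eq_mul, ← enorm_eq_nnnorm]
    gcongr
    exact young_lintegral hk hf

theorem aestronglyMeasurable_convolution (L : K →L[ℝ] F →L[ℝ] V) {k : E d → K} {f : E d → F}
    (hk : AEStronglyMeasurable k volume) (hf : AEStronglyMeasurable f volume) :
    AEStronglyMeasurable (convolution k f L) volume :=
  (AEStronglyMeasurable.convolution_integrand L hk hf).integral_prod_right'

theorem memLp_convolution (c : ℝ≥0∞) [hy : YoungTriple a b c] [hc : Fact (1 ≤ c)]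
    (L : K →L[ℝ] F →L[ℝ] V) {k : E d → K} {f : E d → F}
    (hk : MemLp k a volume) (hf : MemLp f b volume) :
    MemLp (convolution k f L) c volume :=
  ⟨aestronglyMeasurable_convolution L hk.1 hf.1,
    (eLpNorm_convolution_le L hk.1 hf.1).trans_lt
      (ENNReal.mul_lt_top enorm_lt_top (ENNReal.mul_lt_top hk.2 hf.2))⟩

/-- Convolution as a map of Lebesgue spaces. -/
def lpConv (c : ℝ≥0∞) [hy : YoungTriple a b c] [hc : Fact (1 ≤ c)] (L : K →L[ℝ] F →L[ℝ] V) :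
    Lp K a (volume : Measure (E d)) →L[ℝ] Lp F b (volume : Measure (E d)) →L[ℝ]
      Lp V c (volume : Measure (E d)) :=
  LinearMap.mkContinuous₂
    (LinearMap.mk₂ ℝ (fun k f => (memLp_convolution c L (Lp.memLp k) (Lp.memLp f)).toLp)
      (fun k₁ k₂ f => by
        rw [← MemLp.toLp_add]
        refine MemLp.toLp_congr _ _ ?_
        rw [convolution_congr L (Lp.coeFn_add k₁ k₂) (EventuallyEq.refl _ _)]
        -- Additivity of the integral holds where both convolutions converge, hence almost
        -- everywhere.
        filter_upwards [ae_convolutionExistsAt c L (Lp.memLp k₁) (Lp.memLp f),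
          ae_convolutionExistsAt c L (Lp.memLp k₂) (Lp.memLp f)] with x h1 h2
        exact h1.add_distrib h2)
      (fun r k f => by
        rw [← MemLp.toLp_const_smul]
        refine MemLp.toLp_congr _ _ ?_
        rw [convolution_congr L (Lp.coeFn_smul r k) (EventuallyEq.refl _ _), smul_convolution])
      (fun k f₁ f₂ => by
        rw [← MemLp.toLp_add]
        refine MemLp.toLp_congr _ _ ?_
        rw [convolution_congr L (EventuallyEq.refl _ _) (Lp.coeFn_add f₁ f₂)]
        filter_upwards [ae_convolutionExistsAt c L (Lp.memLp k) (Lp.memLp f₁),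
          ae_convolutionExistsAt c L (Lp.memLp k) (Lp.memLp f₂)] with x h1 h2
        exact h1.distrib_add h2)
      (fun r k f => by
        rw [← MemLp.toLp_const_smul]
        refine MemLp.toLp_congr _ _ ?_
        rw [convolution_congr L (EventuallyEq.refl _ _) (Lp.coeFn_smul r f), convolution_smul]))
    ‖L‖ (fun k f => by
      rw [LinearMap.mk₂_apply, Lp.norm_toLp, mul_assoc, Lp.norm_def, Lp.norm_def]
      have := ENNReal.toReal_mono (by
        exact (ENNReal.mul_lt_top enorm_lt_top (ENNReal.mul_lt_top (Lp.memLp k).2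
          (Lp.memLp f).2)).ne) (eLpNorm_convolution_le (c := c) L (Lp.memLp k).1 (Lp.memLp f).1)
      simpa [ENNReal.toReal_mul] using this)

theorem coeFn_lpConv (c : ℝ≥0∞) [hy : YoungTriple a b c] [hc : Fact (1 ≤ c)]
    (L : K →L[ℝ] F →L[ℝ] V) (k : Lp K a (volume : Measure (E d)))
    (f : Lp F b (volume : Measure (E d))) :
    lpConv c L k f =ᵐ[volume] convolution k f L :=
  MemLp.coeFn_toLp (memLp_convolution c L (Lp.memLp k) (Lp.memLp f))

theorem norm_lpConv_le (c : ℝ≥0∞) [hy : YoungTriple a b c] [hc : Fact (1 ≤ c)]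
    (L : K →L[ℝ] F →L[ℝ] V) (k : Lp K a (volume : Measure (E d)))
    (f : Lp F b (volume : Measure (E d))) :
    ‖lpConv c L k f‖ ≤ ‖L‖ * ‖k‖ * ‖f‖ :=
  (ContinuousLinearMap.le_opNorm₂ _ _ _).trans (by
    gcongr
    exact LinearMap.mkContinuous₂_norm_le _ (norm_nonneg L) _)

end Bilinear

instance youngTriple_one_left (b : ℝ≥0∞) : YoungTriple 1 b b := ⟨by simp⟩

section Assoc

variable {K F V : Type*} [NormedAddCommGroup K] [NormedSpace ℝ K] [NormedAddCommGroup F]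
  [NormedSpace ℝ F] [NormedAddCommGroup V] [NormedSpace ℝ V] [CompleteSpace V] [CompleteSpace K]
  {a b c : ℝ≥0∞} [hy : YoungTriple a b c] [ha : Fact (1 ≤ a)]
  [hb : Fact (1 ≤ b)] [hc : Fact (1 ≤ c)]

/-- Convolution with an integrable scalar kernel is associative. -/
theorem lpConv_assoc (L : K →L[ℝ] F →L[ℝ] V) (g : Lp ℝ 1 (volume : Measure (E d)))
    (k : Lp K a (volume : Measure (E d))) (f : Lp F b (volume : Measure (E d))) :
    lpConv c (ContinuousLinearMap.lsmul ℝ ℝ) g (lpConv c L k f) =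
      lpConv c L (lpConv a (ContinuousLinearMap.lsmul ℝ ℝ) g k) f := by
  apply Lp.ext
  refine (coeFn_lpConv _ _ _ _).trans (EventuallyEq.trans ?_ (coeFn_lpConv _ _ _ _).symm)
  rw [convolution_congr _ (EventuallyEq.refl _ _) (coeFn_lpConv c L k f),
    convolution_congr _ (coeFn_lpConv a _ g k) (EventuallyEq.refl _ _)]
  -- Fubini needs absolute convergence of the triple convolution, that is, of |g| * (|k| * |f|).
  have hkf : MemLp (convolution (fun x => ‖k x‖) (fun x => ‖f x‖) (ContinuousLinearMap.mul ℝ ℝ)) c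
      (volume : Measure (E d)) :=
    memLp_convolution c _ (Lp.memLp k).norm (Lp.memLp f).norm
  filter_upwards [ae_convolutionExistsAt c (ContinuousLinearMap.mul ℝ ℝ) (Lp.memLp g).norm hkf]
    with x hx
  exact (convolution_assoc _ _ _ _ (fun r u v => by simp) (Lp.memLp g).1 (Lp.memLp k).1
    (Lp.memLp f).1 (ae_convolutionExistsAt a _ (Lp.memLp g) (Lp.memLp k))
    (ae_convolutionExistsAt c _ (Lp.memLp k).norm (Lp.memLp f).norm) hx).symm

end Assoc

end NSFreq

end

/-! ### Translations, dilations, limits and Bochner integrals in Lᵖ, compared with pointwise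
operations. -/

noncomputable section

namespace NSFreq

variable {d : ℕ}

section Translation

variable {V : Type*} [NormedAddCommGroup V] [NormedSpace ℝ V] {a : ℝ≥0∞} [Fact (1 ≤ a)]

/-- The translation `f ↦ f (· + b)` on a Lebesgue space. -/
def lpTranslate (b : E d) :
    Lp V a (volume : Measure (E d)) →L[ℝ] Lp V a (volume : Measure (E d)) :=
  (Lp.compMeasurePreservingₗᵢ ℝ (· + b) (measurePreserving_add_right volume b)).toContinuousLinearMap

theorem coeFn_lpTranslate (b : E d) (f : Lp V a (volume : Measure (E d))) :
    lpTranslate b f =ᵐ[volume] fun x => f (x + b) :=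
  Lp.coeFn_compMeasurePreserving f (measurePreserving_add_right volume b)

theorem norm_lpTranslate (b : E d) (f : Lp V a (volume : Measure (E d))) :
    ‖lpTranslate b f‖ = ‖f‖ :=
  Lp.norm_compMeasurePreserving f (measurePreserving_add_right volume b)

theorem ae_add_right {P : E d → Prop} (b : E d) (h : ∀ᵐ x, P x) : ∀ᵐ x, P (x + b) :=
  (measurePreserving_add_right (volume : Measure (E d)) b).quasiMeasurePreserving.ae h

theorem lpTranslate_lpTranslate (b c : E d) (f : Lp V a (volume : Measure (E d))) :
    lpTranslate b (lpTranslate c f) = lpTranslate (b + c) f := by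
  apply Lp.ext
  filter_upwards [coeFn_lpTranslate b (lpTranslate c f), ae_add_right b (coeFn_lpTranslate c f),
    coeFn_lpTranslate (b + c) f] with x h1 h2 h3
  rw [h1, h2, h3, add_assoc]

theorem lpTranslate_zero (f : Lp V a (volume : Measure (E d))) : lpTranslate 0 f = f := by
  apply Lp.ext
  filter_upwards [coeFn_lpTranslate 0 f] with x h1
  rw [h1, add_zero]

end Translation

section TranslationBilinear

variable {K F V : Type*} [NormedAddCommGroup K] [NormedSpace ℝ K] [NormedAddCommGroup F]
  [NormedSpace ℝ F] [NormedAddCommGroup V] [NormedSpace ℝ V]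
  {a b c : ℝ≥0∞} [ha : Fact (1 ≤ a)] [hb : Fact (1 ≤ b)] [hc : Fact (1 ≤ c)]

theorem lpTranslate_lpConv_right [hy : YoungTriple a b c] (L : K →L[ℝ] F →L[ℝ] V) (z : E d)
    (k : Lp K a (volume : Measure (E d))) (f : Lp F b (volume : Measure (E d))) :
    lpTranslate z (lpConv c L k f) = lpConv c L k (lpTranslate z f) := by
  apply Lp.ext
  filter_upwards [coeFn_lpTranslate z (lpConv c L k f), ae_add_right z (coeFn_lpConv c L k f),
    coeFn_lpConv c L k (lpTranslate z f)] with x h1 h2 h3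
  rw [h1, h2, h3, convolution_congr L (EventuallyEq.refl _ _) (coeFn_lpTranslate z f)]
  simp only [convolution_def]
  refine integral_congr_ae (Eventually.of_forall fun t => ?_)
  simp only
  congr 2
  abel

theorem lpTranslate_lpConv_left [hy : YoungTriple a b c] (L : K →L[ℝ] F →L[ℝ] V) (z : E d)
    (k : Lp K a (volume : Measure (E d))) (f : Lp F b (volume : Measure (E d))) :
    lpTranslate z (lpConv c L k f) = lpConv c L (lpTranslate z k) f := by
  apply Lp.ext
  filter_upwards [coeFn_lpTranslate z (lpConv c L k f), ae_add_right z (coeFn_lpConv c L k f),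
    coeFn_lpConv c L (lpTranslate z k) f] with x h1 h2 h3
  rw [h1, h2, h3, convolution_congr L (coeFn_lpTranslate z k) (EventuallyEq.refl _ _)]
  rw [convolution_eq_swap, convolution_eq_swap]
  refine integral_congr_ae (Eventually.of_forall fun t => ?_)
  simp only
  congr 3
  abel

theorem lpTranslate_holderL [hy : ENNReal.HolderTriple a b c] (L : K →L[ℝ] F →L[ℝ] V) (z : E d)
    (k : Lp K a (volume : Measure (E d))) (f : Lp F b (volume : Measure (E d))) :
    lpTranslate z (L.holderL volume a b c k f) =
      L.holderL volume a b c (lpTranslate z k) (lpTranslate z f) := by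
  apply Lp.ext
  simp only [ContinuousLinearMap.holderL_apply_apply]
  filter_upwards [coeFn_lpTranslate z (L.holder c k f), ae_add_right z (L.coeFn_holder (r := c) k f),
    L.coeFn_holder (r := c) (lpTranslate z k) (lpTranslate z f), coeFn_lpTranslate z k,
    coeFn_lpTranslate z f] with x h1 h2 h3 h4 h5
  rw [h1, h2, h3, h4, h5]

end TranslationBilinear

section Limits

variable {V : Type*} [NormedAddCommGroup V] {a : ℝ≥0∞} [ha : Fact (1 ≤ a)]

/-- A limit in `Lᵖ` agrees almost everywhere with the pointwise limit. -/
theorem coeFn_eq_of_tendsto {T : ℕ → Lp V a (volume : Measure (E d))}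
    {g : Lp V a (volume : Measure (E d))} {F : ℕ → E d → V} {f : E d → V}
    (hT : Tendsto T atTop (𝓝 g)) (hTF : ∀ n, T n =ᵐ[volume] F n)
    (hF : ∀ᵐ x, Tendsto (fun n => F n x) atTop (𝓝 (f x))) : g =ᵐ[volume] f := by
  have hm := tendstoInMeasure_of_tendsto_Lp hT
  obtain ⟨ns, hns, hlim⟩ := hm.exists_seq_tendsto_ae
  filter_upwards [hlim, hF, ae_all_iff.2 hTF] with x h1 h2 h3
  refine tendsto_nhds_unique h1 ?_
  have := h2.comp hns.tendsto_atTop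
  refine this.congr fun n => ?_
  simp [h3]

/-- The derivative of a curve in `Lᵖ` agrees almost everywhere with the pointwise derivative. -/
theorem coeFn_eq_of_hasDerivAt [NormedSpace ℝ V] {T : ℝ → Lp V a (volume : Measure (E d))}
    {g : Lp V a (volume : Measure (E d))} {F : ℝ → E d → V} {f : E d → V} {r₀ : ℝ}
    (hT : HasDerivAt T g r₀) (hTF : ∀ r, T r =ᵐ[volume] F r)
    (hF : ∀ x, HasDerivAt (fun r => F r x) (f x) r₀) : g =ᵐ[volume] f := by
  -- The null set where `T r` differs from `F r` depends on `r`, so the difference quotients are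
  -- taken along a countable sequence.
  have hseq : Tendsto (fun n : ℕ => r₀ + 1 / ((n : ℝ) + 1)) atTop (𝓝[≠] r₀) := by
    refine tendsto_nhdsWithin_iff.2 ⟨?_, Eventually.of_forall fun n => ?_⟩
    · simpa using tendsto_one_div_add_atTop_nhds_zero_nat.const_add r₀
    · have : (0 : ℝ) < 1 / ((n : ℝ) + 1) := by positivity
      simp only [mem_compl_iff, mem_singleton_iff]
      linarith
  refine coeFn_eq_of_tendsto ((hasDerivAt_iff_tendsto_slope.1 hT).comp hseq) (F := fun n x =>
    slope (fun r => F r x) r₀ (r₀ + 1 / ((n : ℝ) + 1))) (fun n => ?_)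
    (Eventually.of_forall fun x => (hasDerivAt_iff_tendsto_slope.1 (hF x)).comp hseq)
  simp only [Function.comp_def, slope, vsub_eq_sub]
  filter_upwards [Lp.coeFn_smul (r₀ + 1 / ((n : ℝ) + 1) - r₀)⁻¹
    (T (r₀ + 1 / ((n : ℝ) + 1)) - T r₀), Lp.coeFn_sub (T (r₀ + 1 / ((n : ℝ) + 1))) (T r₀),
    hTF (r₀ + 1 / ((n : ℝ) + 1)), hTF r₀] with x h1 h2 h3 h4
  rw [h1, Pi.smul_apply, h2, Pi.sub_apply, h3, h4]

end Limits

section BochnerPointwise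

variable {V : Type*} [NormedAddCommGroup V] [NormedSpace ℝ V] [CompleteSpace V]
  {a : ℝ≥0∞} [ha : Fact (1 ≤ a)] {α : Type*} [MeasurableSpace α] {ν : Measure α} [SFinite ν]

/-- On a set of finite measure Lᵖ embeds in L¹, so Bochner integrability in Lᵖ gives joint
integrability and makes Fubini available. -/
theorem integrable_prod_restrict {H : α → Lp V a (volume : Measure (E d))}
    (hH : Integrable H ν) {F : α → E d → V}
    (hF : AEStronglyMeasurable (Function.uncurry F) (ν.prod volume))
    (hHF : ∀ᵐ s ∂ν, H s =ᵐ[volume] F s) {B : Set (E d)} (hB : volume B < ⊤) :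
    Integrable (Function.uncurry F) (ν.prod (volume.restrict B)) := by
  have : IsFiniteMeasure ((volume : Measure (E d)).restrict B) := ⟨by simpa using hB⟩
  have hFB : AEStronglyMeasurable (Function.uncurry F) (ν.prod (volume.restrict B)) :=
    hF.mono_ac (Measure.AbsolutelyContinuous.prod Measure.AbsolutelyContinuous.rfl
      Measure.restrict_le_self.absolutelyContinuous)
  have hmem : ∀ s, MemLp (H s) a ((volume : Measure (E d)).restrict B) := fun s =>
    (Lp.memLp (H s)).restrict B
  rw [integrable_prod_iff hFB]
  constructor
  · filter_upwards [hHF] with s hs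
    exact ((hmem s).integrable ha.out).congr (ae_restrict_of_ae hs)
  · set M := ((volume : Measure (E d)).restrict B univ) ^ (1 / (1 : ℝ≥0∞).toReal - 1 / a.toReal)
    have hM : M ≠ ⊤ := by
      refine ENNReal.rpow_ne_top_of_nonneg ?_ (measure_ne_top _ _)
      rcases eq_or_ne a ⊤ with h | h
      · simp [h]
      · have : 1 ≤ a.toReal := by
          simpa using ENNReal.toReal_mono h ha.out
        simp only [ENNReal.toReal_one, div_one, sub_nonneg]
        exact (div_le_one (by linarith)).2 this
    refine (hH.norm.mul_const M.toReal).mono' (hFB.norm.integral_prod_right') ?_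
    filter_upwards [hHF] with s hs
    rw [Real.norm_of_nonneg (integral_nonneg fun _ => norm_nonneg _)]
    have h1 : ∫ y, ‖F s y‖ ∂(volume.restrict B) = (eLpNorm (H s) 1 (volume.restrict B)).toReal := by
      rw [eLpNorm_one_eq_lintegral_enorm, ← integral_norm_eq_lintegral_enorm (hmem s).1]
      exact integral_congr_ae (ae_restrict_of_ae (hs.mono fun x hx => by simp [hx]))
    simp only [Function.uncurry]
    rw [h1, Lp.norm_def, ← ENNReal.toReal_mul]
    refine ENNReal.toReal_mono (ENNReal.mul_ne_top (Lp.eLpNorm_ne_top _) hM) ?_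
    refine (eLpNorm_le_eLpNorm_mul_rpow_measure_univ ha.out (hmem s).1).trans ?_
    gcongr
    exact Measure.restrict_le_self

/-- A Bochner integral of a curve in `Lᵖ` is computed pointwise. -/
theorem coeFn_integral_lp {H : α → Lp V a (volume : Measure (E d))}
    (hH : Integrable H ν) {F : α → E d → V}
    (hF : AEStronglyMeasurable (Function.uncurry F) (ν.prod volume))
    (hHF : ∀ᵐ s ∂ν, H s =ᵐ[volume] F s) :
    (∫ s, H s ∂ν : Lp V a (volume : Measure (E d))) =ᵐ[volume] fun x => ∫ s, F s x ∂ν := by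
  have hint : ∀ B : Set (E d), volume B < ⊤ →
      Integrable (Function.uncurry F) (ν.prod (volume.restrict B)) := fun B hB =>
    integrable_prod_restrict hH hF hHF hB
  refine ae_eq_of_forall_setIntegral_eq_of_sigmaFinite (fun B hB hBt => ?_) (fun B hB hBt => ?_)
    (fun B hB hBt => ?_)
  · have : IsFiniteMeasure ((volume : Measure (E d)).restrict B) := ⟨by simpa using hBt⟩
    exact ((Lp.memLp _).restrict B).integrable ha.out
  · have h0 : Integrable (fun x => ∫ s, F s x ∂ν) (volume.restrict B) :=
      (hint B hBt).integral_prod_right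
    exact h0
  · have h1 : ∫ x in B, (∫ s, F s x ∂ν) = ∫ s, (∫ x, F s x ∂(volume.restrict B)) ∂ν :=
      (integral_integral_swap (f := fun s x => F s x) (hint B hBt)).symm
    have : ENNReal.HolderConjugate (ENNReal.conjExponent a) a :=
      (ENNReal.HolderConjugate.conjExponent ha.out).symm
    have : Fact (1 ≤ ENNReal.conjExponent a) := ⟨ENNReal.HolderConjugate.one_le _ a⟩
    -- Integration over B is the pairing with an indicator in the conjugate space, hence a bounded
    -- functional that commutes with the Bochner integral. This covers a = ∞ as well, where the
    -- indicator is taken in L¹.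
    let Λ := ContinuousLinearMap.lpPairing (volume : Measure (E d)) (ENNReal.conjExponent a) a
      (ContinuousLinearMap.lsmul ℝ ℝ : ℝ →L[ℝ] V →L[ℝ] V)
      (indicatorConstLp (ENNReal.conjExponent a) hB hBt.ne (1 : ℝ))
    have hΛ : ∀ f : Lp V a (volume : Measure (E d)), Λ f = ∫ x in B, f x := by
      intro f
      simp only [Λ]
      rw [ContinuousLinearMap.lpPairing_eq_integral, ← integral_indicator hB]
      refine integral_congr_ae ?_
      filter_upwards [indicatorConstLp_coeFn (p := ENNReal.conjExponent a) (hs := hB)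
        (hμs := hBt.ne) (c := (1 : ℝ))] with x hx
      simp only [ContinuousLinearMap.lsmul_apply, hx]
      by_cases hxB : x ∈ B <;> simp [hxB]
    rw [h1, ← hΛ, ← Λ.integral_comp_comm hH]
    refine integral_congr_ae ?_
    filter_upwards [hHF] with s hs
    rw [hΛ]
    exact integral_congr_ae (ae_restrict_of_ae hs)

end BochnerPointwise

section Dilation

variable {V : Type*} [NormedAddCommGroup V] {a : ℝ≥0∞}

theorem ae_smul_right {P : E d → Prop} {r : ℝ} (hr : r ≠ 0) (h : ∀ᵐ x, P x) :
    ∀ᵐ x, P (r • x) := by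
  have hq : Measure.QuasiMeasurePreserving (fun x : E d => r • x) volume volume :=
    ⟨measurable_const_smul r, by
      rw [Measure.map_addHaar_smul _ hr]
      exact Measure.smul_absolutelyContinuous⟩
  exact hq.ae h

theorem eLpNorm_comp_smul {f : E d → V} (hf : AEStronglyMeasurable f volume) (hat : a ≠ ⊤)
    {r : ℝ} (hr : 0 < r) :
    eLpNorm (fun x => f (r • x)) a volume =
      ENNReal.ofReal (r ^ (-(d : ℝ) / a.toReal)) * eLpNorm f a volume := by
  have hmap : Measure.map (fun x : E d => r • x) volume =
      ENNReal.ofReal (r ^ (-(d : ℝ))) • volume := by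
    rw [Measure.map_addHaar_smul _ hr.ne', finrank_euclideanSpace_fin,
      abs_of_nonneg (by positivity), Real.rpow_neg hr.le, Real.rpow_natCast]
  have hf' : AEStronglyMeasurable f (Measure.map (fun x : E d => r • x) volume) := by
    rw [hmap]; exact hf.mono_ac Measure.smul_absolutelyContinuous
  have h := eLpNorm_map_measure (p := a) hf' (measurable_const_smul r).aemeasurable
  have h' : eLpNorm (fun x => f (r • x)) a volume =
    eLpNorm f a (Measure.map (fun x : E d => r • x) volume) := h.symm
  rw [h', hmap, eLpNorm_smul_measure_of_ne_top hat, smul_eq_mul]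
  congr 1
  rw [ENNReal.ofReal_rpow_of_nonneg (by positivity) (by positivity), ← Real.rpow_mul hr.le]
  congr 2
  simp [div_eq_mul_inv]

theorem memLp_comp_smul {f : E d → V} (hf : MemLp f a volume) (hat : a ≠ ⊤) {r : ℝ}
    (hr : 0 < r) : MemLp (fun x => f (r • x)) a volume :=
  ⟨hf.1.comp_quasiMeasurePreserving
    ⟨measurable_const_smul r, by
      rw [Measure.map_addHaar_smul _ hr.ne']
      exact Measure.smul_absolutelyContinuous⟩, by
    rw [eLpNorm_comp_smul hf.1 hat hr]
    exact ENNReal.mul_lt_top ENNReal.ofReal_lt_top hf.2⟩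

variable [NormedSpace ℝ V] [ha : Fact (1 ≤ a)]

/-- The dilation `f ↦ f (r • ·)` on a Lebesgue space of finite exponent. -/
def lpDilate (hat : a ≠ ⊤) {r : ℝ} (hr : 0 < r) :
    Lp V a (volume : Measure (E d)) →L[ℝ] Lp V a (volume : Measure (E d)) :=
  LinearMap.mkContinuous
    { toFun := fun f => (memLp_comp_smul (Lp.memLp f) hat hr).toLp
      map_add' := fun f g => by
        rw [← MemLp.toLp_add]
        refine MemLp.toLp_congr _ _ ?_
        filter_upwards [ae_smul_right hr.ne' (Lp.coeFn_add f g)] with x hx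
        simpa using hx
      map_smul' := fun c f => by
        rw [RingHom.id_apply, ← MemLp.toLp_const_smul]
        refine MemLp.toLp_congr _ _ ?_
        filter_upwards [ae_smul_right hr.ne' (Lp.coeFn_smul c f)] with x hx
        simpa using hx }
    (r ^ (-(d : ℝ) / a.toReal)) (fun f => by
      simp only [LinearMap.coe_mk, AddHom.coe_mk, Lp.norm_toLp]
      rw [eLpNorm_comp_smul (Lp.memLp f).1 hat hr, ENNReal.toReal_mul,
        ENNReal.toReal_ofReal (by positivity), Lp.norm_def])

theorem coeFn_lpDilate (hat : a ≠ ⊤) {r : ℝ} (hr : 0 < r) (f : Lp V a (volume : Measure (E d))) :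
    lpDilate hat hr f =ᵐ[volume] fun x => f (r • x) :=
  MemLp.coeFn_toLp (memLp_comp_smul (Lp.memLp f) hat hr)

theorem norm_lpDilate (hat : a ≠ ⊤) {r : ℝ} (hr : 0 < r) (f : Lp V a (volume : Measure (E d))) :
    ‖lpDilate hat hr f‖ = r ^ (-(d : ℝ) / a.toReal) * ‖f‖ := by
  rw [Lp.norm_def, eLpNorm_congr_ae (coeFn_lpDilate hat hr f),
    eLpNorm_comp_smul (Lp.memLp f).1 hat hr, ENNReal.toReal_mul,
    ENNReal.toReal_ofReal (by positivity), Lp.norm_def]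

end Dilation

end NSFreq

end

/-! ### Pointwise calculus of the heat kernel, and smoothness from a semigroup law. -/

noncomputable section

namespace NSFreq

variable {d : ℕ}

section HeatKernelPointwise

theorem heatKernel_nonneg {t : ℝ} (ht : 0 < t) (x : E d) : 0 ≤ heatKernel t x := by
  unfold heatKernel; positivity

theorem contDiff_heatKernel (t : ℝ) : ContDiff ℝ ∞ (heatKernel (d := d) t) := by
  unfold heatKernel
  exact contDiff_const.mul (((contDiff_norm_sq ℝ).neg.div_const _).exp)

theorem continuous_heatKernel (t : ℝ) : Continuous (heatKernel (d := d) t) :=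
  (contDiff_heatKernel t).continuous

/-- A non-integrable function has Bochner integral zero, whereas the Gaussian integral is positive.
-/
theorem integrable_exp_neg_mul_sq {c : ℝ} (hc : 0 < c) :
    Integrable fun x : E d => Real.exp (-c * ‖x‖ ^ 2) := by
  by_contra h
  have := GaussianFourier.integral_rexp_neg_mul_sq_norm (V := E d) hc
  rw [integral_undef h] at this
  have h2 : 0 < (Real.pi / c) ^ (Module.finrank ℝ (E d) / 2 : ℝ) := by positivity
  linarith

theorem heatKernel_eq (t : ℝ) (x : E d) :
    heatKernel t x = (4 * Real.pi * t) ^ (-(d : ℝ) / 2) * Real.exp (-(1 / (4 * t)) * ‖x‖ ^ 2) := by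
  unfold heatKernel
  congr 2
  ring

theorem integral_heatKernel {t : ℝ} (ht : 0 < t) : ∫ x : E d, heatKernel t x = 1 := by
  simp_rw [heatKernel_eq]
  rw [integral_const_mul, GaussianFourier.integral_rexp_neg_mul_sq_norm (by positivity),
    finrank_euclideanSpace_fin]
  have : Real.pi / (1 / (4 * t)) = 4 * Real.pi * t := by field_simp
  rw [this, ← Real.rpow_add (by positivity)]
  have : -(d : ℝ) / 2 + d / 2 = 0 := by ring
  rw [this, Real.rpow_zero]

theorem memLp_heatKernel {t : ℝ} (ht : 0 < t) {q : ℝ≥0∞} (hq0 : q ≠ 0) (hq : q ≠ ⊤) :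
    MemLp (heatKernel (d := d) t) q volume := by
  rw [← integrable_norm_rpow_iff (continuous_heatKernel t).aestronglyMeasurable hq0 hq]
  have hq' := ENNReal.toReal_pos hq0 hq
  have : (fun x : E d => ‖heatKernel t x‖ ^ q.toReal) = fun x =>
      ((4 * Real.pi * t) ^ (-(d : ℝ) / 2)) ^ q.toReal *
        Real.exp (-(q.toReal / (4 * t)) * ‖x‖ ^ 2) := by
    ext x
    rw [Real.norm_of_nonneg (heatKernel_nonneg ht x), heatKernel_eq,
      Real.mul_rpow (by positivity) (Real.exp_pos _).le, ← Real.exp_mul]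
    congr 2
    ring
  rw [this]
  exact (integrable_exp_neg_mul_sq (by positivity)).const_mul _

/-- The semigroup property of the heat kernel. -/
theorem integral_heatKernel_mul {t s : ℝ} (ht : 0 < t) (hs : 0 < s) (w : E d) :
    ∫ y, heatKernel t y * heatKernel s (w - y) = heatKernel (t + s) w := by
  have hts : 0 < t + s := add_pos ht hs
  -- Completing the square centres the product at (t/(t+s)) w.
  have hexp : ∀ y : E d, heatKernel t y * heatKernel s (w - y) =
      (4 * Real.pi * t) ^ (-(d : ℝ) / 2) * (4 * Real.pi * s) ^ (-(d : ℝ) / 2) *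
        Real.exp (-‖w‖ ^ 2 / (4 * (t + s))) *
        Real.exp (-((t + s) / (4 * t * s)) * ‖y - (t / (t + s)) • w‖ ^ 2) := by
    intro y
    unfold heatKernel
    rw [mul_mul_mul_comm, ← Real.exp_add, mul_assoc _ (Real.exp _) (Real.exp _), ← Real.exp_add]
    congr 2
    rw [norm_sub_sq_real, norm_sub_sq_real, inner_smul_right, norm_smul,
      Real.norm_of_nonneg (by positivity), real_inner_comm y w]
    field_simp
    ring
  simp_rw [hexp]
  rw [integral_const_mul,
    integral_sub_right_eq_self (fun y : E d => Real.exp (-((t + s) / (4 * t * s)) * ‖y‖ ^ 2)),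
    GaussianFourier.integral_rexp_neg_mul_sq_norm (by positivity), finrank_euclideanSpace_fin]
  unfold heatKernel
  rw [mul_right_comm]
  congr 1
  have hX : Real.pi / ((t + s) / (4 * t * s)) = ((t + s) / (4 * Real.pi * t * s))⁻¹ * 1 := by
    field_simp
  rw [hX, mul_one, Real.inv_rpow (by positivity), ← Real.rpow_neg (by positivity), ← neg_div,
    ← Real.mul_rpow (by positivity) (by positivity), ← Real.mul_rpow (by positivity) (by positivity)]
  congr 1
  field_simp

theorem heatKernel_smul {t r : ℝ} (ht : 0 < t) (hr : 0 < r) (x : E d) :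
    heatKernel (r * t) (Real.sqrt r • x) = r ^ (-(d : ℝ) / 2) * heatKernel t x := by
  unfold heatKernel
  rw [norm_smul, mul_pow, Real.norm_of_nonneg (Real.sqrt_nonneg r), Real.sq_sqrt hr.le,
    show 4 * Real.pi * (r * t) = r * (4 * Real.pi * t) by ring,
    Real.mul_rpow hr.le (by positivity), mul_assoc]
  congr 3
  field_simp

/-- The derivative of `(λ, b) ↦ heatKernel λ (x + b)`. -/
def heatKernelDeriv (π : ℝ × E d) (x : E d) : ℝ × E d →L[ℝ] ℝ :=
  heatKernel π.1 (x + π.2) •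
    ((-(d : ℝ) / 2 / π.1 + ‖x + π.2‖ ^ 2 / (4 * π.1 ^ 2)) • ContinuousLinearMap.fst ℝ ℝ (E d) -
      (1 / (2 * π.1)) • (innerSL ℝ (x + π.2)).comp (ContinuousLinearMap.snd ℝ ℝ (E d)))

theorem hasFDerivAt_heatKernel (x : E d) {π : ℝ × E d} (hπ : 0 < π.1) :
    HasFDerivAt (fun π : ℝ × E d => heatKernel π.1 (x + π.2)) (heatKernelDeriv π x) π := by
  have h1 : HasFDerivAt (fun π : ℝ × E d => π.1) (ContinuousLinearMap.fst ℝ ℝ (E d)) π :=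
    hasFDerivAt_fst
  have h2 : HasFDerivAt (fun π : ℝ × E d => x + π.2) (ContinuousLinearMap.snd ℝ ℝ (E d)) π :=
    hasFDerivAt_snd.const_add x
  have h3 := (h1.const_mul (4 * Real.pi)).rpow_const (p := -(d : ℝ) / 2)
    (Or.inl (by positivity))
  have h4 := h2.norm_sq.neg.mul ((hasDerivAt_inv (x := 4 * π.1) (by positivity)).comp_hasFDerivAt π
    (h1.const_mul 4))
  have h5 := h3.mul h4.exp
  refine (h5.congr_fderiv ?_)
  have h6 : (4 * Real.pi * π.1) ^ (-(d : ℝ) / 2 - 1) =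
      (4 * Real.pi * π.1) ^ (-(d : ℝ) / 2) / (4 * Real.pi * π.1) := by
    rw [Real.rpow_sub (by positivity), Real.rpow_one]
  rw [h6]
  apply ContinuousLinearMap.ext
  rintro ⟨l, β⟩
  simp only [heatKernelDeriv, heatKernel, add_apply,
    smul_apply, neg_apply, Pi.mul_apply, Pi.neg_apply,
    Function.comp_apply, sub_apply, ContinuousLinearMap.comp_apply,
    ContinuousLinearMap.coe_fst', ContinuousLinearMap.coe_snd', innerSL_apply_apply, smul_eq_mul,
    nsmul_eq_mul, div_eq_mul_inv (-‖x + π.2‖ ^ 2)]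
  field_simp
  ring

theorem continuous_heatKernelDeriv (π : ℝ × E d) : Continuous (heatKernelDeriv π) := by
  unfold heatKernelDeriv
  have h1 : Continuous fun x : E d => heatKernel π.1 (x + π.2) :=
    (continuous_heatKernel π.1).comp (continuous_id.add continuous_const)
  have h2 : Continuous fun x : E d => innerSL ℝ (x + π.2) :=
    (innerSL ℝ).continuous.comp (continuous_id.add continuous_const)
  have h3 : Continuous fun x : E d =>
      (innerSL ℝ (x + π.2)).comp (ContinuousLinearMap.snd ℝ ℝ (E d)) :=
    h2.clm_comp continuous_const
  fun_prop

/-- One Gaussian dominates the derivative for all parameters near (μ, 0). With z = x + b, the kernel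
decays at least like exp(-|z|²/(8μ)). Half of this absorbs the polynomial factor through u + 1 ≤
e^u, and the other half survives the shift, since |b| ≤ 1 gives |x|² ≤ 2|z|² + 2. -/
theorem norm_heatKernelDeriv_le {μ : ℝ} (hμ : 0 < μ) :
    ∃ C c : ℝ, 0 < c ∧ ∀ π : ℝ × E d, μ / 2 ≤ π.1 → π.1 ≤ 2 * μ → ‖π.2‖ ≤ 1 → ∀ x,
      ‖heatKernelDeriv π x‖ ≤ C * Real.exp (-c * ‖x‖ ^ 2) := by
  set A : ℝ := d / μ + 1 / μ + 16 * μ * (1 / μ ^ 2 + 1 / μ) with hA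
  refine ⟨(4 * Real.pi * (μ / 2)) ^ (-(d : ℝ) / 2) * A * Real.exp (1 / (16 * μ)), 1 / (32 * μ),
    by positivity, fun π h1 h2 h3 x => ?_⟩
  have hπ : 0 < π.1 := by linarith
  set z := x + π.2 with hz
  have hA0 : 0 ≤ A := by positivity
  have hG : heatKernel π.1 z ≤
      (4 * Real.pi * (μ / 2)) ^ (-(d : ℝ) / 2) * Real.exp (-(‖z‖ ^ 2 / (8 * μ))) := by
    unfold heatKernel
    have e1 : (4 * Real.pi * π.1) ^ (-(d : ℝ) / 2) ≤ (4 * Real.pi * (μ / 2)) ^ (-(d : ℝ) / 2) := by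
      refine Real.rpow_le_rpow_of_nonpos (by positivity)
        (mul_le_mul_of_nonneg_left h1 (by positivity)) ?_
      have : (0 : ℝ) ≤ d := by positivity
      linarith
    have e2 : -‖z‖ ^ 2 / (4 * π.1) ≤ -(‖z‖ ^ 2 / (8 * μ)) := by
      rw [neg_div]
      exact neg_le_neg
        (div_le_div_of_nonneg_left (by positivity) (by positivity) (by linarith))
    gcongr
  have hP : ‖(-(d : ℝ) / 2 / π.1 + ‖z‖ ^ 2 / (4 * π.1 ^ 2)) • ContinuousLinearMap.fst ℝ ℝ (E d) -
      (1 / (2 * π.1)) • (innerSL ℝ z).comp (ContinuousLinearMap.snd ℝ ℝ (E d))‖ ≤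
      A * Real.exp (‖z‖ ^ 2 / (16 * μ)) := by
    have n1 : ‖ContinuousLinearMap.fst ℝ ℝ (E d)‖ ≤ 1 := ContinuousLinearMap.norm_fst_le ..
    have n2 : ‖(innerSL ℝ z).comp (ContinuousLinearMap.snd ℝ ℝ (E d))‖ ≤ ‖z‖ := by
      refine (ContinuousLinearMap.opNorm_comp_le _ _).trans ?_
      have := ContinuousLinearMap.norm_snd_le ℝ ℝ (E d)
      rw [innerSL_apply_norm]
      nlinarith [norm_nonneg z]
    have a1 : |-(d : ℝ) / 2 / π.1 + ‖z‖ ^ 2 / (4 * π.1 ^ 2)| ≤ d / μ + ‖z‖ ^ 2 / μ ^ 2 := by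
      refine (abs_add_le _ _).trans (add_le_add ?_ ?_)
      · rw [abs_div, abs_div, abs_neg, abs_of_pos hπ, abs_of_nonneg (by positivity : (0 : ℝ) ≤ d),
          abs_of_pos (by norm_num : (0 : ℝ) < 2), div_div]
        gcongr
        linarith
      · rw [abs_of_nonneg (by positivity)]
        gcongr
        nlinarith
    have a2 : |1 / (2 * π.1)| ≤ 1 / μ := by
      rw [abs_of_nonneg (by positivity)]
      gcongr
      linarith
    calc _ ≤ (d / μ + ‖z‖ ^ 2 / μ ^ 2) * 1 + 1 / μ * ‖z‖ := by
          refine (norm_sub_le _ _).trans (add_le_add ?_ ?_)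
          · rw [norm_smul, Real.norm_eq_abs]
            gcongr
          · rw [norm_smul, Real.norm_eq_abs]
            gcongr
      _ ≤ A * (‖z‖ ^ 2 / (16 * μ) + 1) := by
          have hz1 : ‖z‖ ≤ 1 + ‖z‖ ^ 2 := by nlinarith [sq_nonneg (‖z‖ - 1), norm_nonneg z]
          have : 1 / μ * ‖z‖ ≤ 1 / μ * (1 + ‖z‖ ^ 2) := by gcongr
          have e3 : A * (‖z‖ ^ 2 / (16 * μ) + 1) = A + (d / μ + 1 / μ) * (‖z‖ ^ 2 / (16 * μ)) +
              (1 / μ ^ 2 + 1 / μ) * ‖z‖ ^ 2 := by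
            rw [hA]; field_simp; ring
          have e4 : d / μ + 1 / μ ≤ A := by rw [hA]; linarith [show 0 ≤ 16 * μ * (1 / μ ^ 2 + 1 / μ) by positivity]
          have e5 : 0 ≤ (d / μ + 1 / μ) * (‖z‖ ^ 2 / (16 * μ)) := by positivity
          have e6 : ‖z‖ ^ 2 / μ ^ 2 = 1 / μ ^ 2 * ‖z‖ ^ 2 := by ring
          rw [e3, e6]
          linarith
      _ ≤ _ := by gcongr; exact Real.add_one_le_exp _
  have hexp : Real.exp (-(‖z‖ ^ 2 / (8 * μ))) * Real.exp (‖z‖ ^ 2 / (16 * μ)) ≤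
      Real.exp (1 / (16 * μ)) * Real.exp (-(1 / (32 * μ)) * ‖x‖ ^ 2) := by
    rw [← Real.exp_add, ← Real.exp_add, Real.exp_le_exp]
    have hx : ‖x‖ ^ 2 ≤ 2 * ‖z‖ ^ 2 + 2 := by
      have : ‖x‖ ≤ ‖z‖ + 1 := by
        calc ‖x‖ = ‖z - π.2‖ := by rw [hz]; simp
          _ ≤ ‖z‖ + ‖π.2‖ := norm_sub_le _ _
          _ ≤ _ := by linarith
      nlinarith [norm_nonneg x, norm_nonneg z, sq_nonneg (‖z‖ - 1)]
    have : -(‖z‖ ^ 2 / (8 * μ)) + ‖z‖ ^ 2 / (16 * μ) - (1 / (16 * μ) + -(1 / (32 * μ)) * ‖x‖ ^ 2) =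
      (‖x‖ ^ 2 - (2 * ‖z‖ ^ 2 + 2)) / (32 * μ) := by field_simp; ring
    have h4 : (‖x‖ ^ 2 - (2 * ‖z‖ ^ 2 + 2)) / (32 * μ) ≤ 0 :=
      div_nonpos_of_nonpos_of_nonneg (by linarith) (by positivity)
    linarith
  unfold heatKernelDeriv
  rw [norm_smul, Real.norm_of_nonneg (heatKernel_nonneg hπ _)]
  calc _ ≤ ((4 * Real.pi * (μ / 2)) ^ (-(d : ℝ) / 2) * Real.exp (-(‖z‖ ^ 2 / (8 * μ)))) *
        (A * Real.exp (‖z‖ ^ 2 / (16 * μ))) := by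
        gcongr
    _ = (4 * Real.pi * (μ / 2)) ^ (-(d : ℝ) / 2) * A *
        (Real.exp (-(‖z‖ ^ 2 / (8 * μ))) * Real.exp (‖z‖ ^ 2 / (16 * μ))) := by ring
    _ ≤ (4 * Real.pi * (μ / 2)) ^ (-(d : ℝ) / 2) * A *
        (Real.exp (1 / (16 * μ)) * Real.exp (-(1 / (32 * μ)) * ‖x‖ ^ 2)) := by gcongr
    _ = _ := by ring

end HeatKernelPointwise

section DominatedDerivative

variable {P : Type*} [NormedAddCommGroup P] [NormedSpace ℝ P]

/-- Differentiability of a map into `L¹` under domination of the pointwise derivative. -/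
theorem differentiableAt_lp_one {T : P → Lp ℝ 1 (volume : Measure (E d))} {f : P → E d → ℝ}
    {f' : P → E d → P →L[ℝ] ℝ} {π₀ : P} {bound : E d → ℝ} {ε : ℝ} (hε : 0 < ε)
    (hT : ∀ π ∈ Metric.ball π₀ ε, T π =ᵐ[volume] f π)
    (hf : ∀ π ∈ Metric.ball π₀ ε, ∀ x, HasFDerivAt (fun π => f π x) (f' π x) π)
    (hm : AEStronglyMeasurable (f' π₀) volume)
    (hb : ∀ π ∈ Metric.ball π₀ ε, ∀ x, ‖f' π x‖ ≤ bound x) (hbi : Integrable bound) :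
    DifferentiableAt ℝ T π₀ := by
  have hπ₀ : π₀ ∈ Metric.ball π₀ ε := Metric.mem_ball_self hε
  have hmem : ∀ h : P, MemLp (fun x => f' π₀ x h) 1 volume := fun h => by
    rw [memLp_one_iff_integrable]
    refine (hbi.mul_const ‖h‖).mono' (hm.apply_continuousLinearMap h)
      (Eventually.of_forall fun x => ?_)
    exact ((f' π₀ x).le_opNorm h).trans (by gcongr; exact hb π₀ hπ₀ x)
  let D : P →L[ℝ] Lp ℝ 1 (volume : Measure (E d)) :=
    LinearMap.mkContinuous
      { toFun := fun h => (hmem h).toLp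
        map_add' := fun h₁ h₂ => by
          rw [← MemLp.toLp_add]
          exact MemLp.toLp_congr _ _ (Eventually.of_forall fun x => by simp)
        map_smul' := fun c h => by
          rw [RingHom.id_apply, ← MemLp.toLp_const_smul]
          exact MemLp.toLp_congr _ _ (Eventually.of_forall fun x => by simp) }
      (∫ x, bound x) (fun h => by
        simp only [LinearMap.coe_mk, AddHom.coe_mk]
        rw [L1.norm_eq_integral_norm, ← integral_mul_const]
        refine integral_mono_of_nonneg (Eventually.of_forall fun x => norm_nonneg _)
          (hbi.mul_const _) ?_
        filter_upwards [(hmem h).coeFn_toLp] with x hx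
        rw [hx]
        exact ((f' π₀ x).le_opNorm h).trans (by gcongr; exact hb π₀ hπ₀ x))
  have hD : ∀ h, D h =ᵐ[volume] fun x => f' π₀ x h := fun h => (hmem h).coeFn_toLp
  refine ⟨D, ?_⟩
  rw [hasFDerivAt_iff_tendsto]
  have hball : ∀ᶠ π in 𝓝 π₀, π ∈ Metric.ball π₀ ε := Metric.ball_mem_nhds _ hε
  -- The integral is the L¹ norm of the normalized remainder. The mean value inequality bounds its
  -- integrand by twice `bound`, so dominated convergence applies.
  have key : Tendsto (fun π => ∫ x, ‖π - π₀‖⁻¹ * ‖f π x - f π₀ x - f' π₀ x (π - π₀)‖) (𝓝 π₀)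
      (𝓝 (∫ _ : E d, (0 : ℝ))) := by
    refine tendsto_integral_filter_of_dominated_convergence (fun x => bound x + bound x) ?_ ?_
      (hbi.add hbi) ?_
    · filter_upwards [hball] with π hπ
      have h1 : AEStronglyMeasurable (f π) volume := (Lp.memLp (T π)).1.congr (hT π hπ)
      have h2 : AEStronglyMeasurable (f π₀) volume := (Lp.memLp (T π₀)).1.congr (hT π₀ hπ₀)
      exact ((h1.sub h2).sub (hm.apply_continuousLinearMap _)).norm.const_mul _
    · filter_upwards [hball] with π hπ
      refine Eventually.of_forall fun x => ?_
      have hlip : ‖f π x - f π₀ x‖ ≤ bound x * ‖π - π₀‖ :=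
        (convex_ball π₀ ε).norm_image_sub_le_of_norm_hasFDerivWithin_le
          (fun y hy => (hf y hy x).hasFDerivWithinAt) (fun y hy => hb y hy x) hπ₀ hπ
      have hlin : ‖f' π₀ x (π - π₀)‖ ≤ bound x * ‖π - π₀‖ :=
        ((f' π₀ x).le_opNorm _).trans (by gcongr; exact hb π₀ hπ₀ x)
      rw [norm_mul, norm_inv, norm_norm, norm_norm]
      rcases eq_or_ne (‖π - π₀‖) 0 with h0 | h0
      · rw [h0, inv_zero, zero_mul]
        have := (norm_nonneg _).trans (hb π₀ hπ₀ x)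
        linarith
      · rw [inv_mul_le_iff₀ (lt_of_le_of_ne (norm_nonneg _) h0.symm)]
        calc _ ≤ ‖f π x - f π₀ x‖ + ‖f' π₀ x (π - π₀)‖ := norm_sub_le _ _
          _ ≤ _ := by nlinarith
    · refine Eventually.of_forall fun x => ?_
      exact hasFDerivAt_iff_tendsto.1 (hf π₀ hπ₀ x)
  rw [integral_zero] at key
  refine key.congr' ?_
  filter_upwards [hball] with π hπ
  rw [L1.norm_eq_integral_norm, ← integral_const_mul]
  refine integral_congr_ae ?_
  filter_upwards [Lp.coeFn_sub (T π - T π₀) (D (π - π₀)), Lp.coeFn_sub (T π) (T π₀), hT π hπ,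
    hT π₀ hπ₀, hD (π - π₀)] with x h1 h2 h3 h4 h5
  rw [h1, Pi.sub_apply, h2, Pi.sub_apply, h3, h4, h5]

end DominatedDerivative

section SemigroupSmoothness

variable {A : Type*} [NormedAddCommGroup A] [NormedSpace ℝ A]

/-- A map on the half space `{λ > 0}` that turns sums into products with respect to a bounded
bilinear product is smooth as soon as it is differentiable on the half line. -/
theorem contDiffOn_of_map_add (L : A →L[ℝ] A →L[ℝ] A) {f : ℝ × E d → A}
    (hadd : ∀ π π' : ℝ × E d, 0 < π.1 → 0 < π'.1 → f (π + π') = L (f π) (f π'))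
    (hdiff : ∀ μ : ℝ, 0 < μ → DifferentiableAt ℝ f (μ, 0)) :
    ContDiffOn ℝ ∞ f {π : ℝ × E d | 0 < π.1} := by
  have hopen : IsOpen {π : ℝ × E d | 0 < π.1} := isOpen_lt continuous_const continuous_fst
  -- Near π write f(π') = L (f(π - (μ,0))) (f(π' - π + (μ,0))): only the second factor varies, and
  -- its argument is near (μ,0), where f is differentiable.
  have hder : ∀ μ : ℝ, 0 < μ → ∀ π : ℝ × E d, μ < π.1 →
      HasFDerivAt f ((L (f (π - (μ, 0)))).comp (fderiv ℝ f (μ, 0))) π := by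
    intro μ hμ π hπ
    have h1 : HasFDerivAt (fun π' : ℝ × E d => π' - π + (μ, 0)) (.id ℝ (ℝ × E d)) π :=
      ((hasFDerivAt_id π).sub_const π).add_const _
    have h2 : HasFDerivAt f (fderiv ℝ f (μ, 0)) (π - π + (μ, 0)) := by
      simpa using (hdiff μ hμ).hasFDerivAt
    have h3 := (L (f (π - (μ, 0)))).hasFDerivAt.comp π (h2.comp π h1)
    refine (h3.congr_of_eventuallyEq ?_)
    have : ∀ᶠ π' : ℝ × E d in 𝓝 π, 0 < (π' - π + (μ, 0)).1 := by
      have hc : ContinuousAt (fun π' : ℝ × E d => (π' - π + (μ, 0)).1) π := by fun_prop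
      exact hc.eventually (lt_mem_nhds (by simpa using hμ))
    filter_upwards [this] with π' hπ'
    simp only [Function.comp_apply]
    rw [← hadd _ _ (by simpa using hπ) hπ']
    congr 1
    abel
  have hD : DifferentiableOn ℝ f {π : ℝ × E d | 0 < π.1} := fun π hπ =>
    (hder (π.1 / 2) (half_pos hπ) π (half_lt_self hπ)).differentiableAt.differentiableWithinAt
  rw [contDiffOn_infty]
  intro n
  induction n with
  | zero => exact contDiffOn_zero.2 hD.continuousOn
  | succ n ih =>
    rw [Nat.cast_succ, contDiffOn_succ_iff_fderiv_of_isOpen hopen]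
    refine ⟨hD, by simp, fun π hπ => ContDiffAt.contDiffWithinAt ?_⟩
    have hπ' : 0 < π.1 := hπ
    -- With μ fixed at half the time of π, the formula writes the derivative as a bounded linear
    -- image of a translate of f. So C^n for f gives C^n for its derivative.
    have hev : fderiv ℝ f =ᶠ[𝓝 π] fun π' =>
        (L (f (π' - (π.1 / 2, 0)))).comp (fderiv ℝ f (π.1 / 2, 0)) := by
      have : ∀ᶠ π' : ℝ × E d in 𝓝 π, π.1 / 2 < π'.1 :=
        continuous_fst.continuousAt.eventually (lt_mem_nhds (half_lt_self hπ'))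
      filter_upwards [this] with π' h
      exact (hder _ (half_pos hπ') π' h).fderiv
    refine ContDiffAt.congr_of_eventuallyEq ?_ hev
    have h1 : ContDiffAt ℝ n f (π - (π.1 / 2, 0)) :=
      (ih _ (by simpa using half_lt_self hπ')).contDiffAt
        (hopen.mem_nhds (by simpa using half_lt_self hπ'))
    have h2 : ContDiffAt ℝ n (fun π' : ℝ × E d => f (π' - (π.1 / 2, 0))) π :=
      h1.comp π (contDiffAt_id.sub contDiffAt_const)
    exact (L.contDiff.contDiffAt.comp π h2).clm_comp contDiffAt_const

end SemigroupSmoothness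

end NSFreq

end

/-! ### The curve of heat kernels in L^q, and families of kernels closed under space derivatives. -/

noncomputable section

namespace NSFreq

variable {d : ℕ}

section GaussianCurve

/-- The half space of parameters with positive time. -/
def posTime (d : ℕ) : Set (ℝ × E d) := {π | 0 < π.1}

theorem isOpen_posTime : IsOpen (posTime d) := isOpen_lt continuous_const continuous_fst

theorem memLp_heatKernel_add {π : ℝ × E d} (hπ : 0 < π.1) {q : ℝ≥0∞} (hq0 : q ≠ 0) (hq : q ≠ ⊤) :
    MemLp (fun x => heatKernel π.1 (x + π.2)) q volume :=
  (memLp_heatKernel hπ hq0 hq).comp_measurePreserving (measurePreserving_add_right volume π.2)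

open Classical in
/-- The class of `heatKernel λ (· + b)` in `L^q`, as a function of `(λ, b)` with `λ > 0`. -/
def heatLp (q : ℝ≥0∞) (π : ℝ × E d) : Lp ℝ q (volume : Measure (E d)) :=
  if h : MemLp (fun x => heatKernel π.1 (x + π.2)) q volume then h.toLp else 0

variable {q : ℝ≥0∞} [hq1 : Fact (1 ≤ q)]

theorem coeFn_heatLp (hq : q ≠ ⊤) {π : ℝ × E d} (hπ : 0 < π.1) :
    heatLp q π =ᵐ[volume] fun x => heatKernel π.1 (x + π.2) := by
  unfold heatLp
  rw [dif_pos (memLp_heatKernel_add hπ (zero_lt_one.trans_le hq1.out).ne' hq)]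
  exact MemLp.coeFn_toLp _

theorem lpConv_heatLp (hq : q ≠ ⊤) {π π' : ℝ × E d} (hπ : 0 < π.1) (hπ' : 0 < π'.1) :
    lpConv q (ContinuousLinearMap.lsmul ℝ ℝ) (heatLp 1 π) (heatLp q π') = heatLp q (π + π') := by
  apply Lp.ext
  refine (coeFn_lpConv _ _ _ _).trans (EventuallyEq.trans ?_
    (coeFn_heatLp hq (π := π + π') (add_pos hπ hπ')).symm)
  rw [convolution_congr _ (coeFn_heatLp ENNReal.one_ne_top hπ) (coeFn_heatLp hq hπ')]
  refine Eventually.of_forall fun x => ?_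
  simp only [convolution_def, ContinuousLinearMap.lsmul_apply, smul_eq_mul, Prod.fst_add,
    Prod.snd_add]
  rw [← integral_heatKernel_mul hπ hπ' (x + (π.2 + π'.2)),
    ← integral_add_right_eq_self
      (fun y => heatKernel π.1 y * heatKernel π'.1 (x + (π.2 + π'.2) - y)) π.2]
  refine integral_congr_ae (Eventually.of_forall fun y => ?_)
  simp only
  congr 2
  abel

theorem norm_heatLp_one {π : ℝ × E d} (hπ : 0 < π.1) : ‖heatLp 1 π‖ = 1 := by
  rw [L1.norm_eq_integral_norm, ← integral_heatKernel (d := d) hπ,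
    ← integral_add_right_eq_self (heatKernel (d := d) π.1) π.2]
  refine integral_congr_ae ?_
  filter_upwards [coeFn_heatLp ENNReal.one_ne_top hπ] with x hx
  rw [hx, Real.norm_of_nonneg (heatKernel_nonneg hπ _)]

theorem differentiableAt_heatLp_one {μ : ℝ} (hμ : 0 < μ) :
    DifferentiableAt ℝ (heatLp (d := d) 1) (μ, 0) := by
  obtain ⟨C, c, hc, hb⟩ := norm_heatKernelDeriv_le (d := d) hμ
  have hball : ∀ π ∈ Metric.ball ((μ, 0) : ℝ × E d) (min (μ / 2) 1),
      μ / 2 ≤ π.1 ∧ π.1 ≤ 2 * μ ∧ ‖π.2‖ ≤ 1 := by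
    intro π hπ
    rw [Metric.mem_ball, Prod.dist_eq, max_lt_iff, dist_zero_right, Real.dist_eq, abs_lt] at hπ
    have h1 := min_le_left (μ / 2) 1
    have h2 := min_le_right (μ / 2) 1
    refine ⟨by linarith [hπ.1.1], by linarith [hπ.1.2], by linarith [hπ.2]⟩
  -- The radius min(μ/2, 1) keeps the parameters where the Gaussian domination holds.
  refine differentiableAt_lp_one (f := fun π x => heatKernel π.1 (x + π.2)) (f' := heatKernelDeriv)
    (bound := fun x => C * Real.exp (-c * ‖x‖ ^ 2)) (ε := min (μ / 2) 1) (by positivity)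
    (fun π hπ => coeFn_heatLp ENNReal.one_ne_top (by linarith [(hball π hπ).1]))
    (fun π hπ x => hasFDerivAt_heatKernel x (by linarith [(hball π hπ).1]))
    (continuous_heatKernelDeriv _).aestronglyMeasurable
    (fun π hπ x => hb π (hball π hπ).1 (hball π hπ).2.1 (hball π hπ).2.2 x)
    ((integrable_exp_neg_mul_sq hc).const_mul C)

theorem contDiffOn_heatLp_one : ContDiffOn ℝ ∞ (heatLp (d := d) 1) (posTime d) :=
  contDiffOn_of_map_add (lpConv 1 (ContinuousLinearMap.lsmul ℝ ℝ))
    (fun _ _ h h' => (lpConv_heatLp ENNReal.one_ne_top h h').symm)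
    (fun _ h => differentiableAt_heatLp_one h)

/-- Locally the L^q curve is the smooth L¹ curve convolved with one fixed L^q kernel, so no
domination argument in L^q is needed. -/
theorem contDiffOn_heatLp (hq : q ≠ ⊤) : ContDiffOn ℝ ∞ (heatLp (d := d) q) (posTime d) := by
  intro π hπ
  have hπ' : 0 < π.1 := hπ
  refine ContDiffAt.contDiffWithinAt ?_
  have hev : heatLp q =ᶠ[𝓝 π] fun π' => lpConv q (ContinuousLinearMap.lsmul ℝ ℝ)
      (heatLp 1 (π' - (π.1 / 2, 0))) (heatLp q ((π.1 / 2, 0) : ℝ × E d)) := by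
    have : ∀ᶠ π' : ℝ × E d in 𝓝 π, π.1 / 2 < π'.1 :=
      continuous_fst.continuousAt.eventually (lt_mem_nhds (half_lt_self hπ'))
    filter_upwards [this] with π' h
    rw [lpConv_heatLp hq (by simpa using h) (half_pos hπ'), sub_add_cancel]
  refine ContDiffAt.congr_of_eventuallyEq ?_ hev
  have h1 : ContDiffAt ℝ ∞ (heatLp (d := d) 1) (π - (π.1 / 2, 0)) :=
    (contDiffOn_heatLp_one _ (by simpa [posTime] using half_lt_self hπ')).contDiffAt
      (isOpen_posTime.mem_nhds (by simpa [posTime] using half_lt_self hπ'))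
  have h2 : ContDiffAt ℝ ∞ (fun π' : ℝ × E d => heatLp (d := d) 1 (π' - (π.1 / 2, 0))) π :=
    h1.comp π (contDiffAt_id.sub contDiffAt_const)
  have h3 : ContDiff ℝ ∞ (lpConv q (ContinuousLinearMap.lsmul ℝ ℝ) :
      Lp ℝ 1 (volume : Measure (E d)) →L[ℝ] Lp ℝ q (volume : Measure (E d)) →L[ℝ]
        Lp ℝ q (volume : Measure (E d))) := ContinuousLinearMap.contDiff _
  exact (h3.contDiffAt.comp π h2).clm_apply contDiffAt_const

end GaussianCurve

section HeatFamily

/-- A family of kernels `f λ` of differential order `m` in the space variable that behaves like the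
spatial derivatives of the heat kernel, together with the curve `(λ, b) ↦ f λ (· + b)` in `L^q`. -/
structure IsHeatFamily (q : ℝ≥0∞) [Fact (1 ≤ q)] (hq : q ≠ ⊤) (m : ℕ) (f : ℝ → E d → ℝ)
    (F : ℝ × E d → Lp ℝ q (volume : Measure (E d))) : Prop where
  smooth : ∀ t, ContDiff ℝ ∞ (f t)
  smoothOn : ContDiffOn ℝ ∞ (fun π : ℝ × E d => f π.1 π.2) (posTime d)
  contDiffOn : ContDiffOn ℝ ∞ F (posTime d)
  coeFn : ∀ π, 0 < π.1 → F π =ᵐ[volume] fun x => f π.1 (x + π.2)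
  lpConv_heat : ∀ π π', 0 < π.1 → 0 < π'.1 →
    lpConv q (ContinuousLinearMap.lsmul ℝ ℝ) (heatLp 1 π) (F π') = F (π + π')
  scaling : ∀ (r : ℝ) (hr : 0 < r) (π : ℝ × E d), 0 < π.1 →
    F (r * π.1, Real.sqrt r • π.2) = r ^ (-((d : ℝ) + m) / 2) •
      lpDilate hq (inv_pos.2 (Real.sqrt_pos.2 hr)) (F π)

variable {q : ℝ≥0∞} [hq1 : Fact (1 ≤ q)] {hq : q ≠ ⊤} {m : ℕ} {f : ℝ → E d → ℝ}
  {F : ℝ × E d → Lp ℝ q (volume : Measure (E d))}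

theorem isHeatFamily_heatLp (hq : q ≠ ⊤) :
    IsHeatFamily q hq 0 (heatKernel (d := d)) (heatLp q) where
  smooth := contDiff_heatKernel
  smoothOn := by
    unfold heatKernel
    refine ContDiffOn.mul ?_ ?_
    · refine ContDiffOn.rpow_const_of_ne (contDiffOn_const.mul contDiffOn_fst) fun π hπ => ?_
      have : 0 < π.1 := hπ
      positivity
    · refine ContDiffOn.exp (ContDiffOn.div ?_ (contDiffOn_const.mul contDiffOn_fst) fun π hπ => ?_)
      · exact ((contDiff_norm_sq ℝ).comp contDiff_snd).neg.contDiffOn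
      · have : 0 < π.1 := hπ
        positivity
  contDiffOn := contDiffOn_heatLp hq
  coeFn := fun _ hπ => coeFn_heatLp hq hπ
  lpConv_heat := fun _ _ hπ hπ' => lpConv_heatLp hq hπ hπ'
  scaling := fun r hr π hπ => by
    have hs : 0 < Real.sqrt r := Real.sqrt_pos.2 hr
    apply Lp.ext
    filter_upwards [coeFn_heatLp hq (π := (r * π.1, Real.sqrt r • π.2)) (mul_pos hr hπ),
      Lp.coeFn_smul (r ^ (-((d : ℝ) + (0 : ℕ)) / 2)) (lpDilate hq (inv_pos.2 hs) (heatLp q π)),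
      coeFn_lpDilate hq (inv_pos.2 hs) (heatLp q π),
      ae_smul_right (inv_pos.2 hs).ne' (coeFn_heatLp hq hπ)] with x h1 h2 h3 h4
    rw [h1, h2, Pi.smul_apply, h3, h4]
    simp only [smul_eq_mul, Nat.cast_zero, add_zero]
    rw [← heatKernel_smul hπ hr, smul_add, smul_smul, mul_inv_cancel₀ hs.ne', one_smul]

/-- The derivative in the direction `eᵢ` of the space variable. -/
def spaceDeriv {A : Type*} [NormedAddCommGroup A] [NormedSpace ℝ A] (i : Fin d)
    (F : ℝ × E d → A) (π : ℝ × E d) : A :=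
  fderiv ℝ F π (0, EuclideanSpace.single i 1)

theorem IsHeatFamily.hasFDerivAt (h : IsHeatFamily q hq m f F) {π : ℝ × E d} (hπ : 0 < π.1) :
    HasFDerivAt F (fderiv ℝ F π) π :=
  ((h.contDiffOn.differentiableOn (by simp)).differentiableAt
    (isOpen_posTime.mem_nhds hπ)).hasFDerivAt

/-- Each property is inherited by differentiating it. In the scaling law the chain rule for (λ, b) ↦
(rλ, √r b) produces a factor √r, which is what raises m by one. -/
theorem IsHeatFamily.pderiv (h : IsHeatFamily q hq m f F) (i : Fin d) :
    IsHeatFamily q hq (m + 1) (fun t => pderiv i (f t)) (spaceDeriv i F) where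
  smooth := fun t => by
    unfold NSFreq.pderiv
    exact ((h.smooth t).fderiv_right (by simp)).clm_apply contDiff_const
  smoothOn := by
    refine ((h.smoothOn.fderiv_of_isOpen isOpen_posTime (m := ∞) (by simp)).clm_apply
      (contDiffOn_const (c := ((0, EuclideanSpace.single i 1) : ℝ × E d)))).congr fun π hπ => ?_
    have h1 : HasFDerivAt (fun x : E d => (π.1, x)) (ContinuousLinearMap.inr ℝ ℝ (E d)) π.2 :=
      hasFDerivAt_prodMk_right π.1 π.2
    have h2 := ((h.smoothOn.differentiableOn (by simp)).differentiableAt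
      (isOpen_posTime.mem_nhds hπ)).hasFDerivAt.comp (f := fun x : E d => (π.1, x)) π.2 h1
    have h3 : HasFDerivAt (f π.1) _ π.2 := h2
    simp only [NSFreq.pderiv, h3.fderiv]
    rfl
  contDiffOn := by
    unfold spaceDeriv
    exact (h.contDiffOn.fderiv_of_isOpen isOpen_posTime (by simp)).clm_apply contDiffOn_const
  coeFn := fun π hπ => by
    have hline : HasDerivAt (fun r : ℝ => (π + r • ((0, EuclideanSpace.single i 1) : ℝ × E d)))
        (0, EuclideanSpace.single i 1) 0 := by
      simpa using ((hasDerivAt_id (0 : ℝ)).smul_const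
        ((0, EuclideanSpace.single i 1) : ℝ × E d)).const_add π
    have h0 : HasFDerivAt F (fderiv ℝ F π)
        (π + (0 : ℝ) • ((0, EuclideanSpace.single i 1) : ℝ × E d)) := by
      simpa using h.hasFDerivAt hπ
    refine coeFn_eq_of_hasDerivAt (h0.comp_hasDerivAt 0 hline)
      (F := fun r x => f π.1 (x + π.2 + r • EuclideanSpace.single i 1)) (fun r => ?_) (fun x => ?_)
    · filter_upwards [h.coeFn (π + r • ((0, EuclideanSpace.single i 1) : ℝ × E d))
        (by simpa using hπ)] with x hx
      simp only [Function.comp_apply]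
      rw [hx]
      simp [add_assoc]
    · have hline' : HasDerivAt (fun r : ℝ => x + π.2 + r • (EuclideanSpace.single i 1 : E d))
          (EuclideanSpace.single i 1) 0 := by
        simpa using ((hasDerivAt_id (0 : ℝ)).smul_const
          (EuclideanSpace.single i 1 : E d)).const_add (x + π.2)
      have h1 : HasFDerivAt (f π.1) (fderiv ℝ (f π.1) (x + π.2))
          (x + π.2 + (0 : ℝ) • (EuclideanSpace.single i 1 : E d)) := by
        simpa using ((h.smooth π.1).differentiable (by simp) _).hasFDerivAt
      exact h1.comp_hasDerivAt 0 hline'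
  lpConv_heat := fun π π' hπ hπ' => by
    have h1 := (lpConv q (ContinuousLinearMap.lsmul ℝ ℝ) (heatLp 1 π)).hasFDerivAt.comp π'
      (h.hasFDerivAt hπ')
    have h2 : HasFDerivAt (fun π' => F (π + π')) (fderiv ℝ F (π + π')) π' := by
      have := (h.hasFDerivAt (π := π + π') (add_pos hπ hπ')).comp π'
        ((hasFDerivAt_id π').const_add π)
      rwa [ContinuousLinearMap.comp_id] at this
    have hev : (lpConv q (ContinuousLinearMap.lsmul ℝ ℝ) (heatLp 1 π) ∘ F) =ᶠ[𝓝 π']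
        fun π' => F (π + π') := by
      filter_upwards [isOpen_posTime.mem_nhds hπ'] with y hy
      exact h.lpConv_heat π y hπ hy
    have h3 := (h2.congr_of_eventuallyEq hev).unique h1
    exact (congrArg (fun T => T (0, EuclideanSpace.single i 1)) h3).symm
  scaling := fun r hr π hπ => by
    have hs : 0 < Real.sqrt r := Real.sqrt_pos.2 hr
    let A : ℝ × E d →L[ℝ] ℝ × E d :=
      (r • ContinuousLinearMap.fst ℝ ℝ (E d)).prod (Real.sqrt r • ContinuousLinearMap.snd ℝ ℝ (E d))
    have hA : ∀ π : ℝ × E d, A π = (r * π.1, Real.sqrt r • π.2) := fun π => by simp [A]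
    have h1 : HasFDerivAt (fun π => F (A π)) ((fderiv ℝ F (A π)).comp A) π :=
      (h.hasFDerivAt (π := A π) (by rw [hA]; exact mul_pos hr hπ)).comp π A.hasFDerivAt
    have h2 := ((lpDilate hq (inv_pos.2 hs)).hasFDerivAt.comp π (h.hasFDerivAt hπ)).const_smul
      (r ^ (-((d : ℝ) + m) / 2))
    have hev : (fun π => F (A π)) =ᶠ[𝓝 π] r ^ (-((d : ℝ) + m) / 2) •
        (lpDilate hq (inv_pos.2 hs) ∘ F) := by
      filter_upwards [isOpen_posTime.mem_nhds hπ] with y hy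
      rw [hA]
      exact h.scaling r hr y hy
    have h3 := congrArg (fun T => T (0, EuclideanSpace.single i 1))
      ((h2.congr_of_eventuallyEq hev).unique h1)
    simp only [ContinuousLinearMap.comp_apply, smul_apply] at h3
    have h4 : A (0, EuclideanSpace.single i 1) =
        Real.sqrt r • ((0, EuclideanSpace.single i 1) : ℝ × E d) := by simp [hA]
    rw [h4, map_smul, hA] at h3
    have h5 : fderiv ℝ F (r * π.1, Real.sqrt r • π.2) (0, EuclideanSpace.single i 1) =
        (Real.sqrt r)⁻¹ • (r ^ (-((d : ℝ) + m) / 2) • lpDilate hq (inv_pos.2 hs)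
          (fderiv ℝ F π (0, EuclideanSpace.single i 1))) := by
      rw [h3, smul_smul, inv_mul_cancel₀ hs.ne', one_smul]
    unfold spaceDeriv
    rw [h5, smul_smul]
    congr 1
    rw [Real.sqrt_eq_rpow, ← Real.rpow_neg hr.le, ← Real.rpow_add hr]
    congr 1
    push_cast
    ring

/-- Translations are isometries, and the scaling law moves the time to 1. The exponent combines the
scaling factor with the change of the L^q norm under dilation. -/
theorem IsHeatFamily.norm_le (h : IsHeatFamily q hq m f F) {π : ℝ × E d} (hπ : 0 < π.1) :
    ‖F π‖ = π.1 ^ (-((d : ℝ) + m) / 2 + d / 2 / q.toReal) * ‖F (1, 0)‖ := by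
  have hs : 0 < Real.sqrt π.1 := Real.sqrt_pos.2 hπ
  have htr : ‖F π‖ = ‖F (π.1, 0)‖ := by
    rw [← norm_lpTranslate π.2 (F (π.1, 0))]
    congr 1
    apply Lp.ext
    filter_upwards [h.coeFn π hπ, coeFn_lpTranslate π.2 (F (π.1, 0)),
      ae_add_right π.2 (h.coeFn (π.1, 0) hπ)] with x h1 h2 h3
    rw [h1, h2, h3, add_zero]
  have h1 := h.scaling π.1 hπ (1, 0) one_pos
  simp only [mul_one, smul_zero] at h1
  rw [htr, h1, norm_smul, norm_lpDilate, Real.norm_of_nonneg (by positivity), ← mul_assoc]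
  congr 1
  rw [Real.sqrt_eq_rpow, ← Real.rpow_neg hπ.le, ← Real.rpow_mul hπ.le, ← Real.rpow_add hπ]
  congr 1
  ring

theorem IsHeatFamily.continuousOn (h : IsHeatFamily q hq m f F) : ContinuousOn F (posTime d) :=
  h.contDiffOn.continuousOn

end HeatFamily

end NSFreq

end

/-! ### The Oseen kernel in L^q. -/

noncomputable section

namespace NSFreq

variable {d : ℕ}

section Oseen

theorem setIntegral_Ioi_comp_add_left {A : Type*} [NormedAddCommGroup A] [NormedSpace ℝ A]
    (f : ℝ → A) (t : ℝ) : ∫ σ in Ioi 0, f (t + σ) = ∫ s in Ioi t, f s := by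
  have h := (measurePreserving_add_left (volume : Measure ℝ) t).setIntegral_preimage_emb
    (measurableEmbedding_addLeft t) f (Ioi t)
  rw [← h]
  congr 2
  ext x
  simp

theorem toReal_one_le {q : ℝ≥0∞} [hq1 : Fact (1 ≤ q)] (hq : q ≠ ⊤) : 1 ≤ q.toReal := by
  simpa using ENNReal.toReal_mono hq hq1.out

theorem kernel_exponent_le {q : ℝ≥0∞} [hq1 : Fact (1 ≤ q)] (hq : q ≠ ⊤) (m : ℕ) :
    -((d : ℝ) + m) / 2 + d / 2 / q.toReal ≤ -(m : ℝ) / 2 := by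
  have h1 := toReal_one_le hq
  have h2 : (d : ℝ) / 2 / q.toReal ≤ d / 2 := div_le_self (by positivity) h1
  linarith

variable {q : ℝ≥0∞} [hq1 : Fact (1 ≤ q)] {hq : q ≠ ⊤} {m : ℕ} {f : ℝ → E d → ℝ}
  {F : ℝ × E d → Lp ℝ q (volume : Measure (E d))}

theorem IsHeatFamily.continuousOn_shift (h : IsHeatFamily q hq m f F) {π : ℝ × E d}
    (hπ : 0 < π.1) : ContinuousOn (fun σ : ℝ => F (π + (σ, 0))) (Ioi 0) := by
  refine h.continuousOn.comp (by fun_prop) fun σ hσ => ?_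
  have : 0 < σ := hσ
  exact add_pos hπ this

theorem integrableOn_shift_rpow {t e : ℝ} (ht : 0 < t) (he : e < -1) :
    IntegrableOn (fun σ : ℝ => (t + σ) ^ e) (Ioi 0) := by
  simp_rw [add_comm t]
  exact integrableOn_add_rpow_Ioi_of_lt he (by linarith)

/-- Decay faster than 1/σ, uniformly in q: the exponent is largest at q = 1, where it equals -m/2.
Three derivatives therefore suffice for the tail integral to converge. -/
theorem IsHeatFamily.exponent_lt (hq : q ≠ ⊤) (hm : 2 < m) :
    -((d : ℝ) + m) / 2 + d / 2 / q.toReal < -1 := by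
  refine (kernel_exponent_le hq m).trans_lt ?_
  have : (2 : ℝ) < m := by exact_mod_cast hm
  linarith

theorem IsHeatFamily.integrableOn_shift (h : IsHeatFamily q hq m f F) (hm : 2 < m)
    {π : ℝ × E d} (hπ : 0 < π.1) : IntegrableOn (fun σ : ℝ => F (π + (σ, 0))) (Ioi 0) := by
  refine ((integrableOn_shift_rpow hπ (IsHeatFamily.exponent_lt (d := d) hq hm)).mul_const
    ‖F (1, 0)‖).mono' ((h.continuousOn_shift hπ).aestronglyMeasurable measurableSet_Ioi) ?_
  filter_upwards [ae_restrict_mem measurableSet_Ioi] with σ hσ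
  have hσ' : (0 : ℝ) < σ := hσ
  rw [h.norm_le (π := π + (σ, 0)) (add_pos hπ hσ')]
  rfl

/-- The time integral `∫ₜ^∞` of a family of kernels. -/
def tailIntegral (F : ℝ × E d → Lp ℝ q (volume : Measure (E d))) (π : ℝ × E d) :
    Lp ℝ q (volume : Measure (E d)) :=
  ∫ σ in Ioi (0 : ℝ), F (π + (σ, 0))

theorem IsHeatFamily.norm_tailIntegral_le (h : IsHeatFamily q hq m f F) (hm : 2 < m) :
    ∃ C : ℝ, 0 ≤ C ∧ ∀ π : ℝ × E d, 0 < π.1 →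
      ‖tailIntegral F π‖ ≤ C * π.1 ^ (-((d : ℝ) + m) / 2 + d / 2 / q.toReal + 1) := by
  set e := -((d : ℝ) + m) / 2 + d / 2 / q.toReal with he
  have he1 : e < -1 := IsHeatFamily.exponent_lt hq hm
  refine ⟨‖F (1, 0)‖ * (-(e + 1))⁻¹, by
    have : 0 < -(e + 1) := by linarith
    positivity, fun π hπ => ?_⟩
  refine (norm_integral_le_of_norm_le (g := fun σ => (π.1 + σ) ^ e * ‖F (1, 0)‖)
    ((integrableOn_shift_rpow hπ he1).mul_const _) ?_).trans ?_
  · filter_upwards [ae_restrict_mem measurableSet_Ioi] with σ hσ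
    have hσ' : (0 : ℝ) < σ := hσ
    rw [h.norm_le (π := π + (σ, 0)) (add_pos hπ hσ')]
    rfl
  · rw [integral_mul_const, setIntegral_Ioi_comp_add_left (fun s : ℝ => s ^ e),
      integral_Ioi_rpow_of_lt he1 hπ]
    apply le_of_eq
    rw [inv_neg, neg_div, div_eq_mul_inv]
    ring

theorem IsHeatFamily.continuousOn_tailIntegral (h : IsHeatFamily q hq m f F) (hm : 2 < m) :
    ContinuousOn (tailIntegral F) (posTime d) := by
  intro π hπ
  have hπ' : 0 < π.1 := hπ
  refine ContinuousAt.continuousWithinAt ?_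
  have hev : ∀ᶠ π' : ℝ × E d in 𝓝 π, π.1 / 2 < π'.1 :=
    continuous_fst.continuousAt.eventually (lt_mem_nhds (half_lt_self hπ'))
  have he1 := IsHeatFamily.exponent_lt (d := d) (q := q) hq hm
  refine continuousAt_of_dominated (bound := fun σ => (π.1 / 2 + σ) ^
    (-((d : ℝ) + m) / 2 + d / 2 / q.toReal) * ‖F (1, 0)‖) ?_ ?_
    ((integrableOn_shift_rpow (half_pos hπ') he1).mul_const _) ?_
  · filter_upwards [hev] with π' h'
    exact (h.continuousOn_shift ((half_pos hπ').trans h')).aestronglyMeasurable measurableSet_Ioi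
  · filter_upwards [hev] with π' h'
    filter_upwards [ae_restrict_mem measurableSet_Ioi] with σ hσ
    have hσ' : (0 : ℝ) < σ := hσ
    rw [h.norm_le (π := π' + (σ, 0)) (add_pos ((half_pos hπ').trans h') hσ')]
    gcongr ?_ * _
    exact Real.rpow_le_rpow_of_nonpos (by positivity) (by simpa using h'.le) (by linarith)
  · filter_upwards [ae_restrict_mem measurableSet_Ioi] with σ hσ
    have hσ' : (0 : ℝ) < σ := hσ
    have h1 : ContinuousAt F (π + (σ, 0)) :=
      h.continuousOn.continuousAt (isOpen_posTime.mem_nhds (add_pos hπ' hσ'))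
    exact ContinuousAt.comp (f := fun π' : ℝ × E d => π' + (σ, 0)) h1 (by fun_prop)

theorem IsHeatFamily.lpConv_tailIntegral (h : IsHeatFamily q hq m f F) (hm : 2 < m)
    {π π' : ℝ × E d} (hπ : 0 < π.1) (hπ' : 0 < π'.1) :
    lpConv q (ContinuousLinearMap.lsmul ℝ ℝ) (heatLp 1 π) (tailIntegral F π') =
      tailIntegral F (π + π') := by
  unfold tailIntegral
  rw [← ContinuousLinearMap.integral_comp_comm _ (h.integrableOn_shift hm hπ')]
  refine setIntegral_congr_fun measurableSet_Ioi fun σ hσ => ?_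
  have hσ' : (0 : ℝ) < σ := hσ
  rw [h.lpConv_heat π (π' + (σ, 0)) hπ (add_pos hπ' hσ'), add_assoc]

theorem IsHeatFamily.coeFn_tailIntegral (h : IsHeatFamily q hq m f F) (hm : 2 < m)
    {π : ℝ × E d} (hπ : 0 < π.1) :
    tailIntegral F π =ᵐ[volume] fun x => ∫ s in Ioi π.1, f s (x + π.2) := by
  -- Joint continuity supplies the measurability required to evaluate the Bochner integral
  -- pointwise.
  have hcont : ContinuousOn (Function.uncurry fun (σ : ℝ) (x : E d) => f (π.1 + σ) (x + π.2))
      (Ioi 0 ×ˢ univ) := by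
    refine h.smoothOn.continuousOn.comp
      (f := fun z : ℝ × E d => (π.1 + z.1, z.2 + π.2)) (by fun_prop) fun z hz => ?_
    have : (0 : ℝ) < z.1 := hz.1
    exact add_pos hπ this
  have hmeas : AEStronglyMeasurable
      (Function.uncurry fun (σ : ℝ) (x : E d) => f (π.1 + σ) (x + π.2))
      ((volume.restrict (Ioi (0 : ℝ))).prod (volume : Measure (E d))) := by
    have h1 : (volume.restrict (Ioi (0 : ℝ))).prod (volume : Measure (E d)) =
        ((volume : Measure ℝ).prod (volume : Measure (E d))).restrict (Ioi 0 ×ˢ univ) := by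
      rw [← Measure.prod_restrict, Measure.restrict_univ]
    rw [h1]
    exact hcont.aestronglyMeasurable (measurableSet_Ioi.prod MeasurableSet.univ)
  have h2 := coeFn_integral_lp (h.integrableOn_shift hm hπ) hmeas (by
    filter_upwards [ae_restrict_mem measurableSet_Ioi] with σ hσ
    have hσ' : (0 : ℝ) < σ := hσ
    filter_upwards [h.coeFn (π + (σ, 0)) (add_pos hπ hσ')] with x hx
    rw [hx]
    simp)
  filter_upwards [h2] with x hx
  unfold tailIntegral
  rw [hx]
  exact setIntegral_Ioi_comp_add_left (fun s => f s (x + π.2)) π.1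

/-- The class of `oseenKernel λ i j k (· + b)` in `L^q`, as a function of `(λ, b)`. -/
def oseenLp (q : ℝ≥0∞) [Fact (1 ≤ q)] (i j k : Fin d) (π : ℝ × E d) :
    Lp ℝ q (volume : Measure (E d)) :=
  (if i = j then spaceDeriv k (heatLp q) π else 0) +
    tailIntegral (spaceDeriv i (spaceDeriv j (spaceDeriv k (heatLp q)))) π

theorem isHeatFamily_one (hq : q ≠ ⊤) (k : Fin d) :
    IsHeatFamily q hq 1 (fun t => pderiv k (heatKernel t)) (spaceDeriv k (heatLp q)) :=
  (isHeatFamily_heatLp hq).pderiv k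

theorem isHeatFamily_three (hq : q ≠ ⊤) (i j k : Fin d) :
    IsHeatFamily q hq 3 (fun t => pderiv i (pderiv j (pderiv k (heatKernel t))))
      (spaceDeriv i (spaceDeriv j (spaceDeriv k (heatLp q)))) :=
  ((isHeatFamily_one hq k).pderiv j).pderiv i

theorem coeFn_oseenLp (hq : q ≠ ⊤) (i j k : Fin d) {π : ℝ × E d} (hπ : 0 < π.1) :
    oseenLp q i j k π =ᵐ[volume] fun x => oseenKernel π.1 i j k (x + π.2) := by
  unfold oseenLp oseenKernel
  filter_upwards [Lp.coeFn_add (if i = j then spaceDeriv k (heatLp q) π else 0)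
    (tailIntegral (spaceDeriv i (spaceDeriv j (spaceDeriv k (heatLp q)))) π),
    (isHeatFamily_three hq i j k).coeFn_tailIntegral (by norm_num) hπ,
    (isHeatFamily_one hq k).coeFn π hπ, Lp.coeFn_zero ℝ q (volume : Measure (E d))]
    with x h1 h2 h3 h4
  rw [h1, Pi.add_apply, h2]
  split_ifs
  · rw [h3]
  · rw [h4]; rfl

/-- The tail of the third derivatives has the scaling of a first derivative, since integrating in
time gains one power of time, that is, two orders of differentiation. -/
theorem norm_oseenLp_le (hq : q ≠ ⊤) (i j k : Fin d) :
    ∃ C : ℝ, 0 ≤ C ∧ ∀ π : ℝ × E d, 0 < π.1 →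
      ‖oseenLp q i j k π‖ ≤ C * π.1 ^ (-((d : ℝ) + 1) / 2 + d / 2 / q.toReal) := by
  obtain ⟨C, hC, h⟩ := (isHeatFamily_three hq i j k).norm_tailIntegral_le (by norm_num)
  refine ⟨‖spaceDeriv k (heatLp q) ((1, 0) : ℝ × E d)‖ + C, by positivity, fun π hπ => ?_⟩
  have h3 : -((d : ℝ) + (3 : ℕ)) / 2 + d / 2 / q.toReal + 1 =
      -((d : ℝ) + 1) / 2 + d / 2 / q.toReal := by push_cast; ring
  rw [h3] at h
  rw [add_mul]
  refine (norm_add_le _ _).trans (add_le_add ?_ (h π hπ))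
  split_ifs
  · rw [(isHeatFamily_one hq k).norm_le hπ, mul_comm, Nat.cast_one]
  · rw [norm_zero]; positivity

theorem continuousOn_oseenLp (hq : q ≠ ⊤) (i j k : Fin d) :
    ContinuousOn (oseenLp (d := d) q i j k) (posTime d) := by
  unfold oseenLp
  refine ContinuousOn.add ?_ ((isHeatFamily_three hq i j k).continuousOn_tailIntegral (by norm_num))
  split_ifs
  · exact (isHeatFamily_one hq k).continuousOn
  · exact continuousOn_const

theorem lpConv_oseenLp (hq : q ≠ ⊤) (i j k : Fin d) {π π' : ℝ × E d} (hπ : 0 < π.1)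
    (hπ' : 0 < π'.1) :
    lpConv q (ContinuousLinearMap.lsmul ℝ ℝ) (heatLp 1 π) (oseenLp q i j k π') =
      oseenLp q i j k (π + π') := by
  unfold oseenLp
  rw [map_add, (isHeatFamily_three hq i j k).lpConv_tailIntegral (by norm_num) hπ hπ']
  split_ifs
  · rw [(isHeatFamily_one hq k).lpConv_heat π π' hπ hπ']
  · rw [map_zero]

end Oseen

end NSFreq

end

/-! ### The heat operators and the Navier-Stokes bilinear operator on Lᵖ. -/

noncomputable section

namespace NSFreq

variable {d : ℕ}

theorem coeFn_sum_lp {V ι : Type*} [NormedAddCommGroup V] {a : ℝ≥0∞} (s : Finset ι)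
    {T : ι → Lp V a (volume : Measure (E d))} {F : ι → E d → V}
    (h : ∀ i ∈ s, T i =ᵐ[volume] F i) :
    (∑ i ∈ s, T i : Lp V a (volume : Measure (E d))) =ᵐ[volume] fun x => ∑ i ∈ s, F i x := by
  classical
  induction s using Finset.induction_on with
  | empty =>
    simp only [Finset.sum_empty]
    exact Lp.coeFn_zero V a (volume : Measure (E d))
  | insert i s his ih =>
    rw [Finset.sum_insert his]
    filter_upwards [Lp.coeFn_add (T i) (∑ i ∈ s, T i), h i (Finset.mem_insert_self i s),
      ih fun j hj => h j (Finset.mem_insert_of_mem hj)] with x h1 h2 h3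
    rw [h1, Pi.add_apply, h2, h3, Finset.sum_insert his]

section CompLp

variable {V W : Type*} [NormedAddCommGroup V] [NormedSpace ℝ V] [CompleteSpace V]
  [NormedAddCommGroup W] [NormedSpace ℝ W] [CompleteSpace W] {a : ℝ≥0∞} [Fact (1 ≤ a)]

/-- A bounded linear map of the values passes through the convolution integral wherever the latter
converges. It lets scalar kernels act on vector fields component by component. -/
theorem lpConv_compLpL (L : V →L[ℝ] W) (g : Lp ℝ 1 (volume : Measure (E d)))
    (f : Lp V a (volume : Measure (E d))) :
    lpConv a (ContinuousLinearMap.lsmul ℝ ℝ) g (L.compLpL a volume f) =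
      L.compLpL a volume (lpConv a (ContinuousLinearMap.lsmul ℝ ℝ) g f) := by
  apply Lp.ext
  filter_upwards [coeFn_lpConv a (ContinuousLinearMap.lsmul ℝ ℝ) g (L.compLpL a volume f),
    L.coeFn_compLpL (lpConv a (ContinuousLinearMap.lsmul ℝ ℝ) g f),
    coeFn_lpConv a (ContinuousLinearMap.lsmul ℝ ℝ) g f,
    ae_convolutionExistsAt a (ContinuousLinearMap.lsmul ℝ ℝ) (Lp.memLp g) (Lp.memLp f)]
    with x h1 h2 h3 h4
  rw [h1, h2, h3, convolution_congr _ (EventuallyEq.refl _ _) (L.coeFn_compLpL f),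
    convolution_def, convolution_def, ← L.integral_comp_comm h4.integrable]
  simp

theorem lpTranslate_compLpL (L : V →L[ℝ] W) (b : E d) (f : Lp V a (volume : Measure (E d))) :
    lpTranslate b (L.compLpL a volume f) = L.compLpL a volume (lpTranslate b f) := by
  apply Lp.ext
  filter_upwards [coeFn_lpTranslate b (L.compLpL a volume f), ae_add_right b (L.coeFn_compLpL f),
    L.coeFn_compLpL (lpTranslate b f), coeFn_lpTranslate b f] with x h1 h2 h3 h4
  rw [h1, h2, h3, h4]

end CompLp

section HeatOperator

variable {p : ℝ≥0∞} [hp1 : Fact (1 ≤ p)]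

/-- The space of vector fields `Lᵖ(ℝᵈ; ℝᵈ)`. -/
abbrev VField (d : ℕ) (p : ℝ≥0∞) : Type := Lp (E d) p (volume : Measure (E d))

/-- The operator `e^{λΔ + b·∇}`, the convolution with `heatKernel λ (· + b)`. -/
def heatOp (p : ℝ≥0∞) [Fact (1 ≤ p)] (π : ℝ × E d) : VField d p →L[ℝ] VField d p :=
  lpConv p (ContinuousLinearMap.lsmul ℝ ℝ) (heatLp 1 π)

theorem norm_heatOp_apply_le {π : ℝ × E d} (hπ : 0 < π.1) (f : VField d p) :
    ‖heatOp p π f‖ ≤ ‖f‖ := by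
  unfold heatOp
  refine (norm_lpConv_le _ _ _ _).trans ?_
  rw [norm_heatLp_one hπ, mul_one]
  have : ‖(ContinuousLinearMap.lsmul ℝ ℝ : ℝ →L[ℝ] E d →L[ℝ] E d)‖ ≤ 1 :=
    ContinuousLinearMap.opNorm_lsmul_le
  nlinarith [norm_nonneg f]

theorem norm_heatOp_le {π : ℝ × E d} (hπ : 0 < π.1) : ‖heatOp p π‖ ≤ 1 :=
  ContinuousLinearMap.opNorm_le_bound _ zero_le_one fun f => by
    rw [one_mul]; exact norm_heatOp_apply_le hπ f

theorem heatOp_heatOp {π π' : ℝ × E d} (hπ : 0 < π.1) (hπ' : 0 < π'.1) (f : VField d p) :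
    heatOp p π (heatOp p π' f) = heatOp p (π + π') f := by
  unfold heatOp
  rw [lpConv_assoc, lpConv_heatLp ENNReal.one_ne_top hπ hπ']

theorem heatLp_eq_lpTranslate {t : ℝ} (ht : 0 < t) (b : E d) :
    heatLp 1 (t, b) = lpTranslate b (heatLp 1 ((t, 0) : ℝ × E d)) := by
  apply Lp.ext
  filter_upwards [coeFn_heatLp ENNReal.one_ne_top (π := (t, b)) ht,
    coeFn_lpTranslate b (heatLp 1 ((t, 0) : ℝ × E d)),
    ae_add_right b (coeFn_heatLp ENNReal.one_ne_top (π := ((t, 0) : ℝ × E d)) ht)] with x h1 h2 h3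
  rw [h1, h2, h3, add_zero]

theorem heatOp_eq_lpTranslate {t : ℝ} (ht : 0 < t) (b : E d) (f : VField d p) :
    heatOp p (t, b) f = lpTranslate b (heatOp p (t, 0) f) := by
  unfold heatOp
  rw [heatLp_eq_lpTranslate ht, lpTranslate_lpConv_left]

theorem coeFn_heatOp {t : ℝ} (ht : 0 < t) {f : E d → E d} (hf : MemLp f p volume) :
    heatOp p (t, 0) hf.toLp =ᵐ[volume] heat t f := by
  refine (coeFn_lpConv _ _ _ _).trans ?_
  rw [convolution_congr _ (coeFn_heatLp ENNReal.one_ne_top (π := ((t, 0) : ℝ × E d)) ht)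
    hf.coeFn_toLp]
  refine Eventually.of_forall fun x => ?_
  simp only [convolution_eq_swap, add_zero, ContinuousLinearMap.lsmul_apply]
  rfl

end HeatOperator

section BilinearOperator

variable {p q : ℝ≥0∞} [hp1 : Fact (1 ≤ p)] [hp2 : Fact (1 ≤ p / 2)] [hq1 : Fact (1 ≤ q)]
  [hpq : YoungTriple q (p / 2) p] [hpp : ENNReal.HolderTriple p p (p / 2)]

/-- The `j`-th component of a vector field. -/
def coordLp (p : ℝ≥0∞) [Fact (1 ≤ p)] (j : Fin d) :
    VField d p →L[ℝ] Lp ℝ p (volume : Measure (E d)) :=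
  (EuclideanSpace.proj j : E d →L[ℝ] ℝ).compLpL p volume

/-- The vector field `f eᵢ`. -/
def embedLp (p : ℝ≥0∞) [Fact (1 ≤ p)] (i : Fin d) :
    Lp ℝ p (volume : Measure (E d)) →L[ℝ] VField d p :=
  (ContinuousLinearMap.toSpanSingleton ℝ (EuclideanSpace.single i 1 : E d)).compLpL p volume

theorem coeFn_coordLp (j : Fin d) (f : VField d p) : coordLp p j f =ᵐ[volume] fun x => f x j :=
  ContinuousLinearMap.coeFn_compLpL _ f

theorem coeFn_embedLp (i : Fin d) (f : Lp ℝ p (volume : Measure (E d))) :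
    embedLp p i f =ᵐ[volume] fun x => f x • EuclideanSpace.single i 1 :=
  ContinuousLinearMap.coeFn_compLpL _ f

/-- The product `vⱼ wₖ` of components of vector fields. -/
def productLp (p : ℝ≥0∞) [Fact (1 ≤ p)] [Fact (1 ≤ p / 2)] [ENNReal.HolderTriple p p (p / 2)]
    (j k : Fin d) : VField d p →L[ℝ] VField d p →L[ℝ] Lp ℝ (p / 2) (volume : Measure (E d)) :=
  ((ContinuousLinearMap.mul ℝ ℝ).holderL volume p p (p / 2)).bilinearComp (coordLp p j)
    (coordLp p k)

theorem coeFn_productLp (j k : Fin d) (v w : VField d p) :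
    productLp p j k v w =ᵐ[volume] fun x => v x j * w x k := by
  have h : productLp p j k v w =
    (ContinuousLinearMap.mul ℝ ℝ).holder (p / 2) (coordLp p j v) (coordLp p k w) := rfl
  rw [h]
  filter_upwards [(ContinuousLinearMap.mul ℝ ℝ).coeFn_holder (r := p / 2) (coordLp p j v)
    (coordLp p k w), coeFn_coordLp j v, coeFn_coordLp k w] with x h1 h2 h3
  rw [h1, h2, h3]
  rfl

/-- The form `(κ, v, w) ↦ (κ * (vⱼ wₖ)) eᵢ`. -/
def oseenForm (p q : ℝ≥0∞) [Fact (1 ≤ p)] [Fact (1 ≤ p / 2)] [Fact (1 ≤ q)]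
    [YoungTriple q (p / 2) p] [ENNReal.HolderTriple p p (p / 2)] (i j k : Fin d) :
    Lp ℝ q (volume : Measure (E d)) →L[ℝ] VField d p →L[ℝ] VField d p →L[ℝ] VField d p :=
  -- Assembling the form from continuous linear maps makes continuity in the kernel, hence in time,
  -- automatic.
  (((ContinuousLinearMap.compL ℝ (VField d p)
      (VField d p →L[ℝ] Lp ℝ (p / 2) (volume : Measure (E d))) (VField d p →L[ℝ] VField d p)).flip
        (productLp p j k)).comp
    (ContinuousLinearMap.compL ℝ (VField d p) (Lp ℝ (p / 2) (volume : Measure (E d)))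
      (VField d p))).comp
    (((ContinuousLinearMap.compL ℝ (Lp ℝ (p / 2) (volume : Measure (E d)))
      (Lp ℝ p (volume : Measure (E d))) (VField d p)) (embedLp p i)).comp
        (lpConv p (ContinuousLinearMap.lsmul ℝ ℝ)))

theorem oseenForm_apply (i j k : Fin d) (κ : Lp ℝ q (volume : Measure (E d)))
    (v w : VField d p) : oseenForm p q i j k κ v w =
      embedLp p i (lpConv p (ContinuousLinearMap.lsmul ℝ ℝ) κ (productLp p j k v w)) :=
  rfl

theorem norm_oseenForm_le (i j k : Fin d) :
    ∃ D : ℝ, 0 ≤ D ∧ ∀ κ : Lp ℝ q (volume : Measure (E d)), ‖oseenForm p q i j k κ‖ ≤ D * ‖κ‖ := by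
  set l := ‖(ContinuousLinearMap.lsmul ℝ ℝ : ℝ →L[ℝ] ℝ →L[ℝ] ℝ)‖
  refine ⟨‖embedLp (d := d) p i‖ * l * ‖productLp (d := d) p j k‖, by positivity, fun κ =>
    ContinuousLinearMap.opNorm_le_bound₂ _ (by positivity) fun v w => ?_⟩
  rw [oseenForm_apply]
  calc _ ≤ ‖embedLp (d := d) p i‖ * (l * ‖κ‖ * (‖productLp (d := d) p j k‖ * ‖v‖ * ‖w‖)) := by
        refine (ContinuousLinearMap.le_opNorm _ _).trans ?_
        gcongr
        refine (norm_lpConv_le _ _ _ _).trans ?_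
        gcongr
        exact ContinuousLinearMap.le_opNorm₂ _ _ _
    _ = _ := by ring

/-- The bilinear operator `(v, w) ↦ e^{tΔ} ℙ ∇·(v ⊗ w)`. -/
def bilinOp (p q : ℝ≥0∞) [Fact (1 ≤ p)] [Fact (1 ≤ p / 2)] [Fact (1 ≤ q)]
    [YoungTriple q (p / 2) p] [ENNReal.HolderTriple p p (p / 2)] (t : ℝ) :
    VField d p →L[ℝ] VField d p →L[ℝ] VField d p :=
  ∑ i : Fin d, ∑ j : Fin d, ∑ k : Fin d, oseenForm p q i j k (oseenLp q i j k (t, 0))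

theorem bilinOp_apply (t : ℝ) (v w : VField d p) :
    bilinOp p q t v w = ∑ i : Fin d, ∑ j : Fin d, ∑ k : Fin d,
      oseenForm p q i j k (oseenLp q i j k (t, 0)) v w := by
  simp only [bilinOp, sum_apply]

theorem continuousOn_bilinOp (hq : q ≠ ⊤) :
    ContinuousOn (fun t : ℝ => bilinOp (d := d) p q t) (Ioi 0) := by
  unfold bilinOp
  refine continuousOn_finsetSum _ fun i _ => continuousOn_finsetSum _ fun j _ =>
    continuousOn_finsetSum _ fun k _ => (oseenForm p q i j k).continuous.comp_continuousOn ?_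
  exact (continuousOn_oseenLp hq i j k).comp (f := fun t : ℝ => ((t, 0) : ℝ × E d))
    (by fun_prop) fun t ht => ht

theorem norm_sum_sum_sum_le {A ι : Type*} [SeminormedAddCommGroup A] [Fintype ι]
    {T : ι → ι → ι → A} {D : ι → ι → ι → ℝ} (h : ∀ i j k, ‖T i j k‖ ≤ D i j k) :
    ‖∑ i, ∑ j, ∑ k, T i j k‖ ≤ ∑ i, ∑ j, ∑ k, D i j k :=
  norm_sum_le_of_le _ fun i _ => norm_sum_le_of_le _ fun j _ => norm_sum_le_of_le _
    fun k _ => h i j k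

/-- Summing over components loses only a constant, so the rate is the L^q rate of the Oseen kernel.
For q conjugate to p the exponent is s - 1 > -1 exactly because p > d. -/
theorem norm_bilinOp_le (hq : q ≠ ⊤) :
    ∃ C : ℝ, 0 ≤ C ∧ ∀ t : ℝ, 0 < t →
      ‖bilinOp (d := d) p q t‖ ≤ C * t ^ (-((d : ℝ) + 1) / 2 + d / 2 / q.toReal) := by
  have h0 : ∀ i j k : Fin d, ∃ C : ℝ, 0 ≤ C ∧ ∀ t : ℝ, 0 < t →
      ‖oseenForm p q i j k (oseenLp q i j k (t, 0))‖ ≤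
        C * t ^ (-((d : ℝ) + 1) / 2 + d / 2 / q.toReal) := fun i j k => by
    obtain ⟨C, hC, h⟩ := norm_oseenLp_le (d := d) hq i j k
    obtain ⟨D, hD, hD'⟩ := norm_oseenForm_le (d := d) (p := p) (q := q) i j k
    refine ⟨D * C, mul_nonneg hD hC, fun t ht => (hD' _).trans ?_⟩
    rw [mul_assoc]
    exact mul_le_mul_of_nonneg_left (h (t, 0) ht) hD
  choose C hC h using h0
  refine ⟨∑ i, ∑ j, ∑ k, C i j k, Finset.sum_nonneg fun i _ => Finset.sum_nonneg fun j _ =>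
    Finset.sum_nonneg fun k _ => hC i j k, fun t ht => ?_⟩
  have hnn : 0 ≤ ∑ i, ∑ j, ∑ k, C i j k := Finset.sum_nonneg fun i _ =>
    Finset.sum_nonneg fun j _ => Finset.sum_nonneg fun k _ => hC i j k
  refine ContinuousLinearMap.opNorm_le_bound₂ _ (by positivity) fun v w => ?_
  rw [bilinOp_apply]
  refine (norm_sum_sum_sum_le fun i j k => (ContinuousLinearMap.le_opNorm₂ _ v w).trans
    (mul_le_mul_of_nonneg_right (mul_le_mul_of_nonneg_right (h i j k t ht) (norm_nonneg v))
      (norm_nonneg w))).trans (le_of_eq ?_)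
  simp only [Finset.sum_mul]

/-- By associativity the heat kernel is convolved with the Oseen kernel first, and their times add.
The drift part of π comes out as a translation. -/
theorem heatOp_bilinOp (hq : q ≠ ⊤) {π : ℝ × E d} (hπ : 0 < π.1) {r : ℝ} (hr : 0 < r)
    (v w : VField d p) : heatOp p π (bilinOp p q r v w) =
      lpTranslate π.2 (bilinOp p q (π.1 + r) v w) := by
  have h0 : heatOp p (π.1, 0) (bilinOp p q r v w) = bilinOp p q (π.1 + r) v w := by
    simp only [bilinOp_apply, map_sum, oseenForm_apply]
    refine Finset.sum_congr rfl fun i _ => Finset.sum_congr rfl fun j _ =>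
      Finset.sum_congr rfl fun k _ => ?_
    unfold heatOp embedLp
    rw [lpConv_compLpL, lpConv_assoc,
      lpConv_oseenLp hq i j k (π := (π.1, 0)) (π' := (r, 0)) hπ hr]
    simp
  rw [← h0, ← heatOp_eq_lpTranslate hπ]

theorem lpTranslate_bilinOp (b : E d) (t : ℝ) (v w : VField d p) :
    lpTranslate b (bilinOp p q t v w) =
      bilinOp p q t (lpTranslate b v) (lpTranslate b w) := by
  simp only [bilinOp_apply, map_sum, oseenForm_apply]
  refine Finset.sum_congr rfl fun i _ => Finset.sum_congr rfl fun j _ =>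
    Finset.sum_congr rfl fun k _ => ?_
  have h : lpTranslate b (productLp p j k v w) =
      productLp p j k (lpTranslate b v) (lpTranslate b w) := by
    change lpTranslate b ((ContinuousLinearMap.mul ℝ ℝ).holderL volume p p (p / 2) (coordLp p j v)
      (coordLp p k w)) = (ContinuousLinearMap.mul ℝ ℝ).holderL volume p p (p / 2)
        (coordLp p j (lpTranslate b v)) (coordLp p k (lpTranslate b w))
    unfold coordLp
    rw [lpTranslate_holderL, lpTranslate_compLpL, lpTranslate_compLpL]
  unfold embedLp
  rw [lpTranslate_compLpL, lpTranslate_lpConv_right, h]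

theorem coeFn_bilinOp (hq : q ≠ ⊤) {t : ℝ} (ht : 0 < t) (v : VField d p) :
    bilinOp p q t v v =ᵐ[volume] oseenQuadratic t v := by
  rw [bilinOp_apply]
  have h := coeFn_sum_lp (d := d) Finset.univ
    (T := fun i : Fin d => ∑ j : Fin d, ∑ k : Fin d,
      oseenForm p q i j k (oseenLp q i j k (t, 0)) v v) (fun i _ =>
    coeFn_sum_lp (d := d) Finset.univ (T := fun j : Fin d => ∑ k : Fin d,
      oseenForm p q i j k (oseenLp q i j k (t, 0)) v v) fun j _ =>
    coeFn_sum_lp (d := d) Finset.univ (T := fun k : Fin d =>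
      oseenForm p q i j k (oseenLp q i j k (t, 0)) v v) (F := fun k x =>
        (∫ y, oseenKernel t i j k (x - y) * (v y j * v y k)) • (EuclideanSpace.single i 1 : E d))
      fun k _ => ?_)
  · refine h.trans (Eventually.of_forall fun x => ?_)
    ext l
    simp only [oseenQuadratic, WithLp.ofLp_sum, WithLp.ofLp_smul, Finset.sum_apply, Pi.smul_apply,
      EuclideanSpace.single, smul_eq_mul]
    simp_rw [← Finset.sum_mul]
    simp
  · rw [oseenForm_apply]
    filter_upwards [coeFn_embedLp i (lpConv p (ContinuousLinearMap.lsmul ℝ ℝ)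
      (oseenLp q i j k (t, 0)) (productLp p j k v v)), coeFn_lpConv p
      (ContinuousLinearMap.lsmul ℝ ℝ) (oseenLp q i j k (t, 0)) (productLp p j k v v)] with x h1 h2
    rw [h1, h2, convolution_congr _ (coeFn_oseenLp hq i j k (π := ((t, 0) : ℝ × E d)) ht)
      (coeFn_productLp j k v v), convolution_eq_swap]
    simp

end BilinearOperator

end NSFreq

end

/-! ### Time convolutions written in logarithmic time. -/

noncomputable section

namespace NSFreq

section Trilinear

variable {A B C D : Type*} [NormedAddCommGroup A] [NormedSpace ℝ A] [NormedAddCommGroup B]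
  [NormedSpace ℝ B] [NormedAddCommGroup C] [NormedSpace ℝ C] [NormedAddCommGroup D]
  [NormedSpace ℝ D]

/-- A bounded trilinear map as a continuous linear map. -/
def mkTrilinear (f : A → B → C → D) (M : ℝ) (hM : 0 ≤ M)
    (add₁ : ∀ a a' b c, f (a + a') b c = f a b c + f a' b c)
    (smul₁ : ∀ (r : ℝ) a b c, f (r • a) b c = r • f a b c)
    (add₂ : ∀ a b b' c, f a (b + b') c = f a b c + f a b' c)
    (smul₂ : ∀ (r : ℝ) a b c, f a (r • b) c = r • f a b c)
    (add₃ : ∀ a b c c', f a b (c + c') = f a b c + f a b c')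
    (smul₃ : ∀ (r : ℝ) a b c, f a b (r • c) = r • f a b c)
    (bound : ∀ a b c, ‖f a b c‖ ≤ M * ‖a‖ * ‖b‖ * ‖c‖) : A →L[ℝ] B →L[ℝ] C →L[ℝ] D :=
  LinearMap.mkContinuous
    { toFun := fun a => LinearMap.mkContinuous₂
        (LinearMap.mk₂ ℝ (f a) (add₂ a) (fun r => smul₂ r a) (add₃ a) (fun r => smul₃ r a))
        (M * ‖a‖) (bound a)
      map_add' := fun a a' => by ext b c; exact add₁ a a' b c
      map_smul' := fun r a => by ext b c; exact smul₁ r a b c }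
    M (fun a => LinearMap.mkContinuous₂_norm_le _ (by positivity) (bound a))

end Trilinear

section RpowIntegral

variable {s : ℝ}

theorem integrableOn_rpow_sub_one (hs : 0 < s) :
    IntegrableOn (fun σ : ℝ => σ ^ (s - 1)) (Ioo 0 1) := by
  have h := (intervalIntegral.intervalIntegrable_rpow' (a := 0) (b := 1) (r := s - 1)
    (by linarith)).1
  exact h.mono_set Ioo_subset_Ioc_self

theorem setIntegral_rpow_sub_one (hs : 0 < s) : ∫ σ in Ioo (0 : ℝ) 1, σ ^ (s - 1) = s⁻¹ := by
  rw [← integral_Ioc_eq_integral_Ioo, ← intervalIntegral.integral_of_le zero_le_one,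
    integral_rpow (Or.inl (by linarith))]
  simp [hs.ne']

theorem intervalIntegrable_sub_rpow (hs : 0 < s) (t τ : ℝ) :
    IntervalIntegrable (fun r : ℝ => (τ - r) ^ (s - 1)) volume 0 t := by
  have h := (intervalIntegral.intervalIntegrable_rpow' (a := τ) (b := τ - t) (r := s - 1)
    (by linarith)).comp_sub_left τ
  simpa using h

theorem integral_sub_rpow (hs : 0 < s) (t : ℝ) :
    ∫ r in (0 : ℝ)..t, (t - r) ^ (s - 1) = t ^ s / s := by
  rw [intervalIntegral.integral_comp_sub_left (fun r => r ^ (s - 1)) t,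
    integral_rpow (Or.inl (by linarith))]
  simp [hs.ne']

/-- Extending the integral to the half line gives a Gamma integral. Its factor Λ^{-s} makes the
singular Volterra kernel contractive in the weight e^{Λr} for large Λ. -/
theorem integral_sub_rpow_mul_exp_le (hs : 0 < s) {Λ t : ℝ} (hΛ : 0 < Λ) (ht : 0 ≤ t) :
    ∫ r in (0 : ℝ)..t, (t - r) ^ (s - 1) * Real.exp (-(Λ * (t - r))) ≤
      (1 / Λ) ^ s * Real.Gamma s := by
  rw [intervalIntegral.integral_comp_sub_left (fun r => r ^ (s - 1) * Real.exp (-(Λ * r))) t,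
    sub_self, sub_zero, ← Real.integral_rpow_mul_exp_neg_mul_Ioi hs hΛ,
    intervalIntegral.integral_of_le ht]
  refine setIntegral_mono_set ?_ ?_ Ioc_subset_Ioi_self.eventuallyLE
  · by_contra h
    have h2 := Real.integral_rpow_mul_exp_neg_mul_Ioi hs hΛ
    rw [integral_undef h] at h2
    have : 0 < (1 / Λ) ^ s * Real.Gamma s := mul_pos (by positivity) (Real.Gamma_pos_of_pos hs)
    linarith
  · filter_upwards [ae_restrict_mem measurableSet_Ioi] with r hr
    have : (0 : ℝ) < r := hr
    simp only [Pi.zero_apply]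
    positivity

end RpowIntegral

variable {X : Type*} [NormedAddCommGroup X] [NormedSpace ℝ X] [CompleteSpace X]

section LogTimeConvolution

open BoundedContinuousFunction

variable (s δ : ℝ)

/-- The convolution in time `∫₀ᵗ (t-r)^{s-1} k(t-r)(w(r), v(r)) dr`, written for functions of the
logarithm `θ` of time and with time truncated at `δ`. -/
def logConvFun (k : ℝ →ᵇ (X →L[ℝ] X →L[ℝ] X)) (w v : ℝ →ᵇ X) (θ : ℝ) : X :=
  -- The substitution r = t(1 - σ) gives t - r = tσ. Products become sums of logarithms, the
  -- integration domain no longer depends on t, and t^s comes out in front.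
  Real.exp (s * min θ (Real.log δ)) • ∫ σ in Ioo (0 : ℝ) 1, σ ^ (s - 1) •
    k (min θ (Real.log δ) + Real.log σ) (w (min θ (Real.log δ) + Real.log (1 - σ)))
      (v (min θ (Real.log δ) + Real.log (1 - σ)))

variable {s δ}

theorem norm_logConv_integrand_le (k : ℝ →ᵇ (X →L[ℝ] X →L[ℝ] X)) (w v : ℝ →ᵇ X) (m : ℝ) {σ : ℝ}
    (hσ : σ ∈ Ioo (0 : ℝ) 1) :
    ‖σ ^ (s - 1) • k (m + Real.log σ) (w (m + Real.log (1 - σ))) (v (m + Real.log (1 - σ)))‖ ≤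
      σ ^ (s - 1) * (‖k‖ * ‖w‖ * ‖v‖) := by
  rw [norm_smul, Real.norm_of_nonneg (Real.rpow_nonneg hσ.1.le _)]
  refine mul_le_mul_of_nonneg_left ?_ (Real.rpow_nonneg hσ.1.le _)
  refine (ContinuousLinearMap.le_opNorm₂ _ _ _).trans ?_
  gcongr
  · exact k.norm_coe_le_norm _
  · exact w.norm_coe_le_norm _
  · exact v.norm_coe_le_norm _

theorem aestronglyMeasurable_logConv_integrand (k : ℝ →ᵇ (X →L[ℝ] X →L[ℝ] X)) (w v : ℝ →ᵇ X)
    (m : ℝ) : AEStronglyMeasurable (fun σ : ℝ => σ ^ (s - 1) • k (m + Real.log σ)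
      (w (m + Real.log (1 - σ))) (v (m + Real.log (1 - σ)))) (volume.restrict (Ioo 0 1)) := by
  refine ContinuousOn.aestronglyMeasurable ?_ measurableSet_Ioo
  have h1 : ContinuousOn (fun σ : ℝ => m + Real.log σ) (Ioo 0 1) :=
    continuousOn_const.add (Real.continuousOn_log.mono fun σ hσ => hσ.1.ne')
  have h2 : ContinuousOn (fun σ : ℝ => m + Real.log (1 - σ)) (Ioo 0 1) :=
    continuousOn_const.add (Real.continuousOn_log.comp (by fun_prop) fun σ hσ => by
      simpa [sub_eq_zero] using hσ.2.ne')
  refine ContinuousOn.smul ?_ (((k.continuous.comp_continuousOn h1).clm_apply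
    (w.continuous.comp_continuousOn h2)).clm_apply (v.continuous.comp_continuousOn h2))
  exact fun σ hσ => (Real.continuousAt_rpow_const _ _ (Or.inl hσ.1.ne')).continuousWithinAt

theorem integrable_logConv_integrand (hs : 0 < s) (k : ℝ →ᵇ (X →L[ℝ] X →L[ℝ] X)) (w v : ℝ →ᵇ X)
    (m : ℝ) : IntegrableOn (fun σ : ℝ => σ ^ (s - 1) • k (m + Real.log σ)
      (w (m + Real.log (1 - σ))) (v (m + Real.log (1 - σ)))) (Ioo 0 1) := by
  refine ((integrableOn_rpow_sub_one hs).mul_const (‖k‖ * ‖w‖ * ‖v‖)).mono'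
    (aestronglyMeasurable_logConv_integrand k w v m) ?_
  filter_upwards [ae_restrict_mem measurableSet_Ioo] with σ hσ
  exact norm_logConv_integrand_le k w v m hσ

theorem continuous_logConvFun (hs : 0 < s) (k : ℝ →ᵇ (X →L[ℝ] X →L[ℝ] X)) (w v : ℝ →ᵇ X) :
    Continuous (logConvFun s δ k w v) := by
  unfold logConvFun
  refine Continuous.smul (by fun_prop) ?_
  refine continuous_of_dominated (bound := fun σ => σ ^ (s - 1) * (‖k‖ * ‖w‖ * ‖v‖))
    (fun θ => aestronglyMeasurable_logConv_integrand k w v _) (fun θ => ?_)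
    ((integrableOn_rpow_sub_one hs).mul_const _) ?_
  · filter_upwards [ae_restrict_mem measurableSet_Ioo] with σ hσ
    exact norm_logConv_integrand_le k w v _ hσ
  · refine Eventually.of_forall fun σ => Continuous.const_smul ?_ _
    exact ((k.continuous.comp (by fun_prop)).clm_apply (w.continuous.comp (by fun_prop))).clm_apply
      (v.continuous.comp (by fun_prop))

theorem norm_logConvFun_le (hs : 0 < s) (hδ : 0 < δ) (k : ℝ →ᵇ (X →L[ℝ] X →L[ℝ] X))
    (w v : ℝ →ᵇ X) (θ : ℝ) :
    ‖logConvFun s δ k w v θ‖ ≤ δ ^ s / s * ‖k‖ * ‖w‖ * ‖v‖ := by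
  have h1 : ‖∫ σ in Ioo (0 : ℝ) 1, σ ^ (s - 1) •
      k (min θ (Real.log δ) + Real.log σ) (w (min θ (Real.log δ) + Real.log (1 - σ)))
      (v (min θ (Real.log δ) + Real.log (1 - σ)))‖ ≤ s⁻¹ * (‖k‖ * ‖w‖ * ‖v‖) := by
    rw [← setIntegral_rpow_sub_one hs, ← integral_mul_const]
    refine norm_integral_le_of_norm_le ((integrableOn_rpow_sub_one hs).mul_const _) ?_
    filter_upwards [ae_restrict_mem measurableSet_Ioo] with σ hσ
    exact norm_logConv_integrand_le k w v _ hσ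
  have h2 : Real.exp (s * min θ (Real.log δ)) ≤ δ ^ s := by
    rw [Real.rpow_def_of_pos hδ, mul_comm]
    gcongr
    exact min_le_right _ _
  unfold logConvFun
  rw [norm_smul, Real.norm_of_nonneg (Real.exp_pos _).le]
  calc _ ≤ δ ^ s * (s⁻¹ * (‖k‖ * ‖w‖ * ‖v‖)) := by gcongr
    _ = _ := by ring

/-- `logConvFun` as a bounded trilinear map. -/
def logConv (X : Type*) [NormedAddCommGroup X] [NormedSpace ℝ X] [CompleteSpace X] {s δ : ℝ}
    (hs : 0 < s) (hδ : 0 < δ) : (ℝ →ᵇ (X →L[ℝ] X →L[ℝ] X)) →L[ℝ]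
    (ℝ →ᵇ X) →L[ℝ] (ℝ →ᵇ X) →L[ℝ] (ℝ →ᵇ X) :=
  mkTrilinear (fun k w v => ofNormedAddCommGroup (logConvFun s δ k w v)
      (continuous_logConvFun hs k w v) (δ ^ s / s * ‖k‖ * ‖w‖ * ‖v‖)
      (norm_logConvFun_le hs hδ k w v)) (δ ^ s / s) (by positivity)
    (fun k k' w v => by
      ext θ
      simp only [coe_ofNormedAddCommGroup, BoundedContinuousFunction.add_apply, logConvFun]
      rw [← smul_add, ← integral_add (integrable_logConv_integrand hs k w v _)
        (integrable_logConv_integrand hs k' w v _)]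
      simp)
    (fun r k w v => by
      ext θ
      simp only [coe_ofNormedAddCommGroup, BoundedContinuousFunction.smul_apply, logConvFun]
      rw [smul_comm r, ← integral_smul r]
      congr 1
      refine integral_congr_ae (Eventually.of_forall fun σ => ?_)
      simp only [BoundedContinuousFunction.smul_apply, map_smul, _root_.smul_apply]
      exact smul_comm _ _ _)
    (fun k w w' v => by
      ext θ
      simp only [coe_ofNormedAddCommGroup, BoundedContinuousFunction.add_apply, logConvFun]
      rw [← smul_add, ← integral_add (integrable_logConv_integrand hs k w v _)
        (integrable_logConv_integrand hs k w' v _)]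
      simp)
    (fun r k w v => by
      ext θ
      simp only [coe_ofNormedAddCommGroup, BoundedContinuousFunction.smul_apply, logConvFun]
      rw [smul_comm r, ← integral_smul r]
      congr 1
      refine integral_congr_ae (Eventually.of_forall fun σ => ?_)
      simp only [BoundedContinuousFunction.smul_apply, map_smul, _root_.smul_apply]
      exact smul_comm _ _ _)
    (fun k w v v' => by
      ext θ
      simp only [coe_ofNormedAddCommGroup, BoundedContinuousFunction.add_apply, logConvFun]
      rw [← smul_add, ← integral_add (integrable_logConv_integrand hs k w v _)
        (integrable_logConv_integrand hs k w v' _)]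
      simp)
    (fun r k w v => by
      ext θ
      simp only [coe_ofNormedAddCommGroup, BoundedContinuousFunction.smul_apply, logConvFun]
      rw [smul_comm r, ← integral_smul r]
      congr 1
      refine integral_congr_ae (Eventually.of_forall fun σ => ?_)
      simp only [BoundedContinuousFunction.smul_apply, map_smul, _root_.smul_apply]
      exact smul_comm _ _ _)
    (fun k w v => norm_ofNormedAddCommGroup_le _ (by positivity) _)

theorem logConv_apply (hs : 0 < s) (hδ : 0 < δ) (k : ℝ →ᵇ (X →L[ℝ] X →L[ℝ] X)) (w v : ℝ →ᵇ X)
    (θ : ℝ) : logConv X hs hδ k w v θ = logConvFun s δ k w v θ := rfl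

theorem norm_logConv_le (hs : 0 < s) (hδ : 0 < δ) (k : ℝ →ᵇ (X →L[ℝ] X →L[ℝ] X))
    (w v : ℝ →ᵇ X) : ‖logConv X hs hδ k w v‖ ≤ δ ^ s / s * ‖k‖ * ‖w‖ * ‖v‖ :=
  norm_ofNormedAddCommGroup_le _ (by positivity) (norm_logConvFun_le hs hδ k w v)

/-- `logConv` in the original time variable. -/
theorem logConv_log (hs : 0 < s) (hδ : 0 < δ) {k : ℝ →ᵇ (X →L[ℝ] X →L[ℝ] X)} {w v : ℝ →ᵇ X}
    {K : ℝ → X →L[ℝ] X →L[ℝ] X} {U V : ℝ → X} {t : ℝ} (ht : t ∈ Ioc 0 δ)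
    (hk : ∀ τ ∈ Ioo 0 t, k (Real.log τ) = τ ^ (1 - s) • K τ)
    (hU : ∀ r ∈ Ioo 0 t, w (Real.log r) = U r) (hV : ∀ r ∈ Ioo 0 t, v (Real.log r) = V r) :
    logConv X hs hδ k w v (Real.log t) = ∫ r in (0 : ℝ)..t, K (t - r) (U r) (V r) := by
  -- The same substitution in reverse; the powers t^s, t^{1-s} and σ^{s-1}, σ^{1-s} multiply to the
  -- Jacobian t.
  have h1 := intervalIntegral.smul_integral_comp_sub_mul (a := (0 : ℝ)) (b := 1)
    (fun r => K (t - r) (U r) (V r)) t t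
  simp only [mul_one, sub_self, mul_zero, sub_zero, sub_sub_cancel] at h1
  rw [← h1, logConv_apply, logConvFun, min_eq_left (Real.log_le_log ht.1 ht.2),
    intervalIntegral.integral_of_le zero_le_one, integral_Ioc_eq_integral_Ioo,
    ← integral_smul, ← integral_smul]
  refine setIntegral_congr_fun measurableSet_Ioo fun σ hσ => ?_
  have hσ' : 0 < 1 - σ := sub_pos.2 hσ.2
  have ht0 := ht.1
  have e1 : Real.log t + Real.log σ = Real.log (t * σ) := (Real.log_mul ht0.ne' hσ.1.ne').symm
  have e2 : Real.log t + Real.log (1 - σ) = Real.log (t - t * σ) := by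
    rw [← Real.log_mul ht0.ne' hσ'.ne', mul_sub, mul_one]
  have m1 : t * σ ∈ Ioo 0 t := ⟨mul_pos ht0 hσ.1, by nlinarith [hσ.2]⟩
  have m2 : t - t * σ ∈ Ioo 0 t := ⟨by nlinarith [hσ.2], by nlinarith [hσ.1]⟩
  rw [e1, e2, hk _ m1, hU _ m2, hV _ m2, _root_.smul_apply, _root_.smul_apply, smul_smul, smul_smul]
  congr 1
  rw [mul_comm s, ← Real.rpow_def_of_pos ht0, Real.mul_rpow ht0.le hσ.1.le]
  calc t ^ s * σ ^ (s - 1) * (t ^ (1 - s) * σ ^ (1 - s))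
      = (t ^ s * t ^ (1 - s)) * (σ ^ (s - 1) * σ ^ (1 - s)) := by ring
    _ = t := by
      rw [← Real.rpow_add ht0, ← Real.rpow_add hσ.1]
      simp

end LogTimeConvolution

end NSFreq

end

/-! ### Abstract mild equations: uniqueness, restart and concatenation. -/

noncomputable section

namespace NSFreq

variable {d : ℕ} {X : Type*} [NormedAddCommGroup X] [NormedSpace ℝ X]

/-- The data of an abstract parabolic evolution with a bilinear term: a heat semigroup `H (t, 0)`
combined with isometric translations `tr b`, and a bilinear kernel `B t` which is integrable at
`t = 0` and compatible with both. -/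
structure MildSystem (d : ℕ) (X : Type*) [NormedAddCommGroup X] [NormedSpace ℝ X] where
  H : ℝ × E d → X →L[ℝ] X
  tr : E d → X →L[ℝ] X
  B : ℝ → X →L[ℝ] X →L[ℝ] X
  s : ℝ
  C : ℝ
  s_pos : 0 < s
  s_le_one : s ≤ 1
  C_nonneg : 0 ≤ C
  norm_H_le : ∀ π ∈ posTime d, ‖H π‖ ≤ 1
  H_H : ∀ π ∈ posTime d, ∀ π' ∈ posTime d, ∀ x, H π (H π' x) = H (π + π') x
  contDiffOn_H : ContDiffOn ℝ ∞ H (posTime d)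
  H_eq_tr : ∀ t, 0 < t → ∀ b x, H (t, b) x = tr b (H (t, 0) x)
  tr_tr : ∀ b c x, tr b (tr c x) = tr (b + c) x
  tr_zero : ∀ x, tr 0 x = x
  norm_tr : ∀ b x, ‖tr b x‖ = ‖x‖
  tr_B : ∀ b t v w, tr b (B t v w) = B t (tr b v) (tr b w)
  continuousOn_B : ContinuousOn B (Ioi 0)
  norm_B_le : ∀ t, 0 < t → ‖B t‖ ≤ C * t ^ (s - 1)
  H_B : ∀ t r, 0 < t → 0 < r → ∀ v w, H (t, 0) (B r v w) = B (t + r) v w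
  -- This field and the next make π ↦ (τ ↦ H(τπ)) differentiable uniformly in τ ∈ (0, δ]. Smoothness
  -- of H on positive times alone gives no control as τ → 0.
  bounded_scaled_fderiv : ∀ μ, 0 < μ → ∀ δ, 0 < δ → ∃ K : ℝ, ∀ τ ∈ Ioc 0 δ, ∀ h : ℝ × E d,
    ‖fderiv ℝ H (τ * μ, 0) (τ • h)‖ ≤ K * ‖h‖
  scaled_differentiable : ∀ μ, 0 < μ → ∀ δ, 0 < δ → ∀ ε, 0 < ε → ∃ η, 0 < η ∧
    ∀ τ ∈ Ioc 0 δ, ∀ h : ℝ × E d, ‖h‖ < η →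
      ‖H ((τ * μ, 0) + τ • h) - H (τ * μ, 0) - fderiv ℝ H (τ * μ, 0) (τ • h)‖ ≤ ε * ‖h‖

namespace MildSystem

variable (P : MildSystem d X)

theorem norm_H_apply_le {π : ℝ × E d} (hπ : π ∈ posTime d) (x : X) : ‖P.H π x‖ ≤ ‖x‖ := by
  simpa using (P.H π).le_of_opNorm_le (P.norm_H_le π hπ) x

theorem norm_B_apply_le {t : ℝ} (ht : 0 < t) (v w : X) :
    ‖P.B t v w‖ ≤ P.C * t ^ (P.s - 1) * ‖v‖ * ‖w‖ := by
  refine (ContinuousLinearMap.le_opNorm₂ _ _ _).trans ?_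
  gcongr
  exact P.norm_B_le t ht

/-- Solutions of the mild formulation on `(0, T)`. -/
structure IsSol (x₀ : X) (T : ℝ) (U : ℝ → X) : Prop where
  continuousOn : ContinuousOn U (Ioo 0 T)
  bounded : ∀ T' < T, ∃ M : ℝ, ∀ t ∈ Ioc 0 T', ‖U t‖ ≤ M
  duhamel : ∀ t ∈ Ioo 0 T, U t = P.H (t, 0) x₀ - ∫ r in (0 : ℝ)..t, P.B (t - r) (U r) (U r)

section Integrals

variable {P} {U V : ℝ → X} {t τ M N : ℝ}

theorem continuousOn_integrand (hτ : t ≤ τ) (hU : ContinuousOn U (Ioo 0 t))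
    (hV : ContinuousOn V (Ioo 0 t)) :
    ContinuousOn (fun r => P.B (τ - r) (U r) (V r)) (Ioo 0 t) :=
  ((P.continuousOn_B.comp (f := fun r => τ - r) (by fun_prop) fun r hr => by
    have := hr.2; simp only [mem_Ioi]; linarith).clm_apply hU).clm_apply hV

theorem norm_integrand_le (hτ : t ≤ τ) (hUM : ∀ r ∈ Ioo 0 t, ‖U r‖ ≤ M)
    (hVN : ∀ r ∈ Ioo 0 t, ‖V r‖ ≤ N) {r : ℝ} (hr : r ∈ Ioo 0 t) :
    ‖P.B (τ - r) (U r) (V r)‖ ≤ (τ - r) ^ (P.s - 1) * (P.C * M * N) := by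
  have h : 0 < τ - r := by linarith [hr.2]
  have h0 : 0 ≤ M := (norm_nonneg _).trans (hUM r hr)
  have hC := P.C_nonneg
  calc _ ≤ P.C * (τ - r) ^ (P.s - 1) * ‖U r‖ * ‖V r‖ := P.norm_B_apply_le h _ _
    _ ≤ P.C * (τ - r) ^ (P.s - 1) * M * N := by
      gcongr
      · exact hUM r hr
      · exact hVN r hr
    _ = _ := by ring

theorem intervalIntegrable_integrand (ht : 0 ≤ t) (hτ : t ≤ τ) (hU : ContinuousOn U (Ioo 0 t))
    (hV : ContinuousOn V (Ioo 0 t)) (hUM : ∀ r ∈ Ioo 0 t, ‖U r‖ ≤ M)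
    (hVN : ∀ r ∈ Ioo 0 t, ‖V r‖ ≤ N) :
    IntervalIntegrable (fun r => P.B (τ - r) (U r) (V r)) volume 0 t := by
  have h1 := (intervalIntegrable_sub_rpow P.s_pos t τ).mul_const (P.C * M * N)
  rw [intervalIntegrable_iff_integrableOn_Ioo_of_le ht] at h1 ⊢
  refine h1.mono' ((continuousOn_integrand hτ hU hV).aestronglyMeasurable measurableSet_Ioo) ?_
  filter_upwards [ae_restrict_mem measurableSet_Ioo] with r hr
  exact norm_integrand_le hτ hUM hVN hr

theorem norm_integral_le (ht : 0 ≤ t) (hUM : ∀ r ∈ Ioo 0 t, ‖U r‖ ≤ M)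
    (hVN : ∀ r ∈ Ioo 0 t, ‖V r‖ ≤ N) :
    ‖∫ r in (0 : ℝ)..t, P.B (t - r) (U r) (V r)‖ ≤ t ^ P.s / P.s * (P.C * M * N) := by
  rw [← integral_sub_rpow P.s_pos, ← intervalIntegral.integral_mul_const]
  refine intervalIntegral.norm_integral_le_of_norm_le ht ?_
    ((intervalIntegrable_sub_rpow P.s_pos t t).mul_const _)
  filter_upwards [compl_mem_ae_iff.2 (measure_singleton t)] with r hr hrt
  exact norm_integrand_le le_rfl hUM hVN ⟨hrt.1, lt_of_le_of_ne hrt.2 hr⟩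

end Integrals

section Solutions

variable {P} {x₀ : X} {T T' : ℝ} {U V : ℝ → X}

theorem IsSol.mono (h : P.IsSol x₀ T U) (hT : T' ≤ T) : P.IsSol x₀ T' U :=
  ⟨h.continuousOn.mono (Ioo_subset_Ioo_right hT), fun T'' h' => h.bounded T'' (h'.trans_le hT),
    fun t ht => h.duhamel t ⟨ht.1, ht.2.trans_le hT⟩⟩

theorem IsSol.exists_bound (h : P.IsSol x₀ T U) (hT' : T' < T) :
    ∃ M : ℝ, 0 < M ∧ ∀ t ∈ Ioc 0 T', ‖U t‖ ≤ M := by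
  obtain ⟨M, hM⟩ := h.bounded T' hT'
  exact ⟨max M 1, by positivity, fun t ht => (hM t ht).trans (le_max_left _ _)⟩

theorem IsSol.intervalIntegrable (h : P.IsSol x₀ T U) {t τ : ℝ} (ht : t ∈ Ioo 0 T) (hτ : t ≤ τ) :
    IntervalIntegrable (fun r => P.B (τ - r) (U r) (U r)) volume 0 t := by
  obtain ⟨M, -, hM⟩ := h.exists_bound ht.2
  have hc := h.continuousOn.mono (Ioo_subset_Ioo_right ht.2.le)
  have hb : ∀ r ∈ Ioo 0 t, ‖U r‖ ≤ M := fun r hr => hM r ⟨hr.1, hr.2.le⟩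
  exact intervalIntegrable_integrand ht.1.le hτ hc hc hb hb

theorem exists_exp_rate {s : ℝ} (hs : 0 < s) {A : ℝ} (hA : 0 ≤ A) :
    ∃ Λ : ℝ, 0 < Λ ∧ A * ((1 / Λ) ^ s * Real.Gamma s) ≤ 1 / 2 := by
  have h : Tendsto (fun Λ : ℝ => A * ((1 / Λ) ^ s * Real.Gamma s)) atTop (𝓝 (A * (0 * Real.Gamma s))) := by
    refine Tendsto.const_mul _ (Tendsto.mul_const _ ?_)
    have := tendsto_rpow_neg_atTop hs
    refine this.congr' ?_
    filter_upwards [eventually_gt_atTop 0] with Λ hΛ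
    rw [one_div, Real.inv_rpow hΛ.le, Real.rpow_neg hΛ.le]
  rw [zero_mul, mul_zero] at h
  obtain ⟨Λ, h1, h2⟩ := ((h.eventually (ge_mem_nhds (by norm_num : (0 : ℝ) < 1 / 2))).and
    (eventually_gt_atTop 0)).exists
  exact ⟨Λ, h2, h1⟩

/-- On (0, t] both solutions are bounded, so the difference satisfies a linear Volterra inequality
with kernel C(M₁ + M₂)(r - ρ)^{s-1}. In the weight e^{Λr} with Λ large this operator halves norms,
and iterating it forces the difference to vanish. -/
theorem IsSol.unique (hU : P.IsSol x₀ T U) (hV : P.IsSol x₀ T V) {t : ℝ} (ht : t ∈ Ioo 0 T) :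
    U t = V t := by
  obtain ⟨M₁, hM₁, hUM⟩ := hU.exists_bound ht.2
  obtain ⟨M₂, hM₂, hVM⟩ := hV.exists_bound ht.2
  obtain ⟨Λ, hΛ, hΛ2⟩ := exists_exp_rate P.s_pos (A := P.C * (M₁ + M₂))
    (mul_nonneg P.C_nonneg (by positivity))
  have key : ∀ n : ℕ, ∀ r ∈ Ioc 0 t,
      ‖U r - V r‖ ≤ (M₁ + M₂) * (1 / 2) ^ n * Real.exp (Λ * r) := by
    intro n
    induction n with
    | zero =>
      intro r hr
      have h1 : 1 ≤ Real.exp (Λ * r) := Real.one_le_exp (mul_nonneg hΛ.le hr.1.le)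
      calc ‖U r - V r‖ ≤ ‖U r‖ + ‖V r‖ := norm_sub_le _ _
        _ ≤ (M₁ + M₂) * 1 := by rw [mul_one]; exact add_le_add (hUM r hr) (hVM r hr)
        _ ≤ _ := by
          rw [pow_zero, mul_one]; exact le_mul_of_one_le_right (by positivity) h1
    | succ n ih =>
      intro r hr
      have hrT : r ∈ Ioo 0 T := ⟨hr.1, hr.2.trans_lt ht.2⟩
      set D : ℝ := (M₁ + M₂) * (1 / 2) ^ n
      have hD : 0 ≤ D := by positivity
      have hdiff : U r - V r = -∫ ρ in (0 : ℝ)..r,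
          (P.B (r - ρ) (U ρ) (U ρ) - P.B (r - ρ) (V ρ) (V ρ)) := by
        rw [intervalIntegral.integral_sub (hU.intervalIntegrable hrT le_rfl)
          (hV.intervalIntegrable hrT le_rfl), hU.duhamel r hrT, hV.duhamel r hrT]
        abel
      rw [hdiff, norm_neg]
      calc _ ≤ ∫ ρ in (0 : ℝ)..r, P.C * (M₁ + M₂) * D * Real.exp (Λ * r) *
            ((r - ρ) ^ (P.s - 1) * Real.exp (-(Λ * (r - ρ)))) := by
            refine intervalIntegral.norm_integral_le_of_norm_le hr.1.le ?_ ?_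
            · filter_upwards [compl_mem_ae_iff.2 (measure_singleton r)] with ρ hρ hρr
              have h1 : 0 < r - ρ := sub_pos.2 (lt_of_le_of_ne hρr.2 hρ)
              have hρt : ρ ∈ Ioc 0 t := ⟨hρr.1, hρr.2.trans hr.2⟩
              have h2 : P.B (r - ρ) (U ρ) (U ρ) - P.B (r - ρ) (V ρ) (V ρ) =
                  P.B (r - ρ) (U ρ) (U ρ - V ρ) + P.B (r - ρ) (U ρ - V ρ) (V ρ) := by
                simp
              have hx := P.C_nonneg
              have h3 := Real.rpow_nonneg h1.le (P.s - 1)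
              rw [h2]
              calc _ ≤ P.C * (r - ρ) ^ (P.s - 1) * ‖U ρ‖ * ‖U ρ - V ρ‖ +
                    P.C * (r - ρ) ^ (P.s - 1) * ‖U ρ - V ρ‖ * ‖V ρ‖ :=
                    (norm_add_le _ _).trans
                      (add_le_add (P.norm_B_apply_le h1 _ _) (P.norm_B_apply_le h1 _ _))
                _ = P.C * (r - ρ) ^ (P.s - 1) * (‖U ρ‖ + ‖V ρ‖) * ‖U ρ - V ρ‖ := by ring
                _ ≤ P.C * (r - ρ) ^ (P.s - 1) * (M₁ + M₂) * (D * Real.exp (Λ * ρ)) := by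
                  gcongr
                  · exact hUM ρ hρt
                  · exact hVM ρ hρt
                  · exact ih ρ hρt
                _ = _ := by
                  have : Real.exp (Λ * ρ) = Real.exp (Λ * r) * Real.exp (-(Λ * (r - ρ))) := by
                    rw [← Real.exp_add]; ring_nf
                  rw [this]; ring
            · exact ((intervalIntegrable_sub_rpow P.s_pos r r).mul_continuousOn
                (by fun_prop)).const_mul _
        _ ≤ P.C * (M₁ + M₂) * D * Real.exp (Λ * r) * ((1 / Λ) ^ P.s * Real.Gamma P.s) := by
            rw [intervalIntegral.integral_const_mul]
            have := P.C_nonneg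
            gcongr
            exact integral_sub_rpow_mul_exp_le P.s_pos hΛ hr.1.le
        _ = (P.C * (M₁ + M₂) * ((1 / Λ) ^ P.s * Real.Gamma P.s)) * (D * Real.exp (Λ * r)) := by
            ring
        _ ≤ 1 / 2 * (D * Real.exp (Λ * r)) := by gcongr
        _ = _ := by simp only [D, pow_succ]; ring
  have hlim : Tendsto (fun n : ℕ => (M₁ + M₂) * (1 / 2) ^ n * Real.exp (Λ * t)) atTop (𝓝 0) := by
    have := ((tendsto_pow_atTop_nhds_zero_of_lt_one (r := (1 / 2 : ℝ)) (by norm_num)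
      (by norm_num)).const_mul (M₁ + M₂)).mul_const (Real.exp (Λ * t))
    simpa using this
  have h0 := ge_of_tendsto' hlim fun n => key n t ⟨ht.1, le_rfl⟩
  exact sub_eq_zero.1 (norm_le_zero_iff.1 h0)

variable [CompleteSpace X]

/-- The propagator is applied to the Duhamel formula at t₀ and passes under the integral; the
semigroup laws for H and for B shift all times by τ. -/
theorem IsSol.restart (h : P.IsSol x₀ T U) {t₀ τ : ℝ} (ht₀ : t₀ ∈ Ioo 0 T) (hτ : 0 < τ) :
    P.H (τ, 0) (U t₀) = P.H (t₀ + τ, 0) x₀ - ∫ r in (0 : ℝ)..t₀, P.B (t₀ + τ - r) (U r) (U r) := by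
  have ht₀' : ((t₀, 0) : ℝ × E d) ∈ posTime d := ht₀.1
  have hτ' : ((τ, 0) : ℝ × E d) ∈ posTime d := hτ
  rw [h.duhamel t₀ ht₀, map_sub, P.H_H _ hτ' _ ht₀',
    ← ContinuousLinearMap.intervalIntegral_comp_comm _ (h.intervalIntegrable ht₀ le_rfl)]
  refine congrArg₂ (· - ·) ?_ ?_
  · rw [Prod.mk_add_mk, add_zero, add_comm τ]
  · refine intervalIntegral.integral_congr_ae ?_
    filter_upwards [compl_mem_ae_iff.2 (measure_singleton t₀)] with r hr hrt
    rw [uIoc_of_le ht₀.1.le] at hrt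
    have hr' : τ + (t₀ - r) = t₀ + τ - r := by ring
    simp only [P.H_B τ _ hτ (sub_pos.2 (lt_of_le_of_ne hrt.2 hr)), hr']

theorem IsSol.intervalIntegrable_of_le (h : P.IsSol x₀ T U) {t τ a b : ℝ} (ht : t ∈ Ioo 0 T)
    (hτ : t ≤ τ) (ha : 0 ≤ a) (hab : a ≤ b) (hb : b ≤ t) :
    IntervalIntegrable (fun r => P.B (τ - r) (U r) (U r)) volume a b :=
  (h.intervalIntegrable ht hτ).mono_set (by
    rw [uIcc_of_le hab, uIcc_of_le ht.1.le]; exact Icc_subset_Icc ha hb)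

/-- The Duhamel integral up to t₀ + t splits at t₀, and the first piece together with the free
evolution is the propagated state at t₀. -/
theorem IsSol.shift (h : P.IsSol x₀ T U) {t₀ : ℝ} (ht₀ : t₀ ∈ Ioo 0 T) :
    P.IsSol (U t₀) (T - t₀) (fun t => U (t₀ + t)) := by
  refine ⟨h.continuousOn.comp (by fun_prop) fun t ht => ⟨by linarith [ht.1, ht₀.1], by
    linarith [ht.2]⟩, fun T' hT' => ?_, fun t ht => ?_⟩
  · obtain ⟨M, hM⟩ := h.bounded (t₀ + T') (by linarith)
    exact ⟨M, fun t ht => hM _ ⟨by linarith [ht.1, ht₀.1], by linarith [ht.2]⟩⟩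
  · have htT : t₀ + t ∈ Ioo 0 T := ⟨by linarith [ht.1, ht₀.1], by linarith [ht.2]⟩
    rw [h.restart ht₀ ht.1, h.duhamel _ htT, ← intervalIntegral.integral_add_adjacent_intervals
      (h.intervalIntegrable_of_le htT le_rfl le_rfl ht₀.1.le (by linarith [ht.1]))
      (h.intervalIntegrable_of_le htT le_rfl ht₀.1.le (by linarith [ht.1]) le_rfl)]
    have h1 := intervalIntegral.integral_comp_add_left (a := 0) (b := t)
      (fun r => P.B (t₀ + t - r) (U r) (U r)) t₀
    rw [add_zero] at h1
    rw [← h1]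
    simp only [add_sub_add_left_eq_sub]
    abel

/-- Concatenation of solutions. -/
theorem IsSol.glue (hU : P.IsSol x₀ T U) {t₀ : ℝ} (ht₀ : t₀ ∈ Ioo 0 T)
    (hV : P.IsSol (U t₀) T' V) (hT' : 0 < T') :
    P.IsSol x₀ (t₀ + T') (fun t => if t ≤ t₀ then U t else V (t - t₀)) := by
  set W : ℝ → X := fun t => if t ≤ t₀ then U t else V (t - t₀) with hW
  -- Uniqueness identifies the two pieces on their overlap, which extends beyond t₀. Continuity at
  -- the junction follows without any limit of V at 0.
  have hWU : ∀ t ∈ Ioo 0 (min T (t₀ + T')), W t = U t := by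
    intro t ht
    by_cases h : t ≤ t₀
    · simp [hW, h]
    · push Not at h
      simp only [hW, not_le.2 h, if_false]
      have h1 : t - t₀ ∈ Ioo 0 (min (T - t₀) T') :=
        ⟨sub_pos.2 h, lt_min (by linarith [ht.2, min_le_left T (t₀ + T')])
          (by linarith [ht.2, min_le_right T (t₀ + T')])⟩
      have h2 := (hV.mono (min_le_right _ _)).unique
        ((hU.shift ht₀).mono (min_le_left _ _)) h1
      rw [h2]; simp
  have hWV : ∀ t, t₀ < t → W t = V (t - t₀) := fun t ht => by simp [hW, ht]
  have hcont : ContinuousOn W (Ioo 0 (t₀ + T')) := by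
    intro t ht
    rcases lt_or_ge t (min T (t₀ + T')) with h | h
    · have hmem : Ioo 0 (min T (t₀ + T')) ∈ 𝓝 t := Ioo_mem_nhds ht.1 h
      refine ContinuousAt.continuousWithinAt ?_
      refine ((hU.continuousOn.mono (Ioo_subset_Ioo_right (min_le_left _ _))).continuousAt
        hmem).congr ?_
      filter_upwards [hmem] with r hr using (hWU r hr).symm
    · have h1 : t₀ < t := (lt_min ht₀.2 (by linarith)).trans_le h
      refine ContinuousAt.continuousWithinAt ?_
      have h2 : ContinuousAt (fun t => V (t - t₀)) t :=
        ContinuousAt.comp (g := V) (hV.continuousOn.continuousAt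
          (Ioo_mem_nhds (sub_pos.2 h1) (by linarith [ht.2]))) (by fun_prop)
      refine h2.congr ?_
      filter_upwards [Ioi_mem_nhds h1] with r hr using (hWV r hr).symm
  have hbd : ∀ T'' < t₀ + T', ∃ M : ℝ, ∀ t ∈ Ioc 0 T'', ‖W t‖ ≤ M := by
    intro T'' hT''
    obtain ⟨M₁, hM₁⟩ := hU.bounded t₀ ht₀.2
    obtain ⟨M₂, hM₂⟩ := hV.bounded (T'' - t₀) (by linarith)
    refine ⟨max M₁ M₂, fun t ht => ?_⟩
    by_cases h : t ≤ t₀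
    · simp only [hW, h, if_true]
      exact (hM₁ t ⟨ht.1, h⟩).trans (le_max_left _ _)
    · push Not at h
      rw [hWV t h]
      exact (hM₂ _ ⟨sub_pos.2 h, by linarith [ht.2]⟩).trans (le_max_right _ _)
  refine ⟨hcont, hbd, fun t ht => ?_⟩
  have hWU' : ∀ r ∈ Ioc 0 t₀, W r = U r := fun r hr => by simp [hW, hr.2]
  rcases le_or_gt t t₀ with h | h
  · rw [hWU' t ⟨ht.1, h⟩, hU.duhamel t ⟨ht.1, h.trans_lt ht₀.2⟩]
    congr 1
    refine intervalIntegral.integral_congr_ae (Eventually.of_forall fun r hr => ?_)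
    rw [uIoc_of_le ht.1.le] at hr
    simp only [hWU' r ⟨hr.1, hr.2.trans h⟩]
  · have htV : t - t₀ ∈ Ioo 0 T' := ⟨sub_pos.2 h, by linarith [ht.2]⟩
    have hcW := hcont.mono (Ioo_subset_Ioo_right ht.2.le)
    obtain ⟨M, hM⟩ := hbd t ht.2
    have hint := intervalIntegrable_integrand (P := P) ht.1.le le_rfl hcW hcW
      (fun r hr => hM r ⟨hr.1, hr.2.le⟩) (fun r hr => hM r ⟨hr.1, hr.2.le⟩)
    have hi1 : IntervalIntegrable (fun r => P.B (t - r) (W r) (W r)) volume 0 t₀ :=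
      hint.mono_set (by
        rw [uIcc_of_le ht₀.1.le, uIcc_of_le ht.1.le]; exact Icc_subset_Icc le_rfl h.le)
    have hi2 : IntervalIntegrable (fun r => P.B (t - r) (W r) (W r)) volume t₀ t :=
      hint.mono_set (by
        rw [uIcc_of_le h.le, uIcc_of_le ht.1.le]; exact Icc_subset_Icc ht₀.1.le le_rfl)
    rw [hWV t h, hV.duhamel _ htV, hU.restart ht₀ htV.1, add_sub_cancel,
      ← intervalIntegral.integral_add_adjacent_intervals hi1 hi2, ← sub_sub]
    congr 1
    · congr 1
      refine intervalIntegral.integral_congr_ae (Eventually.of_forall fun r hr => ?_)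
      rw [uIoc_of_le ht₀.1.le] at hr
      simp only [hWU' r hr]
    · have h1 := intervalIntegral.integral_comp_add_left (a := 0) (b := t - t₀)
        (fun r => P.B (t - r) (W r) (W r)) t₀
      rw [add_zero, add_sub_cancel] at h1
      rw [← h1]
      refine intervalIntegral.integral_congr_ae (Eventually.of_forall fun r hr => ?_)
      rw [uIoc_of_le htV.1.le] at hr
      simp only [hWV (t₀ + r) (by linarith [hr.1]), add_sub_cancel_left, sub_add_eq_sub_sub]

end Solutions

end MildSystem

end NSFreq

end

/-! ### Propagators as functions of logarithmic time, and local existence. -/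

noncomputable section

namespace NSFreq

open BoundedContinuousFunction

variable {d : ℕ} {X : Type*} [NormedAddCommGroup X] [NormedSpace ℝ X]

/-- Pointwise application of a bounded bilinear map with fixed second argument. -/
def bilinBCF {A B C : Type*} [NormedAddCommGroup A] [NormedSpace ℝ A] [NormedAddCommGroup B]
    [NormedSpace ℝ B] [NormedAddCommGroup C] [NormedSpace ℝ C] (L : A →L[ℝ] B →L[ℝ] C)
    (κ : ℝ →ᵇ B) : (ℝ →ᵇ A) →L[ℝ] (ℝ →ᵇ C) :=
  LinearMap.mkContinuous
    { toFun := fun a => ofNormedAddCommGroup (fun θ => L (a θ) (κ θ))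
        ((L.continuous.comp a.continuous).clm_apply κ.continuous) (‖L‖ * ‖κ‖ * ‖a‖) (fun θ => by
          refine (L.le_opNorm₂ _ _).trans ?_
          rw [mul_right_comm]
          gcongr
          · exact κ.norm_coe_le_norm θ
          · exact a.norm_coe_le_norm θ)
      map_add' := fun a a' => by ext θ; simp
      map_smul' := fun r a => by ext θ; simp }
    (‖L‖ * ‖κ‖) (fun a => (BoundedContinuousFunction.norm_le (by positivity)).2 fun θ => by
      refine (L.le_opNorm₂ _ _).trans ?_
      rw [mul_right_comm]
      gcongr
      · exact κ.norm_coe_le_norm θ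
      · exact a.norm_coe_le_norm θ)

/-- Composition of an operator with a bilinear operator. -/
def postComp (X : Type*) [NormedAddCommGroup X] [NormedSpace ℝ X] :
    (X →L[ℝ] X) →L[ℝ] (X →L[ℝ] X →L[ℝ] X) →L[ℝ] (X →L[ℝ] X →L[ℝ] X) :=
  (ContinuousLinearMap.compL ℝ X (X →L[ℝ] X) (X →L[ℝ] X)).comp (ContinuousLinearMap.compL ℝ X X X)

theorem isInvertible_id_add {Y : Type*} [NormedAddCommGroup Y] [NormedSpace ℝ Y] [CompleteSpace Y]
    {T : Y →L[ℝ] Y} (hT : ‖T‖ < 1) : (ContinuousLinearMap.id ℝ Y + T).IsInvertible := by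
  have h : IsUnit (1 - (-T)) := isUnit_one_sub_of_norm_lt_one (by rwa [norm_neg])
  rw [sub_neg_eq_add] at h
  obtain ⟨u, hu⟩ := h
  refine ContinuousLinearMap.IsInvertible.of_inverse (g := (↑u⁻¹ : Y →L[ℝ] Y)) ?_ ?_
  · change (1 + T) * ↑u⁻¹ = 1
    rw [← hu, Units.mul_inv]
  · change ↑u⁻¹ * (1 + T) = 1
    rw [← hu, Units.inv_mul]

theorem smul_mem_posTime {τ : ℝ} (hτ : 0 < τ) {π : ℝ × E d} (hπ : 0 < π.1) :
    τ • π ∈ posTime d := by simpa [posTime] using mul_pos hτ hπ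

namespace MildSystem

variable (P : MildSystem d X) (δ : ℝ)

/-- `exp` of `θ`, truncated at `δ`. -/
def cutTime (θ : ℝ) : ℝ := Real.exp (min θ (Real.log δ))

variable {δ} in
theorem cutTime_mem (hδ : 0 < δ) (θ : ℝ) : cutTime δ θ ∈ Ioc 0 δ :=
  ⟨Real.exp_pos _, by
    calc cutTime δ θ ≤ Real.exp (Real.log δ) := Real.exp_le_exp.2 (min_le_right _ _)
      _ = δ := Real.exp_log hδ⟩

variable {δ} in
theorem cutTime_log {t : ℝ} (ht : t ∈ Ioc 0 δ) : cutTime δ (Real.log t) = t := by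
  rw [cutTime, min_eq_left (Real.log_le_log ht.1 ht.2), Real.exp_log ht.1]

theorem continuous_cutTime : Continuous (cutTime δ) := by
  unfold cutTime; fun_prop

theorem log_cutTime (θ : ℝ) : Real.log (cutTime δ θ) = min θ (Real.log δ) := Real.log_exp _

/-- The normalized bilinear kernel `τ^{1-s} B(ρ τ)` as a function of `log τ`. -/
def bilinLog {δ ρ : ℝ} (hρ : 0 < ρ) : ℝ →ᵇ (X →L[ℝ] X →L[ℝ] X) :=
  ofNormedAddCommGroup (fun θ => cutTime δ θ ^ (1 - P.s) • P.B (ρ * cutTime δ θ))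
    (by
      have h0 : ∀ θ, 0 < cutTime δ θ := fun θ => Real.exp_pos _
      -- The power τ^{1-s} compensates the bound τ^{s-1} for B, so the normalized kernel is bounded
      -- down to τ = 0.
      refine Continuous.smul ((continuous_cutTime δ).rpow_const fun θ => Or.inl (h0 θ).ne') ?_
      exact P.continuousOn_B.comp_continuous (by have := continuous_cutTime δ; fun_prop)
        fun θ => mul_pos hρ (h0 θ))
    (P.C * ρ ^ (P.s - 1)) (fun θ => by
      have h0 : 0 < cutTime δ θ := Real.exp_pos _
      rw [norm_smul, Real.norm_of_nonneg (by positivity)]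
      calc _ ≤ cutTime δ θ ^ (1 - P.s) * (P.C * (ρ * cutTime δ θ) ^ (P.s - 1)) := by
            gcongr
            exact P.norm_B_le _ (mul_pos hρ h0)
        _ = P.C * ρ ^ (P.s - 1) * (cutTime δ θ ^ (1 - P.s) * cutTime δ θ ^ (P.s - 1)) := by
            rw [Real.mul_rpow hρ.le h0.le]; ring
        _ = P.C * ρ ^ (P.s - 1) := by
            rw [← Real.rpow_add h0]; simp)

theorem bilinLog_apply {ρ : ℝ} (hρ : 0 < ρ) (θ : ℝ) :
    P.bilinLog (δ := δ) hρ θ = cutTime δ θ ^ (1 - P.s) • P.B (ρ * cutTime δ θ) := rfl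

theorem norm_bilinLog_le {ρ : ℝ} (hρ : 0 < ρ) :
    ‖P.bilinLog (δ := δ) hρ‖ ≤ P.C * ρ ^ (P.s - 1) :=
  norm_ofNormedAddCommGroup_le _ (mul_nonneg P.C_nonneg (by positivity)) _

open Classical in
/-- The propagators `H (λ τ, τ a)`, `τ ≤ δ`, as a function of `log τ`. -/
def heatLog (π : ℝ × E d) : ℝ →ᵇ (X →L[ℝ] X) :=
  if hπ : 0 < π.1 then
    ofNormedAddCommGroup (fun θ => P.H (cutTime δ θ • π))
      (P.contDiffOn_H.continuousOn.comp_continuous (by have := continuous_cutTime δ; fun_prop)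
        fun θ => smul_mem_posTime (Real.exp_pos _) hπ) 1
      (fun θ => P.norm_H_le _ (smul_mem_posTime (Real.exp_pos _) hπ))
  else 0

theorem heatLog_apply {π : ℝ × E d} (hπ : 0 < π.1) (θ : ℝ) :
    P.heatLog δ π θ = P.H (cutTime δ θ • π) := by
  rw [heatLog, dif_pos hπ]; rfl

theorem norm_heatLog_le (π : ℝ × E d) : ‖P.heatLog δ π‖ ≤ 1 := by
  by_cases hπ : 0 < π.1
  · rw [heatLog, dif_pos hπ]; exact norm_ofNormedAddCommGroup_le _ zero_le_one _
  · rw [heatLog, dif_neg hπ]; simp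

variable {δ}

/-- Scaling by τ is additive in π, so the semigroup law holds at every τ simultaneously. In the
algebra of bounded operator-valued functions this is the hypothesis of `contDiffOn_of_map_add`. -/
theorem heatLog_add {π π' : ℝ × E d} (hπ : 0 < π.1) (hπ' : 0 < π'.1) :
    P.heatLog δ (π + π') = P.heatLog δ π * P.heatLog δ π' := by
  ext θ x
  have h0 : 0 < cutTime δ θ := Real.exp_pos _
  rw [BoundedContinuousFunction.mul_apply, heatLog_apply _ _ hπ, heatLog_apply _ _ hπ',
    heatLog_apply _ _ (add_pos hπ hπ'), mul_apply_eq_comp,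
    P.H_H _ (smul_mem_posTime h0 hπ) _ (smul_mem_posTime h0 hπ'), smul_add]

/-- The candidate derivative is taken pointwise in τ; the two uniformity fields of the system make
it bounded and control the remainder in the supremum norm. -/
theorem differentiableAt_heatLog (hδ : 0 < δ) {μ : ℝ} (hμ : 0 < μ) :
    DifferentiableAt ℝ (P.heatLog δ) (μ, 0) := by
  obtain ⟨K, hK⟩ := P.bounded_scaled_fderiv μ hμ δ hδ
  have hK' : ∀ θ : ℝ, ∀ h : ℝ × E d,
      ‖fderiv ℝ P.H (cutTime δ θ * μ, 0) (cutTime δ θ • h)‖ ≤ max K 0 * ‖h‖ := fun θ h =>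
    (hK _ (cutTime_mem hδ θ) h).trans (by gcongr; exact le_max_left _ _)
  have hcont : ∀ h : ℝ × E d, Continuous fun θ : ℝ =>
      fderiv ℝ P.H (cutTime δ θ * μ, 0) (cutTime δ θ • h) := fun h => by
    have h1 := P.contDiffOn_H.continuousOn_fderiv_of_isOpen isOpen_posTime (by simp)
    have hc := continuous_cutTime δ
    refine (h1.comp_continuous (f := fun θ : ℝ => ((cutTime δ θ * μ, 0) : ℝ × E d)) (by fun_prop)
      fun θ => mul_pos (Real.exp_pos _) hμ).clm_apply (by fun_prop)
  let D : ℝ × E d →L[ℝ] (ℝ →ᵇ (X →L[ℝ] X)) := LinearMap.mkContinuous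
    { toFun := fun h => ofNormedAddCommGroup _ (hcont h) (max K 0 * ‖h‖) fun θ => hK' θ h
      map_add' := fun h h' => by ext θ x; simp
      map_smul' := fun r h => by
        ext θ x
        simp [smul_comm (cutTime δ θ) r] }
    (max K 0) (fun h => norm_ofNormedAddCommGroup_le _ (by positivity) fun θ => hK' θ h)
  have hD : ∀ h θ, D h θ = fderiv ℝ P.H (cutTime δ θ * μ, 0) (cutTime δ θ • h) := fun h θ => rfl
  have : HasFDerivAt (P.heatLog δ) D (μ, 0) := by
    rw [hasFDerivAt_iff_isLittleO_nhds_zero, Asymptotics.isLittleO_iff]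
    intro ε hε
    obtain ⟨η, hη, h⟩ := P.scaled_differentiable μ hμ δ hδ ε hε
    filter_upwards [Metric.ball_mem_nhds (0 : ℝ × E d) hη, Metric.ball_mem_nhds (0 : ℝ × E d) hμ]
      with k hk hkμ
    rw [mem_ball_zero_iff] at hk hkμ
    have h1 : 0 < ((μ, (0 : E d)) + k).1 := by
      have : |k.1| ≤ ‖k‖ := norm_fst_le k
      have h3 := neg_abs_le k.1
      simp only [Prod.fst_add]; linarith
    rw [BoundedContinuousFunction.norm_le (by positivity)]
    intro θ
    rw [BoundedContinuousFunction.sub_apply, BoundedContinuousFunction.sub_apply,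
      P.heatLog_apply δ h1, P.heatLog_apply δ (π := (μ, 0)) hμ, hD]
    have h2 := h _ (cutTime_mem hδ θ) k hk
    simpa [smul_add] using h2
  exact this.differentiableAt

theorem contDiffOn_heatLog (hδ : 0 < δ) : ContDiffOn ℝ ∞ (P.heatLog δ) (posTime d) :=
  contDiffOn_of_map_add (ContinuousLinearMap.mul ℝ _)
    (fun _ _ hπ hπ' => P.heatLog_add hπ hπ') fun _ hμ => P.differentiableAt_heatLog hδ hμ

variable [CompleteSpace X]

theorem logConv_eq_integral {s : ℝ} (hs : 0 < s) (hδ : 0 < δ) {k : ℝ →ᵇ (X →L[ℝ] X →L[ℝ] X)}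
    {w v : ℝ →ᵇ X} {K : ℝ → X →L[ℝ] X →L[ℝ] X} {U V : ℝ → X} (θ : ℝ)
    (hk : ∀ τ ∈ Ioo 0 δ, k (Real.log τ) = τ ^ (1 - s) • K τ)
    (hU : ∀ r ∈ Ioo 0 δ, w (Real.log r) = U r) (hV : ∀ r ∈ Ioo 0 δ, v (Real.log r) = V r) :
    logConv X hs hδ k w v θ =
      ∫ r in (0 : ℝ)..cutTime δ θ, K (cutTime δ θ - r) (U r) (V r) := by
  have h := cutTime_mem hδ θ
  rw [← logConv_log hs hδ h (fun τ hτ => hk τ ⟨hτ.1, hτ.2.trans_le h.2⟩)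
    (fun τ hτ => hU τ ⟨hτ.1, hτ.2.trans_le h.2⟩) (fun τ hτ => hV τ ⟨hτ.1, hτ.2.trans_le h.2⟩),
    logConv_apply, logConv_apply, log_cutTime]
  simp [logConvFun]

/-- The free evolution of `x₀` as a function of the logarithm of time. -/
def evalLog (x₀ : X) : (ℝ →ᵇ (X →L[ℝ] X)) →L[ℝ] (ℝ →ᵇ X) :=
  (ContinuousLinearMap.apply ℝ X x₀).compLeftContinuousBounded ℝ

theorem evalLog_apply (x₀ : X) (A : ℝ →ᵇ (X →L[ℝ] X)) (θ : ℝ) : evalLog x₀ A θ = A θ x₀ := rfl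

/-- Contraction in the ball of radius 2‖x₀‖ of bounded continuous functions of log t. With q =
Cδ^s/s, invariance of the ball needs 4q‖x₀‖ ≤ 1, and the Lipschitz constant is 4q‖x₀‖; the factor 8
makes it at most 1/2. -/
theorem exists_sol (x₀ : X) (hδ : 0 < δ) (hsmall : 8 * (δ ^ P.s / P.s) * P.C * ‖x₀‖ ≤ 1) :
    ∃ U, P.IsSol x₀ δ U ∧ ∀ t ∈ Ioo 0 δ, ‖U t‖ ≤ 2 * ‖x₀‖ := by
  have hs := P.s_pos
  have hC := P.C_nonneg
  set κ : ℝ →ᵇ (X →L[ℝ] X →L[ℝ] X) := P.bilinLog (δ := δ) one_pos with hκ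
  have hκC : ‖κ‖ ≤ P.C := by simpa using P.norm_bilinLog_le (δ := δ) one_pos
  set b : ℝ →ᵇ X := evalLog x₀ (P.heatLog δ (1, 0)) with hb
  have hbθ : ∀ θ, b θ = P.H (cutTime δ θ, 0) x₀ := fun θ => by
    rw [hb, evalLog_apply, P.heatLog_apply δ (π := (1, 0)) one_pos]
    simp
  have hbn : ‖b‖ ≤ ‖x₀‖ := by
    rw [BoundedContinuousFunction.norm_le (norm_nonneg _)]
    intro θ
    rw [hbθ]
    exact P.norm_H_apply_le (π := (cutTime δ θ, 0)) (Real.exp_pos _) _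
  have hL : ∀ w v : ℝ →ᵇ X, ‖logConv X hs hδ κ w v‖ ≤ δ ^ P.s / P.s * P.C * ‖w‖ * ‖v‖ :=
    fun w v => (norm_logConv_le hs hδ κ w v).trans (by gcongr)
  set G : (ℝ →ᵇ X) → (ℝ →ᵇ X) := fun w => b - logConv X hs hδ κ w w with hG
  set R := 2 * ‖x₀‖ with hR
  set q := δ ^ P.s / P.s * P.C with hq
  have hq0 : 0 ≤ q := by positivity
  have hqx : 8 * (q * ‖x₀‖) ≤ 1 := by rw [hq]; linarith
  have hmaps : MapsTo G (Metric.closedBall 0 R) (Metric.closedBall 0 R) := by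
    intro w hw
    rw [mem_closedBall_zero_iff] at hw ⊢
    have h1 : ‖logConv X hs hδ κ w w‖ ≤ q * R * R := (hL w w).trans (by gcongr)
    have h2 : q * R * R ≤ ‖x₀‖ := by
      rw [hR]; nlinarith [norm_nonneg x₀]
    calc ‖G w‖ ≤ ‖b‖ + ‖logConv X hs hδ κ w w‖ := norm_sub_le _ _
      _ ≤ R := by rw [hR]; linarith
  have hlip : ContractingWith (1 / 2) (hmaps.restrict G _ _) := by
    refine ⟨by rw [← NNReal.coe_lt_coe]; norm_num, LipschitzWith.of_dist_le_mul fun w v => ?_⟩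
    have hw := mem_closedBall_zero_iff.1 w.2
    have hv := mem_closedBall_zero_iff.1 v.2
    change dist (G w) (G v) ≤ _ * dist (w : ℝ →ᵇ X) v
    rw [dist_eq_norm, dist_eq_norm]
    have h1 : G w - G v = -(logConv X hs hδ κ w (w - v) + logConv X hs hδ κ (w - v) v) := by
      simp only [hG, map_sub, _root_.sub_apply]; abel
    rw [h1, norm_neg]
    calc _ ≤ q * ‖(w : ℝ →ᵇ X)‖ * ‖(w : ℝ →ᵇ X) - v‖ + q * ‖(w : ℝ →ᵇ X) - v‖ * ‖(v : ℝ →ᵇ X)‖ :=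
          (norm_add_le _ _).trans (add_le_add (hL _ _) (hL _ _))
      _ ≤ q * R * ‖(w : ℝ →ᵇ X) - v‖ + q * ‖(w : ℝ →ᵇ X) - v‖ * R := by gcongr
      _ = 4 * (q * ‖x₀‖) * ‖(w : ℝ →ᵇ X) - v‖       := by
        simp only [hR]; ring
      _ ≤ _ := by
        gcongr
        push_cast
        linarith
  obtain ⟨w, hwR, hw, -⟩ := hlip.exists_fixedPoint' (Metric.isClosed_closedBall.isComplete) hmaps
    (x := 0) (Metric.mem_closedBall_self (by positivity)) (edist_ne_top _ _)
  rw [mem_closedBall_zero_iff] at hwR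
  have hwb : ∀ t, ‖w (Real.log t)‖ ≤ R := fun t => (w.norm_coe_le_norm _).trans hwR
  refine ⟨fun t => w (Real.log t), ⟨?_, fun T' _ => ⟨R, fun t _ => hwb t⟩, fun t ht => ?_⟩,
    fun t _ => hwb t⟩
  · exact w.continuous.comp_continuousOn (Real.continuousOn_log.mono fun t ht => ht.1.ne')
  · have ht' : t ∈ Ioc 0 δ := ⟨ht.1, ht.2.le⟩
    have h1 : w (Real.log t) = b (Real.log t) - logConv X hs hδ κ w w (Real.log t) := by
      conv_lhs => rw [← hw]
      rfl
    rw [h1, hbθ, cutTime_log ht', logConv_eq_integral hs hδ (K := P.B)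
      (U := fun t => w (Real.log t)) (V := fun t => w (Real.log t)), cutTime_log ht']
    · intro τ hτ
      rw [hκ, bilinLog_apply, cutTime_log ⟨hτ.1, hτ.2.le⟩, one_mul]
    · intros; rfl
    · intros; rfl

end MildSystem

end NSFreq

end

/-! ### Space-time smoothness of orbits by the implicit function theorem. -/

noncomputable section

namespace NSFreq

open BoundedContinuousFunction

variable {d : ℕ} {X : Type*} [NormedAddCommGroup X] [NormedSpace ℝ X] [CompleteSpace X]

namespace MildSystem

variable (P : MildSystem d X) {δ : ℝ}

/-- The kernel `τ^{1-s} H ((λ - 1/2) τ, τ a) B (τ / 2)` as a function of `log τ`. -/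
def movingKernel (δ : ℝ) (π : ℝ × E d) : ℝ →ᵇ (X →L[ℝ] X →L[ℝ] X) :=
  -- The kernel equals tr(τa) B(λτ), but written this way only H depends on the parameters. B is
  -- merely continuous in time, while H is smooth; the range λ > 1/2 is enough near λ = 1.
  bilinBCF (postComp X) (P.bilinLog (δ := δ) (one_half_pos (α := ℝ)))
    (P.heatLog δ (π - (1 / 2, 0)))

theorem norm_postComp_apply_le (A : X →L[ℝ] X) (b : X →L[ℝ] X →L[ℝ] X) (v w : X) :
    ‖postComp X A b v w‖ ≤ ‖A‖ * ‖b‖ * ‖v‖ * ‖w‖ := by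
  change ‖A (b v w)‖ ≤ _
  calc _ ≤ ‖A‖ * (‖b‖ * ‖v‖ * ‖w‖) :=
        (A.le_opNorm _).trans (by gcongr; exact b.le_opNorm₂ _ _)
    _ = _ := by ring

theorem half_rpow_le {s : ℝ} (hs : 0 < s) {l : ℝ} (hl : 1 / 2 ≤ l) (hs1 : s ≤ 1) :
    l ^ (s - 1) ≤ 2 := by
  calc l ^ (s - 1) ≤ (1 / 2 : ℝ) ^ (s - 1) :=
        Real.rpow_le_rpow_of_nonpos (by norm_num) hl (by linarith)
    _ = 2 ^ (1 - s) := by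
        rw [one_div, Real.inv_rpow (by norm_num), ← Real.rpow_neg (by norm_num), neg_sub]
    _ ≤ 2 ^ (1 : ℝ) := Real.rpow_le_rpow_of_exponent_le (by norm_num) (by linarith)
    _ = 2 := Real.rpow_one 2

theorem norm_movingKernel_le (π : ℝ × E d) : ‖P.movingKernel δ π‖ ≤ 2 * P.C := by
  have hC := P.C_nonneg
  rw [BoundedContinuousFunction.norm_le (by positivity)]
  intro θ
  refine ContinuousLinearMap.opNorm_le_bound₂ _ (by positivity) fun v w => ?_
  refine (norm_postComp_apply_le _ _ _ _).trans ?_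
  have h1 : ‖P.heatLog δ (π - (1 / 2, 0)) θ‖ ≤ 1 :=
    (norm_coe_le_norm _ _).trans (P.norm_heatLog_le δ _)
  have h2 : ‖P.bilinLog (δ := δ) (one_half_pos (α := ℝ)) θ‖ ≤ P.C * 2 :=
    (norm_coe_le_norm _ _).trans ((P.norm_bilinLog_le δ (one_half_pos (α := ℝ))).trans
      (mul_le_mul_of_nonneg_left (half_rpow_le P.s_pos le_rfl P.s_le_one) hC))
  calc _ ≤ 1 * (P.C * 2) * ‖v‖ * ‖w‖ := by gcongr
    _ = _ := by ring

theorem movingKernel_log {π : ℝ × E d} (hπ : 1 / 2 < π.1) {τ : ℝ} (hτ : τ ∈ Ioc 0 δ) :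
    P.movingKernel δ π (Real.log τ) = τ ^ (1 - P.s) •
      postComp X (P.H (τ • (π - (1 / 2, 0)))) (P.B (1 / 2 * τ)) := by
  have h : 0 < (π - ((1 / 2 : ℝ), (0 : E d))).1 := by simpa using hπ
  change postComp X (P.heatLog δ (π - (1 / 2, 0)) (Real.log τ))
    (P.bilinLog (δ := δ) (one_half_pos (α := ℝ)) (Real.log τ)) = _
  rw [P.heatLog_apply δ h, bilinLog_apply, cutTime_log hτ, map_smul]

theorem contDiffAt_movingKernel (hδ : 0 < δ) : ContDiffAt ℝ ∞ (P.movingKernel δ) (1, 0) := by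
  refine (ContinuousLinearMap.contDiff _).contDiffAt.comp _ ?_
  have h : ContDiffAt ℝ ∞ (P.heatLog δ) ((1, (0 : E d)) - (1 / 2, 0)) :=
    (P.contDiffOn_heatLog hδ).contDiffAt (isOpen_posTime.mem_nhds (by
      simp only [posTime, mem_ofPred_eq, Prod.fst_sub]; norm_num))
  exact h.comp (f := fun π : ℝ × E d => π - (1 / 2, 0)) _ (by fun_prop)

/-- The equation of a mild solution in dilated and moving coordinates. -/
def movingMap (δ : ℝ) (hδ : 0 < δ) (x₁ : X) (z : (ℝ × E d) × (ℝ →ᵇ X)) : ℝ →ᵇ X :=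
  -- The factor λ in front of the integral is the Jacobian of the dilation r ↦ λr in the Duhamel
  -- term.
  z.2 - evalLog x₁ (P.heatLog δ z.1) +
    z.1.1 • logConv X P.s_pos hδ (P.movingKernel δ z.1) z.2 z.2

variable {x₁ : X}

theorem contDiffAt_movingMap (hδ : 0 < δ) (w : ℝ →ᵇ X) :
    ContDiffAt ℝ ∞ (P.movingMap δ hδ x₁) ((1, 0), w) := by
  have h1 : ContDiffAt ℝ ∞ (fun z : (ℝ × E d) × (ℝ →ᵇ X) => P.heatLog δ z.1) ((1, 0), w) := by
    have h : ContDiffAt ℝ ∞ (P.heatLog δ) (1, 0) :=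
      (P.contDiffOn_heatLog hδ).contDiffAt (isOpen_posTime.mem_nhds (by simp [posTime]))
    exact h.comp (f := Prod.fst) ((1, 0), w) contDiffAt_fst
  have h2 : ContDiffAt ℝ ∞ (fun z : (ℝ × E d) × (ℝ →ᵇ X) => P.movingKernel δ z.1) ((1, 0), w) :=
    (P.contDiffAt_movingKernel hδ).comp (f := Prod.fst) ((1, 0), w) contDiffAt_fst
  have h3 : ContDiffAt ℝ ∞ (fun z : (ℝ × E d) × (ℝ →ᵇ X) => z.2) ((1, 0), w) := contDiffAt_snd
  have h4 : ContDiffAt ℝ ∞ (fun z : (ℝ × E d) × (ℝ →ᵇ X) => z.1.1) ((1, 0), w) :=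
    contDiffAt_fst.fst
  have h5 : ContDiffAt ℝ ∞ (fun z : (ℝ × E d) × (ℝ →ᵇ X) => logConv X P.s_pos hδ
      (P.movingKernel δ z.1)) ((1, 0), w) :=
    (ContinuousLinearMap.contDiff (logConv X P.s_pos hδ)).contDiffAt.comp _ h2
  exact (h3.sub ((ContinuousLinearMap.contDiff (evalLog x₁)).contDiffAt.comp _ h1)).add
    (h4.smul ((h5.clm_apply h3).clm_apply h3))

/-- At (1, 0) the derivative in w is the identity plus v ↦ L(w, v) + L(v, w). Since the moving
kernel has norm at most 2C, this perturbation has norm at most 1/2, and a Neumann series inverts the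
sum. -/
theorem isInvertible_fderiv_movingMap (hδ : 0 < δ) {w : ℝ →ᵇ X}
    (hw : 8 * P.C * (δ ^ P.s / P.s) * ‖w‖ ≤ 1) :
    (fderiv ℝ (P.movingMap δ hδ x₁) ((1, 0), w) ∘L
      .inr ℝ (ℝ × E d) (ℝ →ᵇ X)).IsInvertible := by
  set L := logConv X P.s_pos hδ (P.movingKernel δ (1, (0 : E d))) with hL
  have hs := P.s_pos
  have hC := P.C_nonneg
  have hn : ∀ v v', ‖L v v'‖ ≤ 2 * P.C * (δ ^ P.s / P.s) * ‖v‖ * ‖v'‖ := fun v v' => by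
    refine (norm_logConv_le P.s_pos hδ _ v v').trans ?_
    calc _ ≤ δ ^ P.s / P.s * (2 * P.C) * ‖v‖ * ‖v'‖ := by
          gcongr; exact P.norm_movingKernel_le _
      _ = _ := by ring
  have h1 : fderiv ℝ (P.movingMap δ hδ x₁) ((1, 0), w) ∘L .inr ℝ (ℝ × E d) (ℝ →ᵇ X) =
      .id ℝ (ℝ →ᵇ X) + (L w + L.flip w) := by
    have hF : HasFDerivAt (fun v : ℝ →ᵇ X => P.movingMap δ hδ x₁ ((1, 0), v))
        (fderiv ℝ (P.movingMap δ hδ x₁) ((1, 0), w) ∘L .inr ℝ (ℝ × E d) (ℝ →ᵇ X)) w :=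
      ((P.contDiffAt_movingMap hδ w).differentiableAt (by simp)).hasFDerivAt.comp w
        (hasFDerivAt_prodMk_right (1, 0) w)
    have hG : HasFDerivAt (fun v : ℝ →ᵇ X => P.movingMap δ hδ x₁ ((1, 0), v))
        (.id ℝ (ℝ →ᵇ X) + (L w + L.flip w)) w := by
      have e : (fun v : ℝ →ᵇ X => P.movingMap δ hδ x₁ ((1, 0), v)) =
          fun v => v - evalLog x₁ (P.heatLog δ (1, 0)) + L v v := by
        ext1 v; simp [movingMap, hL]
      rw [e]
      refine ((hasFDerivAt_id w).sub_const _).add ?_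
      have := (L.hasFDerivAt (x := w)).clm_apply (hasFDerivAt_id w)
      convert this using 1 <;> rfl
    exact hF.unique hG
  rw [h1]
  refine isInvertible_id_add (lt_of_le_of_lt (ContinuousLinearMap.opNorm_le_bound _
    (M := 1 / 2) (by norm_num) fun v => ?_) (by norm_num))
  rw [_root_.add_apply, ContinuousLinearMap.flip_apply]
  have := norm_nonneg v
  calc _ ≤ 2 * P.C * (δ ^ P.s / P.s) * ‖w‖ * ‖v‖ + 2 * P.C * (δ ^ P.s / P.s) * ‖v‖ * ‖w‖ :=
        (norm_add_le _ _).trans (add_le_add (hn _ _) (hn _ _))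
    _ = (8 * P.C * (δ ^ P.s / P.s) * ‖w‖) * (1 / 2 * ‖v‖) := by ring
    _ ≤ 1 * (1 / 2 * ‖v‖) := by gcongr
    _ = _ := one_mul _

variable {P} {V : ℝ → X} {T₂ T₃ M : ℝ}

/-- A small solution of the equation in moving coordinates is the moving solution. -/
theorem IsSol.eq_of_movingMap_eq_zero (hV : P.IsSol x₁ T₂ V) (hδ : 0 < δ) (hT : T₃ < T₂)
    (hM : ∀ t ∈ Ioc 0 T₃, ‖V t‖ ≤ M) (hM0 : 0 ≤ M)
    (hsmall : 32 * P.C * (δ ^ P.s / P.s) * (M + 1) ≤ 1) {π : ℝ × E d} (hπ₁ : 1 / 2 < π.1)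
    (hπ₂ : π.1 < 2) (hπ₃ : δ * π.1 ≤ T₃) {w : ℝ →ᵇ X} (hw : ‖w‖ ≤ M + 1)
    (h0 : P.movingMap δ hδ x₁ (π, w) = 0) :
    w (Real.log δ) = P.tr (δ • π.2) (V (δ * π.1)) := by
  have hs := P.s_pos
  have hC := P.C_nonneg
  have hπ0 : 0 < π.1 := by linarith
  obtain ⟨l, a⟩ := π
  simp only at hπ₁ hπ₂ hπ₃ hπ0 ⊢
  -- Undoing the translation returns to the rest frame, where W is to be compared with V(l ·).
  set W : ℝ → X := fun t => P.tr (-(t • a)) (w (Real.log t)) with hW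
  set K : ℝ → X →L[ℝ] X →L[ℝ] X := fun τ =>
    postComp X (P.H (τ • ((l, a) - (1 / 2, 0)))) (P.B (1 / 2 * τ)) with hK
  have hpos : ∀ τ : ℝ, 0 < τ → τ • (((l, a) : ℝ × E d) - (1 / 2, 0)) ∈ posTime d := fun τ hτ =>
    smul_mem_posTime hτ (by simpa using hπ₁)
  have hWM : ∀ t, ‖W t‖ ≤ M + 1 := fun t => by
    rw [hW, P.norm_tr]; exact (w.norm_coe_le_norm _).trans hw
  -- The drift τa in the kernel turns the translation by -ta into one by -(t - τ)a, which is the one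
  -- that defines W at time t - τ.
  have htr : ∀ t τ : ℝ, 0 < τ → ∀ v : X,
      P.tr (-(t • a)) (K τ v v) = P.B (l * τ) (P.tr (-((t - τ) • a)) v)
        (P.tr (-((t - τ) • a)) v) := by
    intro t τ hτ v
    have e1 : τ • (((l, a) : ℝ × E d) - (1 / 2, 0)) = ((l - 1 / 2) * τ, τ • a) := by
      ext <;> simp [mul_comm]
    have e2 : 0 < (l - 1 / 2) * τ := mul_pos (by linarith) hτ
    change P.tr (-(t • a)) (P.H (τ • ((l, a) - (1 / 2, 0))) (P.B (1 / 2 * τ) v v)) = _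
    rw [e1, P.H_eq_tr _ e2, P.H_B _ _ e2 (by positivity), P.tr_tr, P.tr_B]
    have e3 : -(t • a) + τ • a = -((t - τ) • a) := by rw [sub_smul]; abel
    have e4 : (l - 1 / 2) * τ + 1 / 2 * τ = l * τ := by ring
    rw [e3, e4]
  have hVl : ∀ r ∈ Ioc 0 δ, l * r ∈ Ioc 0 T₃ := fun r hr =>
    ⟨mul_pos hπ0 hr.1, (mul_le_mul_of_nonneg_left hr.2 hπ0.le).trans (by rwa [mul_comm])⟩
  -- W and V(l ·) satisfy the same dilated Duhamel equation, so the free terms cancel in the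
  -- difference.
  have hWeq : ∀ t ∈ Ioc 0 δ, W t - V (l * t) = -(l • ∫ r in (0 : ℝ)..t,
      (P.B (l * (t - r)) (W r) (W r) - P.B (l * (t - r)) (V (l * r)) (V (l * r)))) := by
    intro t ht
    have hlt := hVl t ht
    have hltT : l * t ∈ Ioo 0 T₂ := ⟨hlt.1, hlt.2.trans_lt hT⟩
    have h1 : w (Real.log t) = P.H (t • (l, a)) x₁ -
        l • ∫ r in (0 : ℝ)..t, K (t - r) (w (Real.log r)) (w (Real.log r)) := by
      have h2 := DFunLike.congr_fun h0 (Real.log t)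
      simp only [movingMap, BoundedContinuousFunction.add_apply, BoundedContinuousFunction.sub_apply,
        BoundedContinuousFunction.smul_apply, evalLog_apply, P.heatLog_apply δ (π := (l, a)) hπ0,
        BoundedContinuousFunction.coe_zero, Pi.zero_apply] at h2
      rw [logConv_eq_integral hs hδ (K := K) (U := fun t => w (Real.log t))
        (V := fun t => w (Real.log t)) _
        (fun τ hτ => P.movingKernel_log hπ₁ ⟨hτ.1, hτ.2.le⟩) (fun _ _ => rfl) (fun _ _ => rfl),
        cutTime_log ht] at h2
      refine sub_eq_zero.1 (Eq.trans ?_ h2)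
      abel
    have hKint : IntervalIntegrable (fun r => K (t - r) (w (Real.log r)) (w (Real.log r)))
        volume 0 t := by
      have hg := (intervalIntegrable_sub_rpow hs t t).mul_const (P.C * 2 * ‖w‖ * ‖w‖)
      rw [intervalIntegrable_iff_integrableOn_Ioo_of_le ht.1.le] at hg ⊢
      refine hg.mono' (ContinuousOn.aestronglyMeasurable ?_ measurableSet_Ioo) ?_
      · have c1 : ContinuousOn (fun r : ℝ => w (Real.log r)) (Ioo 0 t) :=
          w.continuous.comp_continuousOn (Real.continuousOn_log.mono fun r hr => hr.1.ne')
        have c2 : ContinuousOn (fun r : ℝ => P.H ((t - r) • ((l, a) - (1 / 2, 0)))) (Ioo 0 t) :=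
          P.contDiffOn_H.continuousOn.comp (f := fun r : ℝ => (t - r) • (((l, a) : ℝ × E d) -
            (1 / 2, 0))) (by fun_prop) fun r hr => hpos _ (sub_pos.2 hr.2)
        have c3 : ContinuousOn (fun r : ℝ => P.B (1 / 2 * (t - r))) (Ioo 0 t) :=
          P.continuousOn_B.comp (f := fun r : ℝ => 1 / 2 * (t - r)) (by fun_prop)
            fun r hr => mul_pos (by norm_num) (sub_pos.2 hr.2)
        exact c2.clm_apply ((c3.clm_apply c1).clm_apply c1)
      · filter_upwards [ae_restrict_mem measurableSet_Ioo] with r hr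
        have hr' : 0 < t - r := sub_pos.2 hr.2
        have hww := w.norm_coe_le_norm (Real.log r)
        calc _ ≤ ‖P.H ((t - r) • ((l, a) - (1 / 2, 0)))‖ * ‖P.B (1 / 2 * (t - r))‖ *
              ‖w (Real.log r)‖ * ‖w (Real.log r)‖ := norm_postComp_apply_le _ _ _ _
          _ ≤ 1 * (P.C * (1 / 2 * (t - r)) ^ (P.s - 1)) * ‖w‖ * ‖w‖ := by
            gcongr
            · exact P.norm_H_le _ (hpos _ hr')
            · exact P.norm_B_le _ (by positivity)
          _ ≤ 1 * (P.C * (2 * (t - r) ^ (P.s - 1))) * ‖w‖ * ‖w‖ := by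
            rw [Real.mul_rpow (by norm_num) hr'.le]
            gcongr
            exact half_rpow_le hs le_rfl P.s_le_one
          _ = _ := by ring
    have h3 : W t = P.H (l * t, 0) x₁ -
        l • ∫ r in (0 : ℝ)..t, P.tr (-(t • a)) (K (t - r) (w (Real.log r)) (w (Real.log r))) := by
      have e : t • ((l, a) : ℝ × E d) = (l * t, t • a) := by ext <;> simp [mul_comm]
      rw [ContinuousLinearMap.intervalIntegral_comp_comm _ hKint, hW]
      simp only
      rw [h1, map_sub, map_smul, e, P.H_eq_tr _ hlt.1, P.tr_tr, neg_add_cancel, P.tr_zero]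
    have h4 : V (l * t) = P.H (l * t, 0) x₁ -
        l • ∫ r in (0 : ℝ)..t, P.B (l * (t - r)) (V (l * r)) (V (l * r)) := by
      rw [hV.duhamel _ hltT]
      congr 1
      have := intervalIntegral.smul_integral_comp_mul_left (a := (0 : ℝ)) (b := t)
        (fun r => P.B (l * t - r) (V r) (V r)) l
      rw [mul_zero] at this
      rw [← this]
      simp only [mul_sub]
    have hi2 : IntervalIntegrable (fun r => P.B (l * (t - r)) (V (l * r)) (V (l * r)))
        volume 0 t := by
      have := (hV.intervalIntegrable hltT le_rfl).comp_mul_left (c := l)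
      rw [zero_div, mul_div_cancel_left₀ _ hπ0.ne'] at this
      simpa only [mul_sub] using this
    have hcongr : ∀ r ∈ Ioo 0 t, P.tr (-(t • a)) (K (t - r) (w (Real.log r)) (w (Real.log r))) =
        P.B (l * (t - r)) (W r) (W r) := fun r hr => by
      rw [htr t (t - r) (sub_pos.2 hr.2), sub_sub_cancel]
    have hae : ∀ᵐ r : ℝ, r ∈ uIoc 0 t →
        P.tr (-(t • a)) (K (t - r) (w (Real.log r)) (w (Real.log r))) =
        P.B (l * (t - r)) (W r) (W r) := by
      filter_upwards [compl_mem_ae_iff.2 (measure_singleton t)] with r hr hrt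
      rw [uIoc_of_le ht.1.le] at hrt
      exact hcongr r ⟨hrt.1, lt_of_le_of_ne hrt.2 hr⟩
    have hi1 : IntervalIntegrable (fun r => P.B (l * (t - r)) (W r) (W r)) volume 0 t :=
      IntervalIntegrable.congr_ae
        ⟨(P.tr (-(t • a))).integrable_comp hKint.1, (P.tr (-(t • a))).integrable_comp hKint.2⟩
        ((ae_restrict_iff' measurableSet_uIoc).2 hae)
    rw [h3, h4, intervalIntegral.integral_sub hi1 hi2,
      intervalIntegral.integral_congr_ae hae, smul_sub]
    abel
  -- Both functions are bounded by M + 1, l < 2 and l^{s-1} ≤ 2. The Lipschitz constant is then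
  -- 8C(δ^s/s)(M + 1), at most 1/4 by the smallness assumption.
  have key : ∀ n : ℕ, ∀ t ∈ Ioc 0 δ, ‖W t - V (l * t)‖ ≤ 2 * (M + 1) * (1 / 2) ^ n := by
    intro n
    induction n with
    | zero =>
      intro t ht
      calc _ ≤ ‖W t‖ + ‖V (l * t)‖ := norm_sub_le _ _
        _ ≤ (M + 1) + M := add_le_add (hWM t) (hM _ (hVl t ht))
        _ ≤ _ := by rw [pow_zero]; linarith
    | succ n ih =>
      intro t ht
      set D : ℝ := 2 * (M + 1) * (1 / 2) ^ n with hD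
      have hD0 : 0 ≤ D := by positivity
      rw [hWeq t ht, norm_neg, norm_smul, Real.norm_of_nonneg hπ0.le]
      have hint : ‖∫ r in (0 : ℝ)..t, (P.B (l * (t - r)) (W r) (W r) -
          P.B (l * (t - r)) (V (l * r)) (V (l * r)))‖ ≤
          t ^ P.s / P.s * (2 * P.C * (2 * (M + 1)) * D) := by
        rw [← integral_sub_rpow hs, ← intervalIntegral.integral_mul_const]
        refine intervalIntegral.norm_integral_le_of_norm_le ht.1.le ?_
          ((intervalIntegrable_sub_rpow hs t t).mul_const _)
        filter_upwards [compl_mem_ae_iff.2 (measure_singleton t)] with r hr hrt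
        have hr' : 0 < t - r := sub_pos.2 (lt_of_le_of_ne hrt.2 hr)
        have hlr : 0 < l * (t - r) := mul_pos hπ0 hr'
        have hrδ : r ∈ Ioc 0 δ := ⟨hrt.1, hrt.2.trans ht.2⟩
        have hVr := hM _ (hVl r hrδ)
        have h2 : P.B (l * (t - r)) (W r) (W r) - P.B (l * (t - r)) (V (l * r)) (V (l * r)) =
            P.B (l * (t - r)) (W r) (W r - V (l * r)) +
              P.B (l * (t - r)) (W r - V (l * r)) (V (l * r)) := by simp
        have h3 := Real.rpow_nonneg hlr.le (P.s - 1)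
        rw [h2]
        calc _ ≤ P.C * (l * (t - r)) ^ (P.s - 1) * ‖W r‖ * ‖W r - V (l * r)‖ +
              P.C * (l * (t - r)) ^ (P.s - 1) * ‖W r - V (l * r)‖ * ‖V (l * r)‖ :=
              (norm_add_le _ _).trans
                (add_le_add (P.norm_B_apply_le hlr _ _) (P.norm_B_apply_le hlr _ _))
          _ = P.C * (l * (t - r)) ^ (P.s - 1) * (‖W r‖ + ‖V (l * r)‖) * ‖W r - V (l * r)‖ := by
              ring
          _ ≤ P.C * (2 * (t - r) ^ (P.s - 1)) * (2 * (M + 1)) * D := by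
              rw [Real.mul_rpow hπ0.le hr'.le]
              gcongr
              · exact half_rpow_le hs hπ₁.le P.s_le_one
              · linarith [hWM r]
              · exact ih r hrδ
          _ = _ := by ring
      have hts : t ^ P.s ≤ δ ^ P.s := Real.rpow_le_rpow ht.1.le ht.2 hs.le
      calc _ ≤ 2 * (δ ^ P.s / P.s * (2 * P.C * (2 * (M + 1)) * D)) := by
            gcongr
            exact hint.trans (by gcongr)
        _ = 32 * P.C * (δ ^ P.s / P.s) * (M + 1) * (D / 4) := by ring
        _ ≤ 1 * (D / 4) := by gcongr
        _ ≤ D / 2 := by linarith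
        _ = _ := by rw [hD, pow_succ]; ring
  have hlim : Tendsto (fun n : ℕ => 2 * (M + 1) * (1 / 2 : ℝ) ^ n) atTop (𝓝 0) := by
    simpa using (tendsto_pow_atTop_nhds_zero_of_lt_one (r := (1 / 2 : ℝ)) (by norm_num)
      (by norm_num)).const_mul (2 * (M + 1))
  have hδ' : δ ∈ Ioc 0 δ := ⟨hδ, le_rfl⟩
  have h1 := sub_eq_zero.1 (norm_le_zero_iff.1 (ge_of_tendsto' hlim fun n => key n δ hδ'))
  rw [mul_comm δ, ← h1, hW]
  simp only
  rw [P.tr_tr, add_neg_cancel, P.tr_zero]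

/-- The implicit function theorem at the solution itself gives a smooth branch of zeros of the
moving equation. Uniqueness for that equation identifies the branch with the moved solution, and
evaluation at log δ is bounded linear. -/
theorem IsSol.contDiffAt_moving (hV : P.IsSol x₁ T₂ V) (hδ : 0 < δ) (hδT : δ < T₃)
    (hT : T₃ < T₂) (hM : ∀ t ∈ Ioc 0 T₃, ‖V t‖ ≤ M) (hM0 : 0 ≤ M)
    (hsmall : 32 * P.C * (δ ^ P.s / P.s) * (M + 1) ≤ 1) :
    ContDiffAt ℝ ∞ (fun π : ℝ × E d => P.tr (δ • π.2) (V (δ * π.1))) (1, 0) := by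
  have hs := P.s_pos
  have hC := P.C_nonneg
  have hcut : ∀ θ, cutTime δ θ ∈ Ioc 0 T₃ := fun θ =>
    ⟨(cutTime_mem hδ θ).1, (cutTime_mem hδ θ).2.trans hδT.le⟩
  set w₁ : ℝ →ᵇ X := ofNormedAddCommGroup (fun θ => V (cutTime δ θ))
    (hV.continuousOn.comp_continuous (continuous_cutTime δ) fun θ =>
      ⟨(hcut θ).1, (hcut θ).2.trans_lt hT⟩) M (fun θ => hM _ (hcut θ)) with hw₁
  have hw₁M : ‖w₁‖ ≤ M := norm_ofNormedAddCommGroup_le _ hM0 _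
  have hw₁log : ∀ t ∈ Ioo 0 δ, w₁ (Real.log t) = V t := fun t ht => by
    change V (cutTime δ (Real.log t)) = _
    rw [cutTime_log ⟨ht.1, ht.2.le⟩]
  have hzero : P.movingMap δ hδ x₁ ((1, 0), w₁) = 0 := by
    ext θ
    have hθ := cutTime_mem hδ θ
    have hθT : cutTime δ θ ∈ Ioo 0 T₂ := ⟨(hcut θ).1, (hcut θ).2.trans_lt hT⟩
    simp only [movingMap, BoundedContinuousFunction.add_apply, BoundedContinuousFunction.sub_apply,
        evalLog_apply, one_smul,
        P.heatLog_apply δ (π := ((1, 0) : ℝ × E d)) one_pos, BoundedContinuousFunction.coe_zero, Pi.zero_apply]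
    rw [logConv_eq_integral hs hδ (K := P.B) (U := V) (V := V) θ ?_ hw₁log hw₁log]
    · change V (cutTime δ θ) - _ + _ = 0
      rw [hV.duhamel _ hθT]
      simp
    · intro τ hτ
      rw [P.movingKernel_log (π := (1, 0)) (by norm_num) ⟨hτ.1, hτ.2.le⟩]
      congr 1
      ext v w
      have e : τ • (((1 : ℝ), (0 : E d)) - (1 / 2, 0)) = (1 / 2 * τ, 0) := by
        ext <;> simp; ring
      change P.H _ (P.B (1 / 2 * τ) v w) = _
      have hτ2 : 0 < 1 / 2 * τ := by have := hτ.1; positivity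
      rw [e, P.H_B _ _ hτ2 hτ2]
      congr 3
      ring
  have hA := P.contDiffAt_movingMap (x₁ := x₁) hδ w₁
  have hI := P.isInvertible_fderiv_movingMap (x₁ := x₁) hδ (w := w₁) (by
    have h1 : 0 ≤ P.C * (δ ^ P.s / P.s) := by positivity
    nlinarith [norm_nonneg w₁])
  set ψ := hA.implicitFunction (by simp) hI with hψ
  have hψc : ContDiffAt ℝ ∞ ψ (1, 0) := hA.contDiffAt_implicitFunction (by simp) hI
  have hψ1 : ψ (1, 0) = w₁ := hA.implicitFunction_apply_self (by simp) hI
  have hψ0 : ∀ᶠ π in 𝓝 ((1, 0) : ℝ × E d), P.movingMap δ hδ x₁ (π, ψ π) = 0 := by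
    have := hA.eventually_apply_implicitFunction (by simp) hI
    rwa [hzero] at this
  -- The radius M + 1 leaves room around w₁, whose norm is at most M, so nearby points of the branch
  -- stay in the uniqueness class.
  have hψM : ∀ᶠ π in 𝓝 ((1, 0) : ℝ × E d), ‖ψ π‖ < M + 1 :=
    hψc.continuousAt.norm.eventually_lt_const (by simp only [hψ1]; linarith)
  have hfst : ContinuousAt (fun π : ℝ × E d => π.1) (1, 0) := continuousAt_fst
  have hmul : ContinuousAt (fun π : ℝ × E d => δ * π.1) (1, 0) := by fun_prop
  have hfinal : ContDiffAt ℝ ∞ (fun π => ψ π (Real.log δ)) (1, 0) :=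
    (ContinuousLinearMap.contDiff (BoundedContinuousFunction.evalCLM ℝ (Real.log δ) :
      (ℝ →ᵇ X) →L[ℝ] X)).contDiffAt.comp (1, 0) hψc
  refine hfinal.congr_of_eventuallyEq ?_
  filter_upwards [hψ0, hψM, hfst.eventually_const_lt (show (1 / 2 : ℝ) < 1 by norm_num),
    hfst.eventually_lt_const (show (1 : ℝ) < 2 by norm_num),
    hmul.eventually_lt_const (show δ * 1 < T₃ by linarith)] with π h1 h2 h3 h4 h5
  exact (hV.eq_of_movingMap_eq_zero hδ hT hM hM0 hsmall h3 h4 h5.le h2.le h1).symm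

/-- Near (t, y) the solution is restarted at t - δ for a small δ. The nearby point (t', y') is then
reached by the dilation λ = 1 + (t' - t)/δ and the velocity a = (y' - y)/δ, which vary affinely and
are (1, 0) at the centre. -/
theorem IsSol.contDiffOn_orbit {x₀ : X} {T : ℝ} {U : ℝ → X} (hU : P.IsSol x₀ T U) :
    ContDiffOn ℝ ∞ (fun z : ℝ × E d => P.tr z.2 (U z.1)) (Ioo 0 T ×ˢ univ) := by
  rintro ⟨t, y⟩ ⟨ht, -⟩
  refine ContDiffAt.contDiffWithinAt ?_
  have hs := P.s_pos
  set T' := (t + T) / 2 with hT'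
  have h1 : t < T' := by have := ht.2; rw [hT']; linarith
  have h2 : T' < T := by have := ht.2; rw [hT']; linarith
  obtain ⟨M, hM0, hM⟩ := hU.exists_bound h2
  obtain ⟨δ, hδ, hδt, hsmall⟩ : ∃ δ, 0 < δ ∧ δ < t ∧
      32 * P.C * (δ ^ P.s / P.s) * (M + 1) ≤ 1 := by
    have hlim : Tendsto (fun δ : ℝ => 32 * P.C * (δ ^ P.s / P.s) * (M + 1)) (𝓝[>] 0)
        (𝓝 (32 * P.C * (0 ^ P.s / P.s) * (M + 1))) := by
      refine Tendsto.mono_left ?_ nhdsWithin_le_nhds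
      exact (((Real.continuousAt_rpow_const 0 P.s (Or.inr hs.le)).tendsto.div_const
        P.s).const_mul _).mul_const _
    rw [Real.zero_rpow hs.ne', zero_div, mul_zero, zero_mul] at hlim
    obtain ⟨δ, h3, h4, h5⟩ := ((hlim.eventually (ge_mem_nhds one_pos)).and
      ((eventually_mem_nhdsWithin (a := (0 : ℝ)) (s := Ioi 0)).and
        ((gt_mem_nhds ht.1).filter_mono nhdsWithin_le_nhds))).exists
    exact ⟨δ, h4, h5, h3⟩
  have ht₀ : t - δ ∈ Ioo 0 T := ⟨sub_pos.2 hδt, by linarith [ht.2]⟩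
  have h3 := (hU.shift ht₀).contDiffAt_moving (T₃ := T' - (t - δ)) hδ (by linarith) (by linarith)
    (M := M) (fun r hr => hM _ ⟨by linarith [hr.1, ht₀.1], by linarith [hr.2]⟩) hM0.le hsmall
  set g : ℝ × E d → ℝ × E d := fun z => (1 + δ⁻¹ * (z.1 - t), δ⁻¹ • (z.2 - y)) with hg
  have hgt : g (t, y) = (1, 0) := by simp [hg]
  have h4 : ContDiffAt ℝ ∞ (fun z => P.tr y (P.tr (δ • (g z).2) (U (t - δ + δ * (g z).1))))
      (t, y) := by
    refine (P.tr y).contDiff.contDiffAt.comp _ ?_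
    rw [← hgt] at h3
    exact h3.comp (f := g) (t, y) (by rw [hg]; fun_prop)
  convert h4 using 1
  ext1 z
  have e1 : y + δ • (g z).2 = z.2 := by
    simp [hg, smul_smul, mul_inv_cancel₀ hδ.ne']
  have e2 : t - δ + δ * (g z).1 = z.1 := by
    simp only [hg, mul_add, mul_one, ← mul_assoc, mul_inv_cancel₀ hδ.ne']; ring
  rw [P.tr_tr, e1, e2]

end MildSystem

end NSFreq

end

/-! ### The Navier-Stokes equations in Lᵖ as an abstract mild system. -/

noncomputable section

namespace NSFreq

variable {d : ℕ}

section ScaledHeat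

/-- The isometry of `L¹` given by a parabolic dilation. -/
theorem exists_scaling_heatLp_one {τ : ℝ} (hτ : 0 < τ) :
    ∃ J : Lp ℝ 1 (volume : Measure (E d)) →L[ℝ] Lp ℝ 1 (volume : Measure (E d)),
      (∀ f, ‖J f‖ = ‖f‖) ∧ ∀ π : ℝ × E d, 0 < π.1 →
        heatLp 1 (τ * π.1, Real.sqrt τ • π.2) = J (heatLp 1 π) := by
  have hq : (1 : ℝ≥0∞) ≠ ⊤ := ENNReal.one_ne_top
  refine ⟨τ ^ (-((d : ℝ) + (0 : ℕ)) / 2) • lpDilate hq (inv_pos.2 (Real.sqrt_pos.2 hτ)),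
    fun f => ?_, fun π hπ => (isHeatFamily_heatLp hq).scaling τ hτ π hπ⟩
  rw [smul_apply, norm_smul, norm_lpDilate, ← mul_assoc, Real.norm_of_nonneg (by positivity),
    Real.sqrt_eq_rpow, ← Real.rpow_neg hτ.le, ← Real.rpow_mul hτ.le, ← Real.rpow_add hτ]
  have : -((d : ℝ) + (0 : ℕ)) / 2 + -(1 / 2) * (-(d : ℝ) / (1 : ℝ≥0∞).toReal) = 0 := by
    simp; ring
  rw [this, Real.rpow_zero, one_mul]

/-- An increment τh at time τμ becomes, after parabolic rescaling to time μ, the increment (h₁, √τ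
h₂). It stays bounded as τ → 0, which gives the uniformity required of the system. -/
theorem exists_scaling_fderiv_heatLp_one {τ μ : ℝ} (hτ : 0 < τ) (hμ : 0 < μ) :
    ∃ J : Lp ℝ 1 (volume : Measure (E d)) →L[ℝ] Lp ℝ 1 (volume : Measure (E d)),
      (∀ f, ‖J f‖ = ‖f‖) ∧
      (∀ h : ℝ × E d, 0 < μ + h.1 → heatLp 1 ((τ * μ, 0) + τ • h) =
        J (heatLp 1 ((μ, 0) + (h.1, Real.sqrt τ • h.2)))) ∧
      ∀ h : ℝ × E d, fderiv ℝ (heatLp 1) (τ * μ, 0) (τ • h) =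
        J (fderiv ℝ (heatLp 1) ((μ, 0) : ℝ × E d) (h.1, Real.sqrt τ • h.2)) := by
  obtain ⟨J, hJ, h⟩ := exists_scaling_heatLp_one (d := d) hτ
  refine ⟨J, hJ, fun k hk => ?_, fun k => ?_⟩
  · rw [← h _ (by simpa using hk)]
    congr 1
    ext1
    · simp [mul_add]
    · simp [smul_smul, Real.mul_self_sqrt hτ.le]
  · set A : ℝ × E d →L[ℝ] ℝ × E d := (τ • ContinuousLinearMap.fst ℝ ℝ (E d)).prod
      (Real.sqrt τ • ContinuousLinearMap.snd ℝ ℝ (E d)) with hA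
    have hAμ : A (μ, 0) = (τ * μ, 0) := by simp [hA]
    have hfam := isHeatFamily_heatLp (d := d) (q := 1) ENNReal.one_ne_top
    have h1 : HasFDerivAt (fun π => heatLp 1 (A π))
        ((fderiv ℝ (heatLp 1) (A (μ, 0))).comp A) (μ, 0) :=
      (hfam.hasFDerivAt (π := A (μ, 0)) (by rw [hAμ]; exact mul_pos hτ hμ)).comp (μ, 0)
        A.hasFDerivAt
    have h2 : HasFDerivAt (fun π => heatLp 1 (A π))
        (J.comp (fderiv ℝ (heatLp 1) ((μ, 0) : ℝ × E d))) (μ, 0) := by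
      refine (J.hasFDerivAt.comp (μ, 0) (hfam.hasFDerivAt (π := (μ, 0)) hμ)).congr_of_eventuallyEq ?_
      filter_upwards [isOpen_posTime.mem_nhds (show ((μ, 0) : ℝ × E d) ∈ posTime d from hμ)]
        with π hπ
      exact h π hπ
    have h3 := DFunLike.congr_fun (h1.unique h2) (k.1, Real.sqrt τ • k.2)
    rw [ContinuousLinearMap.comp_apply, ContinuousLinearMap.comp_apply, hAμ] at h3
    rw [← h3]
    congr 1
    ext1
    · simp [hA]
    · simp [hA, smul_smul, Real.mul_self_sqrt hτ.le]

theorem norm_parabolic_le {τ δ : ℝ} (hτ : τ ∈ Ioc 0 δ) (h : ℝ × E d) :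
    ‖((h.1, Real.sqrt τ • h.2) : ℝ × E d)‖ ≤ (1 + Real.sqrt δ) * ‖h‖ := by
  have h1 : Real.sqrt τ ≤ Real.sqrt δ := Real.sqrt_le_sqrt hτ.2
  have h2 := norm_fst_le h
  have h3 := norm_snd_le h
  have h4 := Real.sqrt_nonneg τ
  rw [Prod.norm_mk, max_le_iff, norm_smul, Real.norm_of_nonneg h4]
  constructor
  · nlinarith [norm_nonneg h]
  · calc Real.sqrt τ * ‖h.2‖ ≤ Real.sqrt δ * ‖h‖ := by gcongr
      _ ≤ _ := by nlinarith [norm_nonneg h]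

end ScaledHeat

variable {p : ℝ≥0∞} [hp1 : Fact (1 ≤ p)]

/-- Convolution with an `L¹` kernel. -/
def convOp (p : ℝ≥0∞) [Fact (1 ≤ p)] : Lp ℝ 1 (volume : Measure (E d)) →L[ℝ]
    VField d p →L[ℝ] VField d p :=
  lpConv p (ContinuousLinearMap.lsmul ℝ ℝ)

theorem norm_convOp_apply_le (k : Lp ℝ 1 (volume : Measure (E d))) : ‖convOp p k‖ ≤ ‖k‖ := by
  refine ContinuousLinearMap.opNorm_le_bound _ (norm_nonneg _) fun f =>
    (norm_lpConv_le _ _ _ _).trans ?_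
  have h : ‖(ContinuousLinearMap.lsmul ℝ ℝ : ℝ →L[ℝ] E d →L[ℝ] E d)‖ ≤ 1 :=
    ContinuousLinearMap.opNorm_lsmul_le
  calc _ ≤ 1 * ‖k‖ * ‖f‖ := by gcongr
    _ = _ := by rw [one_mul]

theorem contDiffOn_heatOp : ContDiffOn ℝ ∞ (heatOp (d := d) p) (posTime d) :=
  (convOp (d := d) p).contDiff.comp_contDiffOn contDiffOn_heatLp_one

theorem fderiv_heatOp {π : ℝ × E d} (hπ : 0 < π.1) (h : ℝ × E d) :
    fderiv ℝ (heatOp p) π h = convOp p (fderiv ℝ (heatLp 1) π h) := by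
  have h1 := (convOp (d := d) p).hasFDerivAt.comp π
    ((isHeatFamily_heatLp (d := d) (q := 1) ENNReal.one_ne_top).hasFDerivAt hπ)
  have h2 : HasFDerivAt (heatOp p) _ π := h1
  rw [h2.fderiv]
  rfl

/-- The heat semigroup and the Navier-Stokes bilinear kernel on `Lᵖ`. -/
def navierStokes (p q : ℝ≥0∞) [Fact (1 ≤ p)] [Fact (1 ≤ p / 2)] [Fact (1 ≤ q)]
    [YoungTriple q (p / 2) p] [ENNReal.HolderTriple p p (p / 2)] (hq : q ≠ ⊤) {s : ℝ}
    (hs : 0 < s) (hs1 : s ≤ 1) (hsq : -((d : ℝ) + 1) / 2 + d / 2 / q.toReal = s - 1) :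
    MildSystem d (VField d p) where
  H := heatOp p
  tr := fun b => lpTranslate b
  B := bilinOp p q
  s := s
  C := (norm_bilinOp_le (d := d) (p := p) hq).choose
  s_pos := hs
  s_le_one := hs1
  C_nonneg := (norm_bilinOp_le (d := d) (p := p) hq).choose_spec.1
  norm_H_le := fun _ hπ => norm_heatOp_le hπ
  H_H := fun _ hπ _ hπ' x => heatOp_heatOp hπ hπ' x
  contDiffOn_H := contDiffOn_heatOp
  H_eq_tr := fun _ ht b x => heatOp_eq_lpTranslate ht b x
  tr_tr := fun b c x => lpTranslate_lpTranslate b c x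
  tr_zero := fun x => lpTranslate_zero x
  norm_tr := fun b x => norm_lpTranslate b x
  tr_B := fun b t v w => lpTranslate_bilinOp b t v w
  continuousOn_B := continuousOn_bilinOp hq
  norm_B_le := fun t ht => by
    rw [← hsq]
    exact (norm_bilinOp_le (d := d) (p := p) hq).choose_spec.2 t ht
  H_B := fun t r ht hr v w => by
    rw [heatOp_bilinOp hq (π := (t, 0)) ht hr, lpTranslate_zero]
  bounded_scaled_fderiv := fun μ hμ δ hδ => by
    refine ⟨‖fderiv ℝ (heatLp 1) ((μ, 0) : ℝ × E d)‖ * (1 + Real.sqrt δ), fun τ hτ h => ?_⟩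
    obtain ⟨J, hJ, -, h2⟩ := exists_scaling_fderiv_heatLp_one (d := d) hτ.1 hμ
    rw [fderiv_heatOp (π := (τ * μ, 0)) (mul_pos hτ.1 hμ), h2]
    refine (norm_convOp_apply_le _).trans ?_
    rw [hJ, mul_assoc]
    exact (ContinuousLinearMap.le_opNorm _ _).trans (by gcongr; exact norm_parabolic_le hτ h)
  scaled_differentiable := fun μ hμ δ hδ ε hε => by
    have h1 := (isHeatFamily_heatLp (d := d) (q := 1) ENNReal.one_ne_top).hasFDerivAt
      (π := (μ, 0)) hμ
    rw [hasFDerivAt_iff_isLittleO_nhds_zero, Asymptotics.isLittleO_iff] at h1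
    have hδ' : 0 < 1 + Real.sqrt δ := by positivity
    obtain ⟨η, hη, h2⟩ := Metric.eventually_nhds_iff.1 (h1 (div_pos hε hδ'))
    -- After the parabolic rescaling the increment is shorter than η, the differentiability radius
    -- at time μ, and shorter than μ, so the time stays positive.
    refine ⟨min η μ / (1 + Real.sqrt δ), by positivity, fun τ hτ h hh => ?_⟩
    obtain ⟨J, hJ, h3, h4⟩ := exists_scaling_fderiv_heatLp_one (d := d) hτ.1 hμ
    rw [lt_div_iff₀ hδ', mul_comm] at hh
    have hk := norm_parabolic_le hτ h
    have hk' := hk.trans_lt hh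
    have hh1 : 0 < μ + h.1 := by
      have e1 : |h.1| ≤ ‖((h.1, Real.sqrt τ • h.2) : ℝ × E d)‖ :=
        norm_fst_le ((h.1, Real.sqrt τ • h.2) : ℝ × E d)
      have e2 := min_le_right η μ
      have e3 := neg_abs_le h.1
      linarith
    rw [fderiv_heatOp (π := (τ * μ, 0)) (mul_pos hτ.1 hμ)]
    change ‖convOp p _ - convOp p _ - _‖ ≤ _
    rw [← map_sub, ← map_sub]
    refine (norm_convOp_apply_le _).trans ?_
    have h5 := h3 0 (by simpa using hμ)
    simp only [smul_zero, add_zero, Prod.fst_zero, Prod.snd_zero] at h5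
    rw [h3 h hh1, h4, h5, ← map_sub, ← map_sub, hJ]
    have h6 := h2 (y := (h.1, Real.sqrt τ • h.2))
      (by rw [dist_zero_right]; exact hk'.trans_le (min_le_left _ _))
    have h7 : ((μ, (0 : E d)) + ((0 : ℝ), (0 : E d))) = (μ, 0) := by simp
    rw [h7]
    refine h6.trans ?_
    calc _ ≤ ε / (1 + Real.sqrt δ) * ((1 + Real.sqrt δ) * ‖h‖) := by gcongr
      _ = ε * ‖h‖ := by field_simp

end NSFreq

end

/-! ### The heat equation for the kernels, and smooth pointwise representatives. -/

noncomputable section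

namespace NSFreq

variable {d : ℕ}

section HeatEquation

theorem pderiv_heatKernel {t : ℝ} (ht : 0 < t) (i : Fin d) (x : E d) :
    pderiv i (heatKernel t) x = -(x i / (2 * t)) * heatKernel t x := by
  have h1 : HasFDerivAt (fun y : E d => ((t, y) : ℝ × E d)) (ContinuousLinearMap.inr ℝ ℝ (E d)) x :=
    hasFDerivAt_prodMk_right t x
  have h2 := (hasFDerivAt_heatKernel 0 (π := (t, x)) ht).comp x h1
  have h3 : HasFDerivAt (heatKernel t) _ x := h2.congr_of_eventuallyEq
    (Eventually.of_forall fun y => by simp)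
  rw [pderiv, h3.fderiv]
  simp [heatKernelDeriv, EuclideanSpace.inner_single_right]
  ring

theorem pderiv_pderiv_heatKernel {t : ℝ} (ht : 0 < t) (i : Fin d) (x : E d) :
    pderiv i (pderiv i (heatKernel t)) x =
      (-(1 / (2 * t)) + x i ^ 2 / (4 * t ^ 2)) * heatKernel t x := by
  have h1 : HasFDerivAt (fun y : E d => -(y i / (2 * t)))
      (-((1 / (2 * t)) • (EuclideanSpace.proj i : E d →L[ℝ] ℝ))) x := by
    have := ((EuclideanSpace.proj i : E d →L[ℝ] ℝ).hasFDerivAt (x := x)).const_mul (1 / (2 * t))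
    refine (this.congr_of_eventuallyEq (Eventually.of_forall fun y => ?_)).neg
    simp [div_eq_inv_mul]
  have h2 := h1.mul ((contDiff_heatKernel (d := d) t).differentiable (by simp) x).hasFDerivAt
  have h3 : pderiv i (heatKernel (d := d) t) = fun y => -(y i / (2 * t)) * heatKernel t y :=
    funext fun y => pderiv_heatKernel ht i y
  have h4 : fderiv ℝ (heatKernel t) x (EuclideanSpace.single i 1) = _ := pderiv_heatKernel ht i x
  have h5 : HasFDerivAt (fun y : E d => -(y i / (2 * t)) * heatKernel t y) _ x := h2
  rw [h3, pderiv, h5.fderiv]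
  simp only [_root_.add_apply, _root_.smul_apply, _root_.neg_apply, h4, smul_eq_mul]
  simp
  field_simp
  ring

theorem hasDerivAt_heatKernel {t : ℝ} (ht : 0 < t) (x : E d) :
    HasDerivAt (fun t => heatKernel t x) (∑ i, pderiv i (pderiv i (heatKernel t)) x) t := by
  have h1 : HasDerivAt (fun r : ℝ => ((r, 0) : ℝ × E d)) (1, 0) t :=
    (hasDerivAt_id t).prodMk (hasDerivAt_const t (0 : E d))
  have h2 := (hasFDerivAt_heatKernel x (π := (t, 0)) ht).comp_hasDerivAt t h1
  have h3 : HasDerivAt (fun t => heatKernel t x) _ t := h2.congr_of_eventuallyEq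
    (Eventually.of_forall fun y => by simp)
  convert h3 using 1
  simp_rw [pderiv_pderiv_heatKernel ht]
  rw [← Finset.sum_mul, Finset.sum_add_distrib, ← Finset.sum_div]
  simp [heatKernelDeriv, EuclideanSpace.norm_sq_eq]
  field_simp

variable {q : ℝ≥0∞} [hq1 : Fact (1 ≤ q)]

/-- The heat equation for the curve of heat kernels in `L^q`. -/
theorem fderiv_heatLp_time (hq : q ≠ ⊤) {π : ℝ × E d} (hπ : 0 < π.1) :
    fderiv ℝ (heatLp q) π (1, 0) = ∑ i, spaceDeriv i (spaceDeriv i (heatLp q)) π := by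
  have hfam := isHeatFamily_heatLp (d := d) hq
  apply Lp.ext
  have h1 := coeFn_sum_lp (d := d) Finset.univ
    (T := fun i : Fin d => spaceDeriv i (spaceDeriv i (heatLp q)) π)
    (fun i _ => ((hfam.pderiv i).pderiv i).coeFn π hπ)
  refine EventuallyEq.trans ?_ h1.symm
  have hline : HasDerivAt (fun r : ℝ => π + (r, (0 : E d))) (1, 0) 0 :=
    (((hasDerivAt_id (0 : ℝ)).prodMk (hasDerivAt_const (0 : ℝ) (0 : E d))).const_add π)
  have h0 : HasFDerivAt (heatLp q) (fderiv ℝ (heatLp q) π) (π + ((0 : ℝ), (0 : E d))) := by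
    have : π + ((0 : ℝ), (0 : E d)) = π := add_zero π
    rw [this]
    exact hfam.hasFDerivAt hπ
  have hd := h0.comp_hasDerivAt 0 hline
  have hlim := hasDerivAt_iff_tendsto_slope.1 hd
  -- Positive increments keep the time in the half line, where the class in L^q is known to be that
  -- of the heat kernel.
  have hseq : Tendsto (fun n : ℕ => 1 / ((n : ℝ) + 1)) atTop (𝓝[≠] 0) := by
    refine tendsto_nhdsWithin_iff.2 ⟨tendsto_one_div_add_atTop_nhds_zero_nat,
      Eventually.of_forall fun n => ?_⟩
    have : (0 : ℝ) < 1 / ((n : ℝ) + 1) := by positivity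
    exact this.ne'
  refine coeFn_eq_of_tendsto (hlim.comp hseq) (F := fun n x =>
    slope (fun r => heatKernel (π.1 + r) (x + π.2)) 0 (1 / ((n : ℝ) + 1))) (fun n => ?_)
    (Eventually.of_forall fun x => ?_)
  · have hn : (0 : ℝ) < 1 / ((n : ℝ) + 1) := by positivity
    simp only [Function.comp_apply, slope_def_module]
    filter_upwards [Lp.coeFn_smul (1 / ((n : ℝ) + 1) - 0)⁻¹
        (heatLp q (π + (1 / ((n : ℝ) + 1), 0)) - heatLp q (π + ((0 : ℝ), (0 : E d)))),
      Lp.coeFn_sub (heatLp q (π + (1 / ((n : ℝ) + 1), 0))) (heatLp q (π + ((0 : ℝ), (0 : E d)))),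
      coeFn_heatLp hq (π := π + (1 / ((n : ℝ) + 1), 0)) (add_pos hπ hn),
      coeFn_heatLp hq (π := π + ((0 : ℝ), (0 : E d))) (by simpa using hπ)] with x e1 e2 e3 e4
    rw [e1, Pi.smul_apply, e2, Pi.sub_apply, e3, e4]
    simp
  · have h2 : HasDerivAt (fun r => heatKernel (π.1 + r) (x + π.2))
        (∑ i, pderiv i (pderiv i (heatKernel π.1)) (x + π.2)) 0 := by
      have h3 : HasDerivAt (fun t => heatKernel t (x + π.2))
        (∑ i, pderiv i (pderiv i (heatKernel π.1)) (x + π.2)) (π.1 + 0) := by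
        rw [add_zero]; exact hasDerivAt_heatKernel hπ _
      exact h3.comp_const_add π.1 0
    exact (hasDerivAt_iff_tendsto_slope.1 h2).comp hseq

end HeatEquation

theorem hasDerivAt_spaceLine {A : Type*} [NormedAddCommGroup A] [NormedSpace ℝ A]
    {F : ℝ × E d → A} {π : ℝ × E d} (h : DifferentiableAt ℝ F π) (i : Fin d) :
    HasDerivAt (fun a : ℝ => F (π + a • ((0, EuclideanSpace.single i 1) : ℝ × E d)))
      (spaceDeriv i F π) 0 := by
  have hline : HasDerivAt (fun r : ℝ => (π + r • ((0, EuclideanSpace.single i 1) : ℝ × E d)))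
      (0, EuclideanSpace.single i 1) 0 := by
    simpa using ((hasDerivAt_id (0 : ℝ)).smul_const
      ((0, EuclideanSpace.single i 1) : ℝ × E d)).const_add π
  have h0 : HasFDerivAt F (fderiv ℝ F π)
      (π + (0 : ℝ) • ((0, EuclideanSpace.single i 1) : ℝ × E d)) := by
    simpa using h.hasFDerivAt
  exact h0.comp_hasDerivAt 0 hline

theorem contDiffOn_spaceDeriv {A : Type*} [NormedAddCommGroup A] [NormedSpace ℝ A]
    {F : ℝ × E d → A} {Ω : Set (ℝ × E d)} (hΩ : IsOpen Ω) (h : ContDiffOn ℝ ∞ F Ω) (i : Fin d) :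
    ContDiffOn ℝ ∞ (spaceDeriv i F) Ω :=
  (h.fderiv_of_isOpen hΩ (by simp)).clm_apply contDiffOn_const

section Evaluation

variable {p q : ℝ≥0∞} [hp1 : Fact (1 ≤ p)] [hq1 : Fact (1 ≤ q)] [hqp : q.HolderConjugate p]

/-- The pairing of scalar kernels with vector fields. -/
def fieldPairing (q p : ℝ≥0∞) [Fact (1 ≤ p)] [Fact (1 ≤ q)] [q.HolderConjugate p] :
    Lp ℝ q (volume : Measure (E d)) →L[ℝ] VField d p →L[ℝ] E d :=
  (ContinuousLinearMap.lsmul ℝ ℝ : ℝ →L[ℝ] E d →L[ℝ] E d).lpPairing volume q p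

theorem fieldPairing_apply (k : Lp ℝ q (volume : Measure (E d))) (f : VField d p) :
    fieldPairing q p k f = ∫ x, k x • f x :=
  ContinuousLinearMap.lpPairing_eq_integral _ _ _

/-- The value at the origin of `e^{rΔ} f`. -/
def heatEval (q p : ℝ≥0∞) [Fact (1 ≤ p)] [Fact (1 ≤ q)] [q.HolderConjugate p] (r : ℝ) :
    VField d p →L[ℝ] E d := fieldPairing q p (heatLp q (r, 0))

/-- Translation invariance of Lebesgue measure moves the translation from the field to the kernel,
which depends smoothly on it even when f does not. -/
theorem fieldPairing_heatLp_neg (hq : q ≠ ⊤) {r : ℝ} (hr : 0 < r) (y : E d) (f : VField d p) :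
    fieldPairing q p (heatLp q (r, -y)) f = heatEval q p r (lpTranslate y f) := by
  rw [heatEval, fieldPairing_apply, fieldPairing_apply,
    ← integral_add_right_eq_self (μ := (volume : Measure (E d)))
      (fun x => heatLp q (r, -y) x • f x) y]
  refine integral_congr_ae ?_
  filter_upwards [ae_add_right y (coeFn_heatLp hq (π := (r, -y)) hr),
    coeFn_heatLp hq (π := ((r, 0) : ℝ × E d)) hr, coeFn_lpTranslate y f] with x h1 h2 h3
  rw [h1, h2, h3]
  simp

theorem heatKernel_neg (t : ℝ) (x : E d) : heatKernel t (-x) = heatKernel t x := by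
  simp [heatKernel]

theorem coeFn_heatOp_eval (hq : q ≠ ⊤) {r : ℝ} (hr : 0 < r) (f : VField d p) :
    heatOp p (r, 0) f =ᵐ[volume] fun y => heatEval q p r (lpTranslate y f) := by
  refine (coeFn_lpConv _ _ _ _).trans (Eventually.of_forall fun y => ?_)
  simp only
  rw [convolution_congr _ (coeFn_heatLp ENNReal.one_ne_top (π := ((r, 0) : ℝ × E d)) hr)
    (EventuallyEq.refl _ _), ← fieldPairing_heatLp_neg hq hr, convolution_eq_swap,
    fieldPairing_apply]
  refine integral_congr_ae ?_
  filter_upwards [coeFn_heatLp hq (π := (r, -y)) hr] with x hx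
  rw [hx, ← heatKernel_neg]
  simp [sub_eq_add_neg]

theorem continuousOn_heatEval (hq : q ≠ ⊤) : ContinuousOn (heatEval (d := d) q p) (Ioi 0) :=
  (fieldPairing q p).continuous.comp_continuousOn
    ((contDiffOn_heatLp hq).continuousOn.comp (f := fun r : ℝ => ((r, 0) : ℝ × E d)) (by fun_prop)
      fun _ hr => hr)

/-- The L^q norm of the heat kernel at time r is a multiple of r^{s-1/2}, integrable at 0. -/
theorem intervalIntegrable_heatEval (hq : q ≠ ⊤) {s : ℝ} (hs : 0 < s)
    (hsq : -((d : ℝ) + 1) / 2 + d / 2 / q.toReal = s - 1) :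
    IntervalIntegrable (heatEval (d := d) q p) volume 0 1 := by
  have hfam := isHeatFamily_heatLp (d := d) hq
  rw [intervalIntegrable_iff_integrableOn_Ioo_of_le zero_le_one]
  have hg := (integrableOn_rpow_sub_one (s := s + 1 / 2) (by linarith)).const_mul
    (‖fieldPairing (d := d) q p‖ * ‖heatLp q ((1, 0) : ℝ × E d)‖)
  refine hg.mono' (((continuousOn_heatEval hq).mono fun r hr => hr.1).aestronglyMeasurable
    measurableSet_Ioo) ?_
  filter_upwards [ae_restrict_mem measurableSet_Ioo] with r hr
  refine (ContinuousLinearMap.le_opNorm _ _).trans ?_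
  rw [hfam.norm_le (π := (r, 0)) hr.1]
  have : -((d : ℝ) + (0 : ℕ)) / 2 + d / 2 / q.toReal = s + 1 / 2 - 1 := by
    push_cast; linarith
  rw [this]
  exact le_of_eq (by ring)

/-- The heat equation tested against a smooth orbit of translations. -/
theorem hasDerivAt_heatEval (hq : q ≠ ⊤) {T : ℝ} {U : ℝ → VField d p}
    (hΦ : ContDiffOn ℝ ∞ (fun z : ℝ × E d => lpTranslate z.2 (U z.1)) (Ioo 0 T ×ˢ univ))
    {z : ℝ × E d} (hz : z.1 ∈ Ioo 0 T) {r : ℝ} (hr : 0 < r) :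
    HasDerivAt (fun r => heatEval q p r (lpTranslate z.2 (U z.1)))
      (heatEval q p r (∑ i, spaceDeriv i (spaceDeriv i
        (fun z : ℝ × E d => lpTranslate z.2 (U z.1))) z)) r := by
  set Φ := fun z : ℝ × E d => lpTranslate z.2 (U z.1) with hΦdef
  have hΩ : IsOpen (Ioo 0 T ×ˢ (univ : Set (E d))) := isOpen_Ioo.prod isOpen_univ
  have hfam := isHeatFamily_heatLp (d := d) hq
  set Pf : Lp ℝ q (volume : Measure (E d)) →L[ℝ] E d := (fieldPairing q p).flip (U z.1) with hPf
  have hbase : ∀ y : E d, heatEval q p r (Φ (z.1, y)) = Pf (heatLp q (r, -y)) := fun y =>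
    (fieldPairing_heatLp_neg hq hr y (U z.1)).symm
  have hmem : ∀ y : E d, (z.1, y) ∈ Ioo 0 T ×ˢ (univ : Set (E d)) := fun y => ⟨hz, mem_univ y⟩
  have hadd : ∀ (y : E d) (a : ℝ) (i : Fin d),
      (z.1, y) + a • ((0, EuclideanSpace.single i 1) : ℝ × E d) =
        (z.1, y + a • EuclideanSpace.single i 1) := fun y a i => by ext1 <;> simp
  -- Integration by parts in dual form: each space derivative moved from the orbit to the kernel
  -- costs a sign. Two of them give the Laplacian of the kernel, which equals its time derivative.
  have step : ∀ (Ψ : ℝ × E d → VField d p) (G : ℝ × E d → Lp ℝ q (volume : Measure (E d)))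
      (c : ℝ), ContDiffOn ℝ ∞ Ψ (Ioo 0 T ×ˢ univ) → ContDiffOn ℝ ∞ G (posTime d) →
      (∀ y, heatEval q p r (Ψ (z.1, y)) = c • Pf (G (r, -y))) → ∀ i y,
      heatEval q p r (spaceDeriv i Ψ (z.1, y)) = (-c) • Pf (spaceDeriv i G (r, -y)) := by
    intro Ψ G c hΨ hG h i y
    have hd1 := (heatEval (d := d) q p r).hasFDerivAt.comp_hasDerivAt (0 : ℝ)
      (hasDerivAt_spaceLine ((hΨ.contDiffAt (hΩ.mem_nhds (hmem y))).differentiableAt (by simp)) i)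
    have hG' : DifferentiableAt ℝ G (r, -y) :=
      (hG.contDiffAt (isOpen_posTime.mem_nhds (show (r, -y) ∈ posTime d from hr))).differentiableAt
        (by simp)
    have hd2 : HasDerivAt (fun a : ℝ => G ((r, -y) +
        (-a) • ((0, EuclideanSpace.single i 1) : ℝ × E d))) (-spaceDeriv i G (r, -y)) 0 := by
      have h1 : HasDerivAt (fun a : ℝ => G ((r, -y) +
        a • ((0, EuclideanSpace.single i 1) : ℝ × E d))) (spaceDeriv i G (r, -y)) (-0) := by
        rw [neg_zero]; exact hasDerivAt_spaceLine hG' i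
      exact (h1.scomp (0 : ℝ) (hasDerivAt_neg (0 : ℝ))).congr_deriv (by simp)
    have hd3 := (Pf.hasFDerivAt.comp_hasDerivAt (0 : ℝ) hd2).const_smul c
    have heq : (⇑(heatEval (d := d) q p r) ∘ fun a : ℝ =>
        Ψ ((z.1, y) + a • ((0, EuclideanSpace.single i 1) : ℝ × E d))) =
        c • (⇑Pf ∘ fun a : ℝ => G ((r, -y) +
          (-a) • ((0, EuclideanSpace.single i 1) : ℝ × E d))) := by
      ext1 a
      simp only [Function.comp_apply, Pi.smul_apply]
      rw [hadd, h]
      congr 3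
      ext1 <;> simp; abel
    rw [heq] at hd1
    rw [hd1.unique hd3, map_neg, smul_neg, neg_smul]
  have h1 : ∀ i y, heatEval q p r (spaceDeriv i Φ (z.1, y)) =
      (-1 : ℝ) • Pf (spaceDeriv i (heatLp q) (r, -y)) :=
    step Φ (heatLp q) 1 hΦ hfam.contDiffOn fun y => by rw [hbase, one_smul]
  have h2 : ∀ i, heatEval q p r (spaceDeriv i (spaceDeriv i Φ) z) =
      Pf (spaceDeriv i (spaceDeriv i (heatLp q)) (r, -z.2)) := fun i => by
    have := step (spaceDeriv i Φ) (spaceDeriv i (heatLp q)) (-1)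
      (contDiffOn_spaceDeriv hΩ hΦ i) (hfam.pderiv i).contDiffOn (h1 i) i z.2
    simpa using this
  rw [map_sum, Finset.sum_congr rfl fun i _ => h2 i, ← map_sum,
    ← fderiv_heatLp_time hq (π := (r, -z.2)) hr]
  have hline : HasDerivAt (fun r : ℝ => ((r, -z.2) : ℝ × E d)) (1, 0) r :=
    (hasDerivAt_id r).prodMk (hasDerivAt_const r (-z.2))
  have h3 := Pf.hasFDerivAt.comp_hasDerivAt r
    ((hfam.hasFDerivAt (π := (r, -z.2)) hr).comp_hasDerivAt r hline)
  refine h3.congr_of_eventuallyEq ?_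
  filter_upwards [Ioi_mem_nhds hr] with r' hr'
  exact (fieldPairing_heatLp_neg hq hr' z.2 (U z.1)).symm

end Evaluation

namespace MildSystem

variable {X : Type*} [NormedAddCommGroup X] [NormedSpace ℝ X] [CompleteSpace X]
  {P : MildSystem d X}

/-- Solutions are continuity points of the heat semigroup. -/
theorem IsSol.tendsto_heat {x₀ : X} {T : ℝ} {U : ℝ → X} (hU : P.IsSol x₀ T U) {t : ℝ}
    (ht : t ∈ Ioo 0 T) : Tendsto (fun ε : ℝ => P.H (ε, 0) (U t)) (𝓝[>] 0) (𝓝 (U t)) := by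
  have hs := P.s_pos
  set T' := (T - t) / 2 with hT'
  have hT'0 : 0 < T' := by have := ht.2; rw [hT']; linarith
  obtain ⟨M, hM0, hM⟩ := (hU.shift ht).exists_bound (T' := T') (by rw [hT']; linarith [ht.2])
  have h1 : Tendsto (fun ε : ℝ => U (t + ε)) (𝓝[>] 0) (𝓝 (U t)) := by
    have hc : ContinuousAt U (t + 0) := by
      rw [add_zero]; exact hU.continuousOn.continuousAt (Ioo_mem_nhds ht.1 ht.2)
    have := ContinuousAt.comp (f := fun ε : ℝ => t + ε) (x := (0 : ℝ)) hc (by fun_prop)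
    have h2 := this.tendsto
    simp only [Function.comp_apply, add_zero] at h2
    exact h2.mono_left nhdsWithin_le_nhds
  have h2 : Tendsto (fun ε : ℝ => ε ^ P.s / P.s * (P.C * M * M)) (𝓝[>] 0) (𝓝 0) := by
    have := ((Real.continuousAt_rpow_const 0 P.s (Or.inr hs.le)).tendsto.div_const
      P.s).mul_const (P.C * M * M)
    rw [Real.zero_rpow hs.ne', zero_div, zero_mul] at this
    exact this.mono_left nhdsWithin_le_nhds
  have h3 : Tendsto (fun ε : ℝ => ∫ r in (0 : ℝ)..ε, P.B (ε - r) (U (t + r)) (U (t + r)))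
      (𝓝[>] 0) (𝓝 0) := by
    refine squeeze_zero_norm' ?_ h2
    filter_upwards [Ioo_mem_nhdsGT hT'0] with ε hε
    exact norm_integral_le hε.1.le (fun r hr => hM r ⟨hr.1, (hr.2.trans hε.2).le⟩)
      (fun r hr => hM r ⟨hr.1, (hr.2.trans hε.2).le⟩)
  have h4 := h1.add h3
  rw [add_zero] at h4
  refine h4.congr' ?_
  -- The limit comes from the equation restarted at t: H(ε)U(t) is U(t + ε) plus a Duhamel term of
  -- size O(ε^s). Strong continuity of H at 0 is not assumed.
  filter_upwards [Ioo_mem_nhdsGT hT'0] with ε hε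
  have := (hU.shift ht).duhamel ε ⟨hε.1, by have := hε.2; rw [hT'] at this; linarith [ht.2]⟩
  rw [this]
  abel

end MildSystem

section Representative

variable {p q : ℝ≥0∞} [hp1 : Fact (1 ≤ p)] [hp2 : Fact (1 ≤ p / 2)] [hq1 : Fact (1 ≤ q)]
  [hpq : YoungTriple q (p / 2) p] [hpp : ENNReal.HolderTriple p p (p / 2)]
  [hqp : q.HolderConjugate p]

/-- Solutions have representatives which are smooth in space-time. -/
theorem exists_smooth_representative {hq : q ≠ ⊤} {s : ℝ} {hs : 0 < s} {hs1 : s ≤ 1}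
    {hsq : -((d : ℝ) + 1) / 2 + d / 2 / q.toReal = s - 1} {x₀ : VField d p} {T : ℝ}
    {U : ℝ → VField d p} (hU : (navierStokes p q hq hs hs1 hsq).IsSol x₀ T U) :
    ∃ u : ℝ → E d → E d, SmoothOn T u ∧ ∀ t ∈ Ioo 0 T, U t =ᵐ[volume] u t := by
  set Φ := fun z : ℝ × E d => lpTranslate z.2 (U z.1) with hΦdef
  have hΦ : ContDiffOn ℝ ∞ Φ (Ioo 0 T ×ˢ univ) := hU.contDiffOn_orbit
  have hΩ : IsOpen (Ioo 0 T ×ˢ (univ : Set (E d))) := isOpen_Ioo.prod isOpen_univ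
  set ΔΦ : ℝ × E d → VField d p := fun z => ∑ i, spaceDeriv i (spaceDeriv i Φ) z with hΔΦ
  have hint := intervalIntegrable_heatEval (d := d) (p := p) hq hs hsq
  -- This is e^{Δ}f - ∫₀¹ e^{rΔ}Δf dr at the point y, with f = U(t). Both functionals are bounded on
  -- Lᵖ and both arguments are smooth in (t, y), so the representative is smooth.
  refine ⟨fun t y => heatEval q p 1 (Φ (t, y)) - (∫ r in (0 : ℝ)..1, heatEval q p r) (ΔΦ (t, y)),
    ?_, fun t ht => ?_⟩
  · have hΔ : ContDiffOn ℝ ∞ ΔΦ (Ioo 0 T ×ˢ univ) := ContDiffOn.sum fun i _ =>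
      contDiffOn_spaceDeriv hΩ (contDiffOn_spaceDeriv hΩ hΦ i) i
    exact ((heatEval q p 1).contDiff.comp_contDiffOn hΦ).sub
      ((∫ r in (0 : ℝ)..1, heatEval q p r).contDiff.comp_contDiffOn hΔ)
  · have hseq : Tendsto (fun n : ℕ => 1 / ((n : ℝ) + 1)) atTop (𝓝[>] 0) :=
      tendsto_nhdsWithin_iff.2 ⟨tendsto_one_div_add_atTop_nhds_zero_nat,
        Eventually.of_forall fun n => by simp only [mem_Ioi]; positivity⟩
    refine coeFn_eq_of_tendsto ((hU.tendsto_heat ht).comp hseq)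
      (F := fun n y => heatEval q p (1 / ((n : ℝ) + 1)) (Φ (t, y)))
      (fun n => coeFn_heatOp_eval hq (by positivity) (U t)) (Eventually.of_forall fun y => ?_)
    have hprim := intervalIntegral.continuousOn_primitive_interval'
      (f := fun r => heatEval q p r (ΔΦ (t, y))) (b₁ := 0) (b₂ := 1) (a := 1) (μ := volume)
      ⟨(ContinuousLinearMap.apply ℝ (E d) (ΔΦ (t, y))).integrable_comp hint.1,
        (ContinuousLinearMap.apply ℝ (E d) (ΔΦ (t, y))).integrable_comp hint.2⟩ right_mem_uIcc
    have h0 := (hprim 0 left_mem_uIcc).tendsto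
    rw [uIcc_of_le zero_le_one] at h0
    have hseq' : Tendsto (fun n : ℕ => 1 / ((n : ℝ) + 1)) atTop (𝓝[Icc 0 1] 0) :=
      tendsto_nhdsWithin_iff.2 ⟨tendsto_one_div_add_atTop_nhds_zero_nat,
        Eventually.of_forall fun n => ⟨by positivity, by
          rw [div_le_one (by positivity)]; linarith [Nat.cast_nonneg (α := ℝ) n]⟩⟩
    have h1 := (h0.comp hseq').const_add (heatEval q p 1 (Φ (t, y)))
    -- The fundamental theorem of calculus on [1/(n+1), 1] shows that (e^{Δ/(n+1)}f)(y) converges to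
    -- the formula at every y, while e^{Δ/(n+1)}f converges to f in Lᵖ.
    rw [intervalIntegral.integral_symm, ← ContinuousLinearMap.intervalIntegral_apply hint,
      ← sub_eq_add_neg] at h1
    refine h1.congr fun n => ?_
    have hn : (0 : ℝ) < 1 / ((n : ℝ) + 1) := by positivity
    have hn1 : 1 / ((n : ℝ) + 1) ≤ 1 := by
      rw [div_le_one (by positivity)]; linarith [Nat.cast_nonneg (α := ℝ) n]
    have hsub : uIcc 1 (1 / ((n : ℝ) + 1)) ⊆ Ioi 0 := by
      rw [uIcc_of_ge hn1]; exact fun r hr => hn.trans_le hr.1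
    simp only [Function.comp_apply]
    rw [intervalIntegral.integral_eq_sub_of_hasDerivAt (f := fun r => heatEval q p r (Φ (t, y)))
      (fun r hr => hasDerivAt_heatEval hq hΦ (z := (t, y)) ht (hsub hr))
      (ContinuousOn.intervalIntegrable
        (((continuousOn_heatEval hq).mono hsub).clm_apply continuousOn_const))]
    abel

end Representative

end NSFreq

end

/-! ### Equivalence of the pointwise and the abstract notions of mild solution. -/

noncomputable section

namespace NSFreq

variable {d : ℕ}

section Parity

theorem fderiv_comp_neg_apply (f : E d → ℝ) (x : E d) :
    fderiv ℝ (fun x => f (-x)) x = -fderiv ℝ f (-x) := by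
  have h := (LinearIsometryEquiv.neg ℝ (E := E d)).toContinuousLinearEquiv.comp_right_fderiv
    (f := f) (x := x)
  ext y
  have h2 := DFunLike.congr_fun h y
  simpa [Function.comp_def] using h2

theorem pderiv_neg_of_even {f : E d → ℝ} (hf : ∀ x, f (-x) = f x) (i : Fin d) (x : E d) :
    pderiv i f (-x) = -pderiv i f x := by
  have h := fderiv_comp_neg_apply f x
  simp only [hf] at h
  rw [pderiv, pderiv, h]
  simp

theorem pderiv_neg_of_odd {f : E d → ℝ} (hf : ∀ x, f (-x) = -f x) (i : Fin d) (x : E d) :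
    pderiv i f (-x) = pderiv i f x := by
  have h := fderiv_comp_neg_apply f x
  simp only [hf] at h
  have h2 : fderiv ℝ (fun x => -f x) x = -fderiv ℝ f x := fderiv_neg
  rw [h2, neg_inj] at h
  rw [pderiv, pderiv, h]

/-- The kernel is built from odd-order derivatives of an even function. -/
theorem oseenKernel_neg (t : ℝ) (i j k : Fin d) (x : E d) :
    oseenKernel t i j k (-x) = -oseenKernel t i j k x := by
  have h1 : ∀ s : ℝ, ∀ x : E d, pderiv k (heatKernel s) (-x) = -pderiv k (heatKernel s) x :=
    fun s => pderiv_neg_of_even (heatKernel_neg s) k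
  have h3 : ∀ s : ℝ, pderiv i (pderiv j (pderiv k (heatKernel s))) (-x) =
      -pderiv i (pderiv j (pderiv k (heatKernel s))) x := fun s =>
    pderiv_neg_of_even (pderiv_neg_of_odd (h1 s) j) i x
  simp only [oseenKernel, h1, h3, integral_neg]
  split_ifs <;> ring

end Parity

section Norms

variable {p : ℝ≥0∞}

theorem edist_eq_eLpNorm_of_ae_eq {V W : VField d p} {v w : E d → E d} (hv : V =ᵐ[volume] v)
    (hw : W =ᵐ[volume] w) : edist V W = eLpNorm (v - w) p volume := by
  rw [Lp.edist_def]
  exact eLpNorm_congr_ae (hv.sub hw)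

theorem norm_eq_eLpNorm_of_ae_eq {V : VField d p} {v : E d → E d} (hv : V =ᵐ[volume] v) :
    ‖V‖ = (eLpNorm v p volume).toReal := by
  rw [Lp.norm_def, eLpNorm_congr_ae hv]

end Norms

variable {p q r : ℝ≥0∞} [hp1 : Fact (1 ≤ p)] [hp2 : Fact (1 ≤ p / 2)] [hq1 : Fact (1 ≤ q)]
  [hr1 : Fact (1 ≤ r)] [hpq : YoungTriple q (p / 2) p] [hpp : ENNReal.HolderTriple p p (p / 2)]
  [hrp : r.HolderConjugate (p / 2)]

theorem oseenQuadratic_congr {v w : E d → E d} (h : v =ᵐ[volume] w) (t : ℝ) :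
    oseenQuadratic t v = oseenQuadratic t w := by
  funext x
  unfold oseenQuadratic
  congr 1
  funext i
  refine Finset.sum_congr rfl fun j _ => Finset.sum_congr rfl fun k _ => integral_congr_ae ?_
  filter_upwards [h] with y hy
  rw [hy]

/-- With r conjugate to p/2, every pointwise value is a duality pairing of a translated kernel with
the product of components. This makes the quadratic term jointly continuous in time and space. -/
theorem oseenQuadratic_eq_pairing (hr : r ≠ ⊤) {t : ℝ} (ht : 0 < t) (v : VField d p) (x : E d) :
    oseenQuadratic t v x = WithLp.toLp 2 fun i : Fin d => ∑ j : Fin d, ∑ k : Fin d,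
      -(ContinuousLinearMap.mul ℝ ℝ).lpPairing volume r (p / 2) (oseenLp r i j k (t, -x))
        (productLp p j k v v) := by
  unfold oseenQuadratic
  congr 1
  funext i
  refine Finset.sum_congr rfl fun j _ => Finset.sum_congr rfl fun k _ => ?_
  rw [ContinuousLinearMap.lpPairing_eq_integral, ← integral_neg]
  refine integral_congr_ae ?_
  filter_upwards [coeFn_oseenLp hr i j k (π := (t, -x)) ht, coeFn_productLp j k v v] with y h1 h2
  rw [h1, h2, ContinuousLinearMap.mul_apply', ← neg_mul, ← oseenKernel_neg]
  congr 2
  simp only [neg_add, neg_neg]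
  abel

theorem continuousOn_oseenQuadratic (hr : r ≠ ⊤) {U : ℝ → VField d p} {t : ℝ}
    (hU : ContinuousOn U (Ioo 0 t)) :
    ContinuousOn (fun z : ℝ × E d => oseenQuadratic (t - z.1) (U z.1) z.2)
      (Ioo 0 t ×ˢ univ) := by
  have h : ContinuousOn (fun z : ℝ × E d => WithLp.toLp 2 fun i : Fin d =>
      ∑ j : Fin d, ∑ k : Fin d, -(ContinuousLinearMap.mul ℝ ℝ).lpPairing volume r (p / 2)
        (oseenLp r i j k (t - z.1, -z.2)) (productLp p j k (U z.1) (U z.1)))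
      (Ioo 0 t ×ˢ univ) := by
    refine (PiLp.continuous_toLp 2 _).comp_continuousOn (continuousOn_pi.2 fun i =>
      continuousOn_finsetSum _ fun j _ => continuousOn_finsetSum _ fun k _ => ContinuousOn.neg ?_)
    have hU' : ContinuousOn (fun z : ℝ × E d => U z.1) (Ioo 0 t ×ˢ univ) :=
      hU.comp continuousOn_fst fun z hz => hz.1
    have h1 : ContinuousOn (fun z : ℝ × E d => oseenLp r i j k (t - z.1, -z.2))
        (Ioo 0 t ×ˢ univ) :=
      (continuousOn_oseenLp hr i j k).comp (f := fun z : ℝ × E d => (t - z.1, -z.2))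
        (by fun_prop) fun z hz => sub_pos.2 hz.1.2
    have h2 : ContinuousOn (fun z : ℝ × E d => productLp p j k (U z.1) (U z.1))
        (Ioo 0 t ×ˢ univ) :=
      (((productLp (d := d) p j k).continuous.comp_continuousOn hU').clm_apply hU')
    exact (((ContinuousLinearMap.mul ℝ ℝ).lpPairing volume r
      (p / 2)).continuous.comp_continuousOn h1).clm_apply h2
  exact h.congr fun z hz => oseenQuadratic_eq_pairing hr (sub_pos.2 hz.1.2) _ _

section Equivalence

variable {hq : q ≠ ⊤} {s : ℝ} {hs : 0 < s} {hs1 : s ≤ 1}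
    {hsq : -((d : ℝ) + 1) / 2 + d / 2 / q.toReal = s - 1} {T : ℝ}
    {U : ℝ → VField d p} {u : ℝ → E d → E d} {u₀ : E d → E d}

/-- Joint measurability is obtained for the continuous curve U, and u replaces it afterwards because
the quadratic term depends only on the class of its argument. No measurability of u in time is
required. -/
theorem coeFn_integral_bilinOp (hr : r ≠ ⊤) {t : ℝ} (ht : 0 ≤ t)
    (hU : ContinuousOn U (Ioo 0 t)) (huU : ∀ ρ ∈ Ioo 0 t, U ρ =ᵐ[volume] u ρ)
    (hint : IntervalIntegrable (fun ρ => bilinOp p q (t - ρ) (U ρ) (U ρ)) volume 0 t)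
    (hq : q ≠ ⊤) :
    (∫ ρ in (0 : ℝ)..t, bilinOp p q (t - ρ) (U ρ) (U ρ) : VField d p) =ᵐ[volume]
      fun x => ∫ ρ in (0 : ℝ)..t, oseenQuadratic (t - ρ) (u ρ) x := by
  simp only [intervalIntegral.integral_of_le ht, integral_Ioc_eq_integral_Ioo]
  rw [intervalIntegrable_iff_integrableOn_Ioo_of_le ht] at hint
  have hF : AEStronglyMeasurable (Function.uncurry fun (ρ : ℝ) x =>
      oseenQuadratic (t - ρ) (U ρ) x) ((volume.restrict (Ioo 0 t)).prod volume) := by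
    have h1 : (volume.restrict (Ioo 0 t)).prod (volume : Measure (E d)) =
        (volume.prod volume).restrict (Ioo 0 t ×ˢ univ) := by
      rw [← Measure.prod_restrict, Measure.restrict_univ]
    rw [h1]
    exact (continuousOn_oseenQuadratic hr hU).aestronglyMeasurable
      (measurableSet_Ioo.prod MeasurableSet.univ)
  refine (coeFn_integral_lp hint hF ?_).trans (Eventually.of_forall fun x => ?_)
  · filter_upwards [ae_restrict_mem measurableSet_Ioo] with ρ hρ
    exact coeFn_bilinOp hq (sub_pos.2 hρ.2) (U ρ)
  · refine setIntegral_congr_fun measurableSet_Ioo fun ρ hρ => ?_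
    simp only [oseenQuadratic_congr (huU ρ hρ)]

/-- Abstract solutions are mild solutions. -/
theorem MildSystem.IsSol.isMildSolution (hr : r ≠ ⊤) (hu₀ : MemLp u₀ p volume)
    (hU : (navierStokes p q hq hs hs1 hsq).IsSol hu₀.toLp T U)
    (hu : ∀ t ∈ Ioo 0 T, U t =ᵐ[volume] u t) : IsMildSolution p u₀ T u where
  memLp := fun t ht => (memLp_congr_ae (hu t ht)).1 (Lp.memLp (U t))
  continuous := fun t ht => by
    have hmem := Ioo_mem_nhds ht.1 ht.2
    have h := (tendsto_iff_edist_tendsto_0.1 (hU.continuousOn.continuousAt hmem).tendsto)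
    refine h.congr' ?_
    filter_upwards [hmem] with ρ hρ
    exact edist_eq_eLpNorm_of_ae_eq (hu ρ hρ) (hu t ht)
  bounded := fun T' hT' => by
    obtain ⟨M, hM⟩ := hU.bounded T' hT'
    refine ⟨M, fun t ht => ?_⟩
    have ht' : t ∈ Ioo 0 T := ⟨ht.1, ht.2.trans_lt hT'⟩
    have hmem : MemLp (u t) p volume := (memLp_congr_ae (hu t ht')).1 (Lp.memLp (U t))
    have := hM t ht
    rw [norm_eq_eLpNorm_of_ae_eq (hu t ht')] at this
    rw [← ENNReal.ofReal_toReal hmem.2.ne]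
    exact ENNReal.ofReal_le_ofReal this
  duhamel := fun t ht => by
    have h1 := coeFn_integral_bilinOp hr ht.1.le
      (hU.continuousOn.mono (Ioo_subset_Ioo_right ht.2.le))
      (fun ρ hρ => hu ρ ⟨hρ.1, hρ.2.trans ht.2⟩) (hU.intervalIntegrable ht le_rfl) hq
    have h2 : U t = heatOp p (t, 0) hu₀.toLp -
      ∫ ρ in (0 : ℝ)..t, bilinOp p q (t - ρ) (U ρ) (U ρ) := hU.duhamel t ht
    filter_upwards [hu t ht, h1, coeFn_heatOp ht.1 hu₀, Lp.coeFn_sub (heatOp p (t, 0) hu₀.toLp)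
      (∫ ρ in (0 : ℝ)..t, bilinOp p q (t - ρ) (U ρ) (U ρ))] with x e1 e2 e3 e4
    rw [← e1, h2, e4, Pi.sub_apply, e2, e3]

open Classical in
/-- Mild solutions are abstract solutions. -/
theorem IsMildSolution.exists_isSol (hr : r ≠ ⊤) (hu₀ : MemLp u₀ p volume)
    (hu : IsMildSolution p u₀ T u) :
    ∃ U, (navierStokes p q hq hs hs1 hsq).IsSol hu₀.toLp T U ∧
      ∀ t ∈ Ioo 0 T, U t =ᵐ[volume] u t := by
  set U : ℝ → VField d p := fun t =>
    if ht : t ∈ Ioo 0 T then (hu.memLp t ht).toLp else 0 with hU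
  have hUu : ∀ t ∈ Ioo 0 T, U t =ᵐ[volume] u t := fun t ht => by
    rw [hU]
    simp only [dif_pos ht]
    exact (hu.memLp t ht).coeFn_toLp
  have hcont : ContinuousOn U (Ioo 0 T) := fun t ht => by
    refine ContinuousAt.continuousWithinAt (tendsto_iff_edist_tendsto_0.2 ?_)
    refine (hu.continuous t ht).congr' ?_
    filter_upwards [Ioo_mem_nhds ht.1 ht.2] with ρ hρ
    exact (edist_eq_eLpNorm_of_ae_eq (hUu ρ hρ) (hUu t ht)).symm
  have hbd : ∀ T' < T, ∃ M : ℝ, ∀ t ∈ Ioc 0 T', ‖U t‖ ≤ M := fun T' hT' => by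
    obtain ⟨M, hM⟩ := hu.bounded T' hT'
    refine ⟨max M 0, fun t ht => ?_⟩
    rw [norm_eq_eLpNorm_of_ae_eq (hUu t ⟨ht.1, ht.2.trans_lt hT'⟩)]
    exact ENNReal.toReal_le_of_le_ofReal (le_max_right _ _)
      ((hM t ht).trans (ENNReal.ofReal_le_ofReal (le_max_left _ _)))
  refine ⟨U, ⟨hcont, hbd, fun t ht => ?_⟩, hUu⟩
  obtain ⟨M, hM⟩ := hbd t ht.2
  have hc := hcont.mono (Ioo_subset_Ioo_right ht.2.le)
  have hb : ∀ ρ ∈ Ioo 0 t, ‖U ρ‖ ≤ M := fun ρ hρ => hM ρ ⟨hρ.1, hρ.2.le⟩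
  have hint := MildSystem.intervalIntegrable_integrand (P := navierStokes p q hq hs hs1 hsq)
    ht.1.le le_rfl hc hc hb hb
  have h1 := coeFn_integral_bilinOp hr ht.1.le hc
    (fun ρ hρ => hUu ρ ⟨hρ.1, hρ.2.trans ht.2⟩) hint hq
  change U t = heatOp p (t, 0) hu₀.toLp - ∫ ρ in (0 : ℝ)..t, bilinOp p q (t - ρ) (U ρ) (U ρ)
  apply Lp.ext
  filter_upwards [hUu t ht, h1, coeFn_heatOp ht.1 hu₀, Lp.coeFn_sub (heatOp p (t, 0) hu₀.toLp)
      (∫ ρ in (0 : ℝ)..t, bilinOp p q (t - ρ) (U ρ) (U ρ)), hu.duhamel t ht] with x e1 e2 e3 e4 e5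
  rw [e1, e4, Pi.sub_apply, e2, e3, e5]

end Equivalence

/-- Uniqueness and smoothness of mild solutions, given an abstract solution. -/
theorem MildSystem.IsSol.uniqueSmoothMildSolution [hqp : q.HolderConjugate p] (hr : r ≠ ⊤)
    {hq : q ≠ ⊤} {s : ℝ} {hs : 0 < s} {hs1 : s ≤ 1}
    {hsq : -((d : ℝ) + 1) / 2 + d / 2 / q.toReal = s - 1} {T : ℝ} {U : ℝ → VField d p}
    {u₀ : E d → E d} (hu₀ : MemLp u₀ p volume)
    (hU : (navierStokes p q hq hs hs1 hsq).IsSol hu₀.toLp T U) :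
    UniqueSmoothMildSolution p u₀ T := by
  obtain ⟨u, hsm, hu⟩ := exists_smooth_representative hU
  refine ⟨u, hU.isMildSolution hr hu₀ hu, hsm, fun T' hT' v hv t ht => ?_⟩
  obtain ⟨V, hV, hVv⟩ := hv.exists_isSol (hq := hq) (hs := hs) (hs1 := hs1) (hsq := hsq) hr hu₀
  have h := hV.unique (hU.mono hT') ht
  have h' := hVv t ht
  rw [h] at h'
  exact h'.symm.trans (hu t ⟨ht.1, ht.2.trans_le hT'⟩)

end NSFreq

end

/-! ### Control of the heat flow by the low frequencies. -/

noncomputable section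

namespace NSFreq

variable {d : ℕ}

section CutoffKernel

open scoped SchwartzMap

/-- The symbol is smooth with compact support, so its inverse Fourier transform is Schwartz, and the
integral of the latter is the value of the symbol at the origin. -/
theorem exists_schwartz_lowFreqKernel {χ : E d → ℝ} (hχ : IsLowFrequencyCutoff χ) :
    ∃ H : 𝓢(E d, ℂ), (∀ x, lowFreqKernel χ x = (H x).re) ∧ ∫ x, H x = 1 := by
  set g : E d → ℂ := fun ξ => ((χ ((2 * Real.pi) • ξ) : ℝ) : ℂ) with hg
  have hgs : ContDiff ℝ ∞ g :=
    Complex.ofRealCLM.contDiff.comp (hχ.smooth.comp (contDiff_const_smul _))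
  have hgc : HasCompactSupport g := by
    refine HasCompactSupport.intro (isCompact_closedBall (0 : E d) (4 / 3)) fun ξ hξ => ?_
    rw [mem_closedBall_zero_iff, not_le] at hξ
    have h1 : (1 : ℝ) ≤ 2 * Real.pi := by have := Real.pi_gt_three; linarith
    have h2 : χ ((2 * Real.pi) • ξ) = 0 := by
      refine hχ.eq_zero _ ?_
      rw [norm_smul, Real.norm_of_nonneg (by positivity)]
      nlinarith [norm_nonneg ξ]
    simp [hg, h2]
  set G : 𝓢(E d, ℂ) := hgc.toSchwartzMap hgs with hG
  have hGg : (G : E d → ℂ) = g := rfl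
  refine ⟨𝓕⁻ G, fun x => ?_, ?_⟩
  · rw [SchwartzMap.fourierInv_coe, hGg]
    rfl
  · have h1 : 𝓕 (𝓕⁻ G) = G := FourierTransform.fourier_fourierInv_eq G
    have h2 := DFunLike.congr_fun h1 0
    rw [SchwartzMap.fourier_coe, Real.fourier_eq] at h2
    simp only [inner_zero_right, neg_zero, AddChar.map_zero_eq_one, one_smul] at h2
    rw [h2, hGg, hg]
    simp [hχ.eq_one 0 (by rw [norm_zero]; norm_num)]

theorem continuous_lowFreqKernel {χ : E d → ℝ} (hχ : IsLowFrequencyCutoff χ) :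
    Continuous (lowFreqKernel χ) := by
  obtain ⟨H, hH, -⟩ := exists_schwartz_lowFreqKernel hχ
  rw [funext hH]
  exact Complex.continuous_re.comp H.continuous

theorem integrable_lowFreqKernel {χ : E d → ℝ} (hχ : IsLowFrequencyCutoff χ) :
    Integrable (lowFreqKernel χ) := by
  obtain ⟨H, hH, -⟩ := exists_schwartz_lowFreqKernel hχ
  rw [funext hH]
  exact H.integrable.re

theorem integral_lowFreqKernel {χ : E d → ℝ} (hχ : IsLowFrequencyCutoff χ) :
    ∫ x, lowFreqKernel χ x = 1 := by
  obtain ⟨H, hH, h1⟩ := exists_schwartz_lowFreqKernel hχ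
  simp_rw [hH]
  have h2 := integral_re (H.integrable (μ := volume))
  simp only [RCLike.re_to_complex] at h2
  rw [h2, h1]
  simp

theorem integrable_norm_mul_lowFreqKernel {χ : E d → ℝ} (hχ : IsLowFrequencyCutoff χ) :
    Integrable fun x => ‖x‖ * |lowFreqKernel χ x| := by
  obtain ⟨H, hH, -⟩ := exists_schwartz_lowFreqKernel hχ
  have h := H.integrable_pow_mul (volume : Measure (E d)) 1
  refine h.mono' (continuous_norm.mul
    (continuous_lowFreqKernel hχ).abs).aestronglyMeasurable (Eventually.of_forall fun x => ?_)
  rw [Real.norm_of_nonneg (by positivity), pow_one, hH]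
  gcongr
  exact Complex.abs_re_le_norm _

end CutoffKernel

section Rescaling

variable {h : E d → ℝ} {R : ℝ}

theorem integrable_rescaled (hR : 0 < R) (hh : Integrable h) :
    Integrable fun x => R ^ d * h (R • x) :=
  (hh.comp_smul hR.ne').const_mul _

theorem integral_rescaled (hR : 0 < R) : ∫ x, R ^ d * h (R • x) = ∫ x, h x := by
  rw [integral_const_mul, Measure.integral_comp_smul, finrank_euclideanSpace_fin,
    abs_of_pos (by positivity), smul_eq_mul, ← mul_assoc, mul_inv_cancel₀ (by positivity), one_mul]

theorem integrable_norm_mul_rescaled (hR : 0 < R) (hh : Integrable fun x => ‖x‖ * |h x|) :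
    Integrable fun x => ‖x‖ * |R ^ d * h (R • x)| := by
  refine ((integrable_rescaled hR hh).const_mul R⁻¹).congr (Eventually.of_forall fun x => ?_)
  simp only [norm_smul, Real.norm_of_nonneg hR.le, abs_mul, abs_of_pos (pow_pos hR d)]
  field_simp

/-- With R = 2^J this is the source of the factor 2^{-J} in the high-frequency bound. -/
theorem integral_norm_mul_rescaled (hR : 0 < R) :
    ∫ x, ‖x‖ * |R ^ d * h (R • x)| = R⁻¹ * ∫ x, ‖x‖ * |h x| := by
  rw [← integral_rescaled (h := fun x => ‖x‖ * |h x|) hR, ← integral_const_mul]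
  refine integral_congr_ae (Eventually.of_forall fun x => ?_)
  simp only [norm_smul, Real.norm_of_nonneg hR.le, abs_mul, abs_of_pos (pow_pos hR d)]
  field_simp

end Rescaling

section Approximation

/-- At t = 1, differentiability handles |b| < η, and for |b| ≥ η the trivial bound 2 is at most
(2/η)|b|. Parabolic scaling replaces b by b/√t. -/
theorem exists_norm_heatLp_one_sub_le : ∃ L : ℝ, 0 ≤ L ∧ ∀ t : ℝ, 0 < t → ∀ b : E d,
    ‖heatLp 1 ((t, 0) : ℝ × E d) - heatLp 1 (t, b)‖ ≤ L * (t ^ (-(1 / 2) : ℝ) * ‖b‖) := by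
  have hone : ∀ t : ℝ, 0 < t → ∀ b : E d, ‖heatLp 1 (t, b)‖ = 1 := fun t ht b =>
    norm_heatLp_one (π := (t, b)) ht
  have hd : HasFDerivAt (heatLp (d := d) 1) (fderiv ℝ (heatLp 1) (1, 0)) (1, 0) :=
    (isHeatFamily_heatLp (d := d) (q := 1) ENNReal.one_ne_top).hasFDerivAt one_pos
  set D := ‖fderiv ℝ (heatLp (d := d) 1) (1, 0)‖ with hD
  rw [hasFDerivAt_iff_isLittleO_nhds_zero, Asymptotics.isLittleO_iff] at hd
  obtain ⟨η, hη, hη2⟩ := Metric.eventually_nhds_iff.1 (hd one_pos)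
  have hunit : ∀ b : E d, ‖heatLp 1 ((1, 0) : ℝ × E d) - heatLp 1 (1, b)‖ ≤
      (D + 1 + 2 / η) * ‖b‖ := by
    intro b
    have hb : ‖((0, b) : ℝ × E d)‖ = ‖b‖ := by simp
    rcases lt_or_ge ‖b‖ η with hbη | hbη
    · have h1 := hη2 (y := (0, b)) (by rwa [dist_zero_right, hb])
      rw [hb, Prod.mk_add_mk, add_zero, zero_add, one_mul] at h1
      have h2 := (fderiv ℝ (heatLp (d := d) 1) (1, 0)).le_opNorm (0, b)
      rw [hb] at h2
      rw [norm_sub_rev]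
      calc _ ≤ ‖heatLp 1 ((1, b) : ℝ × E d) - heatLp 1 (1, 0) -
            fderiv ℝ (heatLp (d := d) 1) (1, 0) (0, b)‖ +
            ‖fderiv ℝ (heatLp (d := d) 1) (1, 0) (0, b)‖ := norm_le_norm_sub_add _ _
        _ ≤ ‖b‖ + D * ‖b‖ := add_le_add h1 h2
        _ ≤ _ := by nlinarith [norm_nonneg b, div_pos (two_pos (α := ℝ)) hη]
    · calc _ ≤ ‖heatLp 1 ((1, 0) : ℝ × E d)‖ + ‖heatLp 1 ((1, b) : ℝ × E d)‖ := norm_sub_le _ _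
        _ = 2 / η * η := by rw [hone _ one_pos, hone _ one_pos]; field_simp; norm_num
        _ ≤ 2 / η * ‖b‖ := by gcongr
        _ ≤ _ := by nlinarith [norm_nonneg b, norm_nonneg (fderiv ℝ (heatLp (d := d) 1) (1, 0))]
  refine ⟨D + 1 + 2 / η, by positivity, fun t ht b => ?_⟩
  obtain ⟨J, hJ, h⟩ := exists_scaling_heatLp_one (d := d) ht
  have hst : 0 < Real.sqrt t := Real.sqrt_pos.2 ht
  have h1 := h (1, 0) one_pos
  have h2 := h (1, (Real.sqrt t)⁻¹ • b) one_pos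
  simp only [mul_one, smul_zero, smul_smul, mul_inv_cancel₀ hst.ne', one_smul] at h1 h2
  rw [h1, h2, ← map_sub, hJ]
  refine (hunit _).trans ?_
  rw [norm_smul, norm_inv, Real.norm_of_nonneg hst.le, Real.sqrt_eq_rpow, Real.rpow_neg ht.le]

theorem heatKernel_le {t : ℝ} (ht : 0 < t) (x : E d) :
    heatKernel t x ≤ (4 * Real.pi * t) ^ (-(d : ℝ) / 2) := by
  rw [heatKernel_eq]
  refine mul_le_of_le_one_right (by positivity) (Real.exp_le_one_iff.2 ?_)
  have : 0 ≤ 1 / (4 * t) * ‖x‖ ^ 2 := by positivity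
  linarith

-- Since k has integral one, G - G * k = ∫ k(z) (G - G(· - z)) dz. Minkowski's inequality and the
-- Lipschitz bound for translates of G leave the first moment of k.
set_option maxHeartbeats 1000000 in
theorem norm_heatLp_sub_lpConv_le {L : ℝ} (hL : ∀ t : ℝ, 0 < t → ∀ b : E d,
      ‖heatLp 1 ((t, 0) : ℝ × E d) - heatLp 1 (t, b)‖ ≤ L * (t ^ (-(1 / 2) : ℝ) * ‖b‖))
    {k : E d → ℝ} (hk : Continuous k) (hk1 : MemLp k 1 volume) (hkint : ∫ x, k x = 1)
    (hkm : Integrable fun x => ‖x‖ * |k x|) {t : ℝ} (ht : 0 < t) :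
    ‖heatLp 1 ((t, 0) : ℝ × E d) -
      lpConv 1 (ContinuousLinearMap.lsmul ℝ ℝ) (heatLp 1 ((t, 0) : ℝ × E d)) hk1.toLp‖ ≤
      L * (t ^ (-(1 / 2) : ℝ) * ∫ x, ‖x‖ * |k x|) := by
  have hki : Integrable k := memLp_one_iff_integrable.1 hk1
  set H : E d → Lp ℝ 1 (volume : Measure (E d)) := fun z =>
    k z • (heatLp 1 ((t, 0) : ℝ × E d) - heatLp 1 (t, -z)) with hH
  have hHn : ∀ z, ‖H z‖ ≤ L * (t ^ (-(1 / 2) : ℝ) * (‖z‖ * |k z|)) := fun z => by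
    rw [hH, norm_smul, Real.norm_eq_abs]
    calc _ ≤ |k z| * (L * (t ^ (-(1 / 2) : ℝ) * ‖-z‖)) := by gcongr; exact hL t ht _
      _ = _ := by rw [norm_neg]; ring
  have hHc : Continuous H := by
    refine hk.smul (continuous_const.sub ?_)
    exact contDiffOn_heatLp_one.continuousOn.comp_continuous
      (f := fun z : E d => ((t, -z) : ℝ × E d)) (by fun_prop) fun z => ht
  have hHi : Integrable H := ((hkm.const_mul _).const_mul L).mono' hHc.aestronglyMeasurable
    (Eventually.of_forall hHn)
  have hF : Continuous (Function.uncurry fun (z x : E d) =>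
      k z * (heatKernel t x - heatKernel t (x - z))) := by
    have := continuous_heatKernel (d := d) t
    simp only [Function.uncurry_def]
    fun_prop
  have hint := coeFn_integral_lp hHi hF.aestronglyMeasurable (Eventually.of_forall fun z => by
    filter_upwards [Lp.coeFn_smul (k z) (heatLp 1 ((t, 0) : ℝ × E d) - heatLp 1 (t, -z)),
      Lp.coeFn_sub (heatLp 1 ((t, 0) : ℝ × E d)) (heatLp 1 (t, -z)),
      coeFn_heatLp ENNReal.one_ne_top (π := ((t, 0) : ℝ × E d)) ht,
      coeFn_heatLp ENNReal.one_ne_top (π := ((t, -z) : ℝ × E d)) ht] with x e1 e2 e3 e4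
    rw [hH]
    simp only
    rw [e1, Pi.smul_apply, e2, Pi.sub_apply, e3, e4, smul_eq_mul, add_zero, ← sub_eq_add_neg])
  have heq : heatLp 1 ((t, 0) : ℝ × E d) -
      lpConv 1 (ContinuousLinearMap.lsmul ℝ ℝ) (heatLp 1 ((t, 0) : ℝ × E d)) hk1.toLp =
      ∫ z, H z := by
    apply Lp.ext
    filter_upwards [hint, Lp.coeFn_sub (heatLp 1 ((t, 0) : ℝ × E d))
      (lpConv 1 (ContinuousLinearMap.lsmul ℝ ℝ) (heatLp 1 ((t, 0) : ℝ × E d)) hk1.toLp),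
      coeFn_heatLp ENNReal.one_ne_top (π := ((t, 0) : ℝ × E d)) ht,
      coeFn_lpConv 1 (ContinuousLinearMap.lsmul ℝ ℝ) (heatLp 1 ((t, 0) : ℝ × E d)) hk1.toLp]
      with x e1 e2 e3 e4
    rw [e1, e2, Pi.sub_apply, e3, e4, convolution_congr _
      (coeFn_heatLp ENNReal.one_ne_top (π := ((t, 0) : ℝ × E d)) ht) hk1.coeFn_toLp,
      convolution_eq_swap]
    simp only [add_zero, ContinuousLinearMap.lsmul_apply, smul_eq_mul, mul_sub]
    have hbd : Integrable fun z => k z * heatKernel t (x - z) := by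
      refine hki.mul_bdd (c := (4 * Real.pi * t) ^ (-(d : ℝ) / 2)) (Continuous.aestronglyMeasurable
        ((continuous_heatKernel t).comp (continuous_const.sub continuous_id)))
        (Eventually.of_forall fun z => ?_)
      rw [Real.norm_of_nonneg (heatKernel_nonneg ht _)]
      exact heatKernel_le ht _
    rw [integral_sub (hki.mul_const _) hbd, integral_mul_const, hkint, one_mul]
    simp only [mul_comm]
  rw [heq]
  refine (norm_integral_le_of_norm_le ((hkm.const_mul _).const_mul L)
    (Eventually.of_forall hHn)).trans (le_of_eq ?_)
  rw [integral_const_mul, integral_const_mul]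

variable {p : ℝ≥0∞} [hp1 : Fact (1 ≤ p)]

/-- The heat flow is controlled by the low frequencies. -/
theorem exists_norm_heatOp_le {χ : E d → ℝ} (hχ : IsLowFrequencyCutoff χ) :
    ∃ K : ℝ, 0 < K ∧ ∀ (p : ℝ≥0∞) [Fact (1 ≤ p)] (f : E d → E d) (hf : MemLp f p volume)
      (J t : ℝ), 0 < t → eLpNorm (lowFreq χ J f) p volume ≠ ⊤ ∧
      ‖heatOp p (t, 0) hf.toLp‖ ≤ (eLpNorm (lowFreq χ J f) p volume).toReal +
        K * (2 ^ J)⁻¹ * t ^ (-(1 / 2) : ℝ) * (eLpNorm f p volume).toReal := by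
  obtain ⟨L, hL0, hL⟩ := exists_norm_heatLp_one_sub_le (d := d)
  set m := ∫ x, ‖x‖ * |lowFreqKernel χ x| with hm
  have hm0 : 0 ≤ m := integral_nonneg fun x => by positivity
  -- L comes from the heat kernel and m is the first moment of the cutoff kernel, so the constant
  -- does not depend on p; the added 1 ensures positivity.
  refine ⟨L * m + 1, by positivity, fun p _ f hf J t ht => ?_⟩
  set R : ℝ := 2 ^ J with hR
  have hR0 : 0 < R := by positivity
  set k : E d → ℝ := fun x => R ^ d * lowFreqKernel χ (R • x) with hk
  have hkc : Continuous k := by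
    have := continuous_lowFreqKernel hχ
    fun_prop
  have hk1 : MemLp k 1 volume :=
    memLp_one_iff_integrable.2 (integrable_rescaled hR0 (integrable_lowFreqKernel hχ))
  have hkint : ∫ x, k x = 1 := by rw [integral_rescaled hR0, integral_lowFreqKernel hχ]
  have hkm := integrable_norm_mul_rescaled hR0 (integrable_norm_mul_lowFreqKernel hχ)
  have hkmi : ∫ x, ‖x‖ * |k x| = R⁻¹ * m := integral_norm_mul_rescaled hR0
  have hlow : convOp p hk1.toLp hf.toLp =ᵐ[volume] lowFreq χ J f := by
    refine (coeFn_lpConv _ _ _ _).trans ?_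
    rw [convolution_congr _ hk1.coeFn_toLp hf.coeFn_toLp]
    refine Eventually.of_forall fun x => ?_
    simp only [convolution_eq_swap, lowFreq, ContinuousLinearMap.lsmul_apply, hk, hR]
    rw [Real.rpow_mul (by norm_num), Real.rpow_natCast]
  have hlowm : MemLp (lowFreq χ J f) p volume :=
    (memLp_congr_ae hlow).1 (Lp.memLp _)
  have hlown : ‖convOp p hk1.toLp hf.toLp‖ = (eLpNorm (lowFreq χ J f) p volume).toReal := by
    rw [Lp.norm_def, eLpNorm_congr_ae hlow]
  have hassoc : heatOp p (t, 0) (convOp p hk1.toLp hf.toLp) = convOp p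
      (lpConv 1 (ContinuousLinearMap.lsmul ℝ ℝ) (heatLp 1 ((t, 0) : ℝ × E d)) hk1.toLp)
      hf.toLp := lpConv_assoc _ _ _ _
  -- The high-frequency part of the heat flow is convolution with G - G * k, so its L¹ norm bounds
  -- the operator on every Lᵖ.
  have hdiff : heatOp p (t, 0) hf.toLp - heatOp p (t, 0) (convOp p hk1.toLp hf.toLp) =
      convOp p (heatLp 1 ((t, 0) : ℝ × E d) -
        lpConv 1 (ContinuousLinearMap.lsmul ℝ ℝ) (heatLp 1 ((t, 0) : ℝ × E d)) hk1.toLp)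
        hf.toLp := by
    rw [hassoc, map_sub, sub_apply]
    rfl
  have hfn : ‖hf.toLp‖ = (eLpNorm f p volume).toReal := by rw [Lp.norm_toLp]
  refine ⟨hlowm.2.ne, ?_⟩
  calc _ ≤ ‖heatOp p (t, 0) (convOp p hk1.toLp hf.toLp)‖ +
        ‖heatOp p (t, 0) hf.toLp - heatOp p (t, 0) (convOp p hk1.toLp hf.toLp)‖ := by
        rw [add_comm]; exact norm_le_norm_sub_add _ _
    _ ≤ (eLpNorm (lowFreq χ J f) p volume).toReal +
        L * (t ^ (-(1 / 2) : ℝ) * (R⁻¹ * m)) * (eLpNorm f p volume).toReal := by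
      refine add_le_add ?_ ?_
      · rw [← hlown]
        exact norm_heatOp_apply_le (π := (t, 0)) ht _
      · rw [hdiff, ← hfn, ← hkmi]
        refine (ContinuousLinearMap.le_opNorm _ _).trans ?_
        gcongr
        exact (norm_convOp_apply_le _).trans (norm_heatLp_sub_lpConv_le hL hkc hk1 hkint hkm ht)
    _ ≤ _ := by
      have h1 : 0 ≤ t ^ (-(1 / 2) : ℝ) * R⁻¹ * (eLpNorm f p volume).toReal := by positivity
      have h2 : L * (t ^ (-(1 / 2) : ℝ) * (R⁻¹ * m)) * (eLpNorm f p volume).toReal =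
        L * m * (t ^ (-(1 / 2) : ℝ) * R⁻¹ * (eLpNorm f p volume).toReal) := by ring
      have h3 : (L * m + 1) * R⁻¹ * t ^ (-(1 / 2) : ℝ) * (eLpNorm f p volume).toReal =
        (L * m + 1) * (t ^ (-(1 / 2) : ℝ) * R⁻¹ * (eLpNorm f p volume).toReal) := by ring
      rw [h2, h3]
      gcongr
      linarith

end Approximation

end NSFreq

end

/-! ### Long existence from a small linear evolution, and the exponents. -/

noncomputable section

namespace NSFreq

variable {d : ℕ}

namespace MildSystem

variable {X : Type*} [NormedAddCommGroup X] [NormedSpace ℝ X] [CompleteSpace X]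
  (P : MildSystem d X)

theorem two_mul_rpow_le {s : ℝ} (hs1 : s ≤ 1) {t : ℝ} (ht : 0 < t) :
    (2 * t) ^ s ≤ 2 * t ^ s := by
  rw [Real.mul_rpow (by norm_num) ht.le]
  gcongr
  calc (2 : ℝ) ^ s ≤ 2 ^ (1 : ℝ) := Real.rpow_le_rpow_of_exponent_le (by norm_num) hs1
    _ = 2 := Real.rpow_one 2

/-- Lifespan 2t rather than t makes t an interior time, at which the solution can be estimated and
restarted. -/
theorem exists_sol_two_mul (x₀ : X) {t : ℝ} (ht : 0 < t)
    (h : 16 * P.C * (‖x₀‖ * t ^ P.s) ≤ P.s) :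
    ∃ U, P.IsSol x₀ (2 * t) U ∧ ∀ r ∈ Ioo 0 (2 * t), ‖U r‖ ≤ 2 * ‖x₀‖ := by
  refine P.exists_sol x₀ (mul_pos two_pos ht) ?_
  have hs := P.s_pos
  have hC := P.C_nonneg
  have h2 : 8 * ((2 * t) ^ P.s / P.s) * P.C * ‖x₀‖ = 8 * P.C * ‖x₀‖ * (2 * t) ^ P.s / P.s := by
    ring
  rw [h2, div_le_one hs]
  calc _ ≤ 8 * P.C * ‖x₀‖ * (2 * t ^ P.s) := by
        gcongr; exact two_mul_rpow_le P.s_le_one ht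
    _ = 16 * P.C * (‖x₀‖ * t ^ P.s) := by ring
    _ ≤ _ := h

/-- If the linear evolution is small at an early time, the solution exists for a long time. -/
theorem exists_sol_of_heat_le (x₀ : X) {T T₀ γ : ℝ} (hT : 0 < T) (hT₀ : 0 < T₀) (hγ : 0 < γ)
    (hsmallT : ‖x₀‖ * T ^ P.s = γ / (2 * (8 * P.C / P.s + 1)))
    (hsmallT₀ : 16 * P.C * (‖x₀‖ * T₀ ^ P.s * γ) ≤ P.s)
    (hheat : ‖P.H (T, 0) x₀‖ ≤ 3 / 4 * γ * ‖x₀‖) :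
    ∃ T₁ U, T₀ < T₁ ∧ P.IsSol x₀ T₁ U := by
  have hs := P.s_pos
  have hC := P.C_nonneg
  set D := 8 * P.C / P.s + 1 with hD
  have hD0 : 0 < D := by positivity
  have hCD : 8 * P.C ≤ D * P.s := by
    rw [hD, add_mul, div_mul_cancel₀ _ hs.ne']; linarith
  -- The value of D is chosen for this: 16 C γ/(2D) ≤ sγ is equivalent to 8C ≤ Ds.
  have hkey : 16 * P.C * (‖x₀‖ * T ^ P.s) ≤ P.s * γ := by
    rw [hsmallT, mul_div_assoc', div_le_iff₀ (by positivity)]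
    nlinarith
  -- For γ ≥ 1 the smallness at T₀ holds without the factor γ, and local existence from x₀ suffices.
  -- For γ < 1, `hkey` gives a solution on (0, 2T).
  rcases le_or_gt 1 γ with h1 | h1
  · obtain ⟨U, hU, -⟩ := P.exists_sol_two_mul x₀ hT₀ (le_trans (by
      have : 0 ≤ ‖x₀‖ * T₀ ^ P.s := by positivity
      exact mul_le_mul_of_nonneg_left (le_mul_of_one_le_right this h1) (by positivity)) hsmallT₀)
    exact ⟨2 * T₀, U, by linarith, hU⟩
  · obtain ⟨U, hU, hUb⟩ := P.exists_sol_two_mul x₀ hT (hkey.trans (by nlinarith))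
    have hTm : T ∈ Ioo 0 (2 * T) := ⟨hT, by linarith⟩
    have hb : ∀ r ∈ Ioo 0 T, ‖U r‖ ≤ 2 * ‖x₀‖ := fun r hr => hUb r ⟨hr.1, by linarith [hr.2]⟩
    have hUT : ‖U T‖ ≤ γ * ‖x₀‖ := by
      rw [hU.duhamel T hTm]
      have h2 := norm_integral_le (P := P) hT.le hb hb
      -- The nonlinear contribution uses up the quarter of γ that the linear bound leaves.
      have h3 : T ^ P.s / P.s * (P.C * (2 * ‖x₀‖) * (2 * ‖x₀‖)) ≤ 1 / 4 * γ * ‖x₀‖ := by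
        have : T ^ P.s / P.s * (P.C * (2 * ‖x₀‖) * (2 * ‖x₀‖)) =
          16 * P.C * (‖x₀‖ * T ^ P.s) / P.s * (1 / 4 * ‖x₀‖) := by ring
        rw [this]
        have h4 : 16 * P.C * (‖x₀‖ * T ^ P.s) / P.s ≤ γ := by
          rw [div_le_iff₀ hs, mul_comm γ]; exact hkey
        calc _ ≤ γ * (1 / 4 * ‖x₀‖) := by gcongr
          _ = _ := by ring
      calc _ ≤ _ := norm_sub_le _ _
        _ ≤ 3 / 4 * γ * ‖x₀‖ + 1 / 4 * γ * ‖x₀‖ := add_le_add hheat (h2.trans h3)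
        _ = _ := by ring
    obtain ⟨V, hV, -⟩ := P.exists_sol_two_mul (U T) hT₀ (le_trans (by
      have : ‖U T‖ * T₀ ^ P.s ≤ ‖x₀‖ * T₀ ^ P.s * γ := by
        calc _ ≤ γ * ‖x₀‖ * T₀ ^ P.s := by gcongr
          _ = _ := by ring
      gcongr) hsmallT₀)
    exact ⟨T + 2 * T₀, _, by linarith, hU.glue hTm hV (by linarith)⟩

end MildSystem

section Exponents

theorem exists_conjugate {a : ℝ≥0∞} (ha : 1 < a) :
    ∃ b : ℝ≥0∞, 1 ≤ b ∧ b ≠ ⊤ ∧ b⁻¹ + a⁻¹ = 1 := by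
  have h : a⁻¹ < 1 := ENNReal.inv_lt_one.2 ha
  refine ⟨(1 - a⁻¹)⁻¹, ENNReal.one_le_inv.2 tsub_le_self, ?_, ?_⟩
  · rw [Ne, ENNReal.inv_eq_top]
    exact (tsub_pos_of_lt h).ne'
  · rw [inv_inv, tsub_add_cancel_of_le h.le]

theorem inv_half (p : ℝ≥0∞) : (p / 2)⁻¹ = p⁻¹ + p⁻¹ := by
  rw [ENNReal.inv_div (Or.inl (by norm_num)) (Or.inl (by norm_num)), div_eq_mul_inv, two_mul]

theorem toReal_natCast_div (p : ℝ≥0∞) : ((d : ℝ≥0∞) / p).toReal = d * p⁻¹.toReal := by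
  rw [div_eq_mul_inv, ENNReal.toReal_mul, ENNReal.toReal_natCast]

theorem scalingExponent_pos {p : ℝ≥0∞} (hd : d ≠ 0) (hp : (d : ℝ≥0∞) < p) :
    0 < scalingExponent d p := by
  have h : (d : ℝ≥0∞) / p < 1 := by
    have hd0 : (d : ℝ≥0∞) ≠ 0 := by simpa using hd
    rw [ENNReal.div_lt_iff (Or.inr hd0) (Or.inr (ENNReal.natCast_ne_top d))]
    simpa using hp
  have h2 := (ENNReal.toReal_lt_toReal h.ne_top ENNReal.one_ne_top).2 h
  rw [ENNReal.toReal_one] at h2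
  unfold scalingExponent
  linarith

theorem scalingExponent_le_one (p : ℝ≥0∞) : scalingExponent d p ≤ 1 := by
  have := ENNReal.toReal_nonneg (a := (d : ℝ≥0∞) / p)
  unfold scalingExponent
  linarith

/-- The blow-up rate of the L^q kernel norm is the scaling-critical one: substituting 1/q = 1 - 1/p
leaves -½(1 + d/p). -/
theorem exponent_eq_scalingExponent {p q : ℝ≥0∞} (hp : p ≠ 0) (hq : q ≠ 0)
    (h : q⁻¹ + p⁻¹ = 1) :
    -((d : ℝ) + 1) / 2 + d / 2 / q.toReal = scalingExponent d p - 1 := by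
  have h1 : q⁻¹.toReal + p⁻¹.toReal = 1 := by
    rw [← ENNReal.toReal_add (ENNReal.inv_ne_top.2 hq) (ENNReal.inv_ne_top.2 hp), h,
      ENNReal.toReal_one]
  have h2 : (q.toReal)⁻¹ = 1 - p⁻¹.toReal := by rw [← ENNReal.toReal_inv]; linarith
  rw [scalingExponent, toReal_natCast_div, div_eq_mul_inv _ q.toReal, h2]
  ring

end Exponents

end NSFreq

end

/-! ### Choice of the constants and conclusion. -/

theorem corollary3p3 (d : ℕ) (hd : 3 ≤ d) (χ : NSFreq.E d → ℝ)
    (hχ : NSFreq.IsLowFrequencyCutoff χ) :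
    ∃ K : ℝ, 0 < K ∧ ∀ p : ℝ≥0∞, (d : ℝ≥0∞) < p →
      ∃ c₀ C : ℝ, 0 < c₀ ∧ c₀ ≤ 1 ∧ 0 < C ∧
        ∀ c : ℝ, 0 < c → c ≤ c₀ →
          ∀ u₀ : NSFreq.E d → NSFreq.E d, NSFreq.MemLpSigma p u₀ →
            ∀ T₀ γ T J : ℝ, 0 < T₀ → 0 < T →
              (eLpNorm u₀ p volume).toReal * T₀ ^ NSFreq.scalingExponent d p * γ = c →
              (eLpNorm u₀ p volume).toReal * T ^ NSFreq.scalingExponent d p = γ / (2 * C) →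
              K * γ⁻¹ * T ^ (-(1 / 2) : ℝ) ≤ (2 : ℝ) ^ J →
              NSFreq.SparseInFrequency χ p (γ / 2) J u₀ →
              ∃ T₁ : ℝ, T₀ < T₁ ∧ NSFreq.UniqueSmoothMildSolution p u₀ T₁ := by
  obtain ⟨K, hK, hlow⟩ := NSFreq.exists_norm_heatOp_le hχ
  -- The factor 4 turns the high-frequency remainder into at most γ/4.
  refine ⟨4 * K, by positivity, fun p hp => ?_⟩
  have hp3 : (3 : ℝ≥0∞) < p := lt_of_le_of_lt (by exact_mod_cast hd) hp
  have hp1 : (1 : ℝ≥0∞) < p := lt_trans (by norm_num) hp3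
  have hp2 : (1 : ℝ≥0∞) < p / 2 := by
    rw [ENNReal.lt_div_iff_mul_lt (Or.inl (by norm_num)) (Or.inl (by norm_num)), one_mul]
    exact lt_trans (by norm_num) hp3
  -- The exponent q serves both Young's inequality and pointwise evaluation on Lᵖ, and r evaluates
  -- the quadratic term, which lies in L^{p/2}. Both are finite because p/2 > 1.
  obtain ⟨q, hq1, hq, hqp⟩ := NSFreq.exists_conjugate hp1
  obtain ⟨r, hr1, hr, hrp⟩ := NSFreq.exists_conjugate hp2
  have : Fact (1 ≤ p) := ⟨hp1.le⟩
  have : Fact (1 ≤ p / 2) := ⟨hp2.le⟩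
  have : Fact (1 ≤ q) := ⟨hq1⟩
  have : Fact (1 ≤ r) := ⟨hr1⟩
  have : q.HolderConjugate p := ⟨by rw [hqp, inv_one]⟩
  have : r.HolderConjugate (p / 2) := ⟨by rw [hrp, inv_one]⟩
  have : ENNReal.HolderTriple p p (p / 2) := ⟨(NSFreq.inv_half p).symm⟩
  have : NSFreq.YoungTriple q (p / 2) p := ⟨by rw [NSFreq.inv_half, ← add_assoc, hqp]⟩
  have hs := NSFreq.scalingExponent_pos (d := d) (by omega) hp
  have hs1 := NSFreq.scalingExponent_le_one (d := d) p
  have hsq := NSFreq.exponent_eq_scalingExponent (d := d) (zero_lt_one.trans hp1).ne'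
    (zero_lt_one.trans_le hq1).ne' hqp
  set P := NSFreq.navierStokes p q hq hs hs1 hsq with hP
  have hPs : P.s = NSFreq.scalingExponent d p := rfl
  have hPC := P.C_nonneg
  -- The first constant guarantees 16 C c ≤ s for the restarted problem, the second is the D of
  -- `exists_sol_of_heat_le`; adding 1 covers C = 0.
  refine ⟨min 1 (P.s / (16 * P.C + 1)), 8 * P.C / P.s + 1, lt_min one_pos (by rw [hPs]; positivity),
    min_le_left _ _, by rw [hPs]; positivity, ?_⟩
  intro c hc hc0 u₀ hu₀ T₀ γ T J hT₀ hT hγc hTγ hJ hsparse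
  have hu := hu₀.1
  have hN : ‖hu.toLp‖ = (eLpNorm u₀ p volume).toReal := by rw [Lp.norm_toLp]
  rw [← hPs, ← hN] at hγc hTγ
  -- Positivity of γ is forced by the positive product that defines it.
  have hγ : 0 < γ := by
    have h1 : 0 ≤ ‖hu.toLp‖ * T₀ ^ P.s := by positivity
    by_contra h
    have h2 := mul_nonpos_of_nonneg_of_nonpos h1 (not_lt.1 h)
    rw [hγc] at h2
    exact absurd hc h2.not_gt
  obtain ⟨hfin, hheat⟩ := hlow p u₀ hu J T hT
  have hsp : (eLpNorm (NSFreq.lowFreq χ J u₀) p volume).toReal ≤ γ / 2 * ‖hu.toLp‖ := by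
    have h1 := ENNReal.toReal_mono (ENNReal.mul_ne_top ENNReal.ofReal_ne_top hu.2.ne) hsparse
    rwa [ENNReal.toReal_mul, ENNReal.toReal_ofReal (by positivity), ← hN] at h1
  have hKJ : K * ((2 : ℝ) ^ J)⁻¹ * T ^ (-(1 / 2) : ℝ) ≤ γ / 4 := by
    have hR : (0 : ℝ) < 2 ^ J := by positivity
    have h1 : 4 * K * T ^ (-(1 / 2) : ℝ) ≤ 2 ^ J * γ := by
      have h2 : 4 * K * γ⁻¹ * T ^ (-(1 / 2) : ℝ) = 4 * K * T ^ (-(1 / 2) : ℝ) / γ := by ring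
      rwa [h2, div_le_iff₀ hγ] at hJ
    have h3 : K * ((2 : ℝ) ^ J)⁻¹ * T ^ (-(1 / 2) : ℝ) =
      (4 * K * T ^ (-(1 / 2) : ℝ)) / (4 * 2 ^ J) := by field_simp
    rw [h3, div_le_iff₀ (by positivity)]
    linarith
  have hheat' : ‖P.H (T, 0) hu.toLp‖ ≤ 3 / 4 * γ * ‖hu.toLp‖ := by
    refine hheat.trans ?_
    rw [← hN]
    calc _ ≤ γ / 2 * ‖hu.toLp‖ + γ / 4 * ‖hu.toLp‖ := by gcongr
      _ = _ := by ring
  have hcs : 16 * P.C * (‖hu.toLp‖ * T₀ ^ P.s * γ) ≤ P.s := by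
    rw [hγc]
    have h1 := hc0.trans (min_le_right _ _)
    rw [le_div_iff₀ (by positivity)] at h1
    linarith
  obtain ⟨T₁, U, hT₁, hU⟩ := P.exists_sol_of_heat_le hu.toLp hT hT₀ hγ hTγ hcs hheat'
  exact ⟨T₁, hT₁, hU.uniqueSmoothMildSolution hr hu⟩
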